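/- **Conventions.** $2\text{-}\mathrm{Cat}$ is the category of small strict 2-categories and strict 2-functors; $gf$ denotes composition of 1-cells, $\beta\alpha$ vertical and $\beta * \alpha$ horizontal composition of 2-cells. $\Delta_1$ is the category $\{0 \to 1\}$ seen as a 2-category with only identity 2-cells, and $e$ is the terminal 2-category. A strict 2-functor $i : A \to B$ is a *sieve* if there is a strict 2-functor $\chi : B \to \Delta_1$ such that $i$ is the pullback along $\chi$ of the inclusion $e \to \Delta_1$ of the object $0$; a sieve is regarded as an inclusion. A *(normalised) oplax 2-functor* $F : C \to D$ assigns to objects, 1-cells $f : x \to y$ and 2-cells $\alpha : f \Rightarrow g$ of $C$ objects $F(x)$, 1-cells $F(f) : F(x) \to F(y)$ and 2-cells $F(\alpha) : F(f) \Rightarrow F(g)$ of $D$, and to composable 1-cells $x \xrightarrow{f} y \xrightarrow{g} z$ a constraint $F(g,f) : F(gf) \Rightarrow F(g)F(f)$, such that $F(1_x) = 1_{F(x)}$; $F(1_y, f) = 1_{F(f)} = F(f, 1_x)$; $(F(h) * F(g,f))\,F(h,gf) = (F(h,g) * F(f))\,F(hg,f)$; $F(\beta\alpha) = F(\beta)F(\alpha)$;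 $F(1_f) = 1_{F(f)}$; and $F(l,g)\,F(\beta * \alpha) = (F(\beta) * F(\alpha))\,F(k,f)$ for $\alpha : f \Rightarrow g$ and $\beta : k \Rightarrow l$ horizontally composable. Strict 2-functors are the oplax 2-functors with identity constraints; the composite $GF$ has constraints $G(F(g),F(f))\,G(F(g,f))$. An *oplax homotopy* from $F$ to $G$ (both $C \to D$) is an oplax 2-functor $H : \Delta_1 \times C \to D$ restricting to $F$ on $\{0\} \times C$ and to $G$ on $\{1\} \times C$. A *strong oplax deformation retract structure* on a sieve $i : A \to B$ is a pair $(r, H)$ where $r : B \to A$ is a strict 2-functor with $ri = 1_A$ and $H$ is an oplax homotopy from $ir$ to $1_B$, such that 1. $H(1_{\Delta_1} \times i) = i\,p_A$, where $p_A : \Delta_1 \times A \to A$ is the projection; 2. for all composable 1-cells $x \xrightarrow{f} y \xrightarrow{g} z$ of $B$ with $f$ in $A$, one has $H(0 \to 1, gf) = H(0 \to 1, g)\,H(0, f)$, and the corresponding constraint of $H$, at the pair $((0 \to 1, g), (1_0, f))$, is an identity. A *strong oplax deformation retract 2-sieve* is a sieve admitting such a structure. **Proposition 6.20.** Strong oplax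 deformation retract 2-sieves are stable under pushout in $2\text{-}\mathrm{Cat}$. More precisely, let $i : A \to B$ be a sieve of 2-categories and let $$\begin{array}{ccc} A & \xrightarrow{u} & A' \\ {\scriptstyle i}\downarrow & & \downarrow{\scriptstyle i'} \\ B & \xrightarrow{v} & B' \end{array}$$ be a pushout square of $2\text{-}\mathrm{Cat}$. Then $i'$ is a sieve, and for every strong oplax deformation retract structure $(r, H)$ on $i$ there is a unique strong oplax deformation retract structure $(r', H')$ on $i'$ such that $$r'v = ur \qquad\text{and}\qquad H'(1_{\Delta_1} \times v) = vH.$$ -/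

import Mathlib

open CategoryTheory

universe w

/-- A small strict 2-category, presented by its sets of objects (0-cells), 1-cells and 2-cells,
with sources, targets, identities and partially defined compositions.
A 1-cell `f` goes from `src f` to `tgt f`; a 2-cell `α` goes from `dom α` to `cod α`, which are
parallel 1-cells. Compositions are written in the classical order:
`comp g f` is `g ∘ f`, `vcomp β α` is `β α` (vertical), `hcomp β α` is `β * α` (horizontal). -/
structure TwoCat : Type (w + 1) where
  /-- objects -/
  Obj : Type w
  /-- 1-cells -/
  One : Type w
  /-- 2-cells -/
  Two : Type w
  src : One → Obj
  tgt : One → Obj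
  dom : Two → One
  cod : Two → One
  /-- the 2-cells are globular -/
  src_cod : ∀ α, src (cod α) = src (dom α)
  tgt_cod : ∀ α, tgt (cod α) = tgt (dom α)
  /-- identity 1-cell of an object -/
  one : Obj → One
  /-- identity 2-cell of a 1-cell -/
  two : One → Two
  /-- composition of 1-cells -/
  comp : ∀ g f : One, src g = tgt f → One
  /-- vertical composition of 2-cells -/
  vcomp : ∀ β α : Two, dom β = cod α → Two
  /-- horizontal composition of 2-cells -/
  hcomp : ∀ β α : Two, src (dom β) = tgt (dom α) → Two
  -- objects and 1-cells form a category
  src_one : ∀ x, src (one x) = x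
  tgt_one : ∀ x, tgt (one x) = x
  src_comp : ∀ g f h, src (comp g f h) = src f
  tgt_comp : ∀ g f h, tgt (comp g f h) = tgt g
  one_comp : ∀ f, comp (one (tgt f)) f (src_one _) = f
  comp_one : ∀ f, comp f (one (src f)) (tgt_one _).symm = f
  comp_assoc : ∀ k g f (h₁ : src k = tgt g) (h₂ : src g = tgt f),
    comp (comp k g h₁) f ((src_comp _ _ _).trans h₂) =
      comp k (comp g f h₂) (h₁.trans (tgt_comp _ _ _).symm)
  -- 1-cells and 2-cells form a category under vertical composition
  dom_two : ∀ f, dom (two f) = f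
  cod_two : ∀ f, cod (two f) = f
  dom_vcomp : ∀ β α h, dom (vcomp β α h) = dom α
  cod_vcomp : ∀ β α h, cod (vcomp β α h) = cod β
  two_vcomp : ∀ α, vcomp (two (cod α)) α (dom_two _) = α
  vcomp_two : ∀ α, vcomp α (two (dom α)) (cod_two _).symm = α
  vcomp_assoc : ∀ γ β α (h₁ : dom γ = cod β) (h₂ : dom β = cod α),
    vcomp (vcomp γ β h₁) α ((dom_vcomp _ _ _).trans h₂) =
      vcomp γ (vcomp β α h₂) (h₁.trans (cod_vcomp _ _ _).symm)
  -- objects and 2-cells form a category under horizontal composition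
  dom_hcomp : ∀ β α h, dom (hcomp β α h) = comp (dom β) (dom α) h
  cod_hcomp : ∀ β α h, cod (hcomp β α h) =
    comp (cod β) (cod α) ((src_cod β).trans (h.trans (tgt_cod α).symm))
  one_hcomp : ∀ α, hcomp (two (one (tgt (dom α)))) α (by rw [dom_two, src_one]) = α
  hcomp_one : ∀ α, hcomp α (two (one (src (dom α)))) (by rw [dom_two, tgt_one]) = α
  hcomp_assoc : ∀ γ β α (h₁ : src (dom γ) = tgt (dom β)) (h₂ : src (dom β) = tgt (dom α)),
    hcomp (hcomp γ β h₁) α (by rw [dom_hcomp, src_comp, h₂]) =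
      hcomp γ (hcomp β α h₂) (by rw [dom_hcomp, tgt_comp, h₁])
  -- horizontal composition is functorial for vertical composition
  hcomp_two : ∀ g f (h : src g = tgt f),
    hcomp (two g) (two f) (by rw [dom_two, dom_two, h]) = two (comp g f h)
  interchange : ∀ δ γ β α (h₁ : dom δ = cod γ) (h₂ : dom β = cod α)
    (h : src (dom γ) = tgt (dom α)),
    hcomp (vcomp δ γ h₁) (vcomp β α h₂) (by rw [dom_vcomp, dom_vcomp, h]) =
      vcomp (hcomp δ β (by rw [h₁, h₂, src_cod, tgt_cod, h])) (hcomp γ α h)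
        (by simp only [dom_hcomp, cod_hcomp, h₁, h₂])

namespace TwoCat

/-- A strict 2-functor. -/
@[ext]
structure StrictFunctor (C D : TwoCat.{w}) : Type w where
  obj : C.Obj → D.Obj
  map : C.One → D.One
  map₂ : C.Two → D.Two
  src_map : ∀ f, D.src (map f) = obj (C.src f)
  tgt_map : ∀ f, D.tgt (map f) = obj (C.tgt f)
  dom_map₂ : ∀ α, D.dom (map₂ α) = map (C.dom α)
  cod_map₂ : ∀ α, D.cod (map₂ α) = map (C.cod α)
  map_one : ∀ x, map (C.one x) = D.one (obj x)
  map_comp : ∀ g f h, map (C.comp g f h) =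
    D.comp (map g) (map f) (by rw [src_map, tgt_map, h])
  map₂_two : ∀ f, map₂ (C.two f) = D.two (map f)
  map₂_vcomp : ∀ β α h, map₂ (C.vcomp β α h) =
    D.vcomp (map₂ β) (map₂ α) (by rw [dom_map₂, cod_map₂, h])
  map₂_hcomp : ∀ β α h, map₂ (C.hcomp β α h) =
    D.hcomp (map₂ β) (map₂ α) (by rw [dom_map₂, dom_map₂, src_map, tgt_map, h])

/-- The category `2-Cat` of small strict 2-categories and strict 2-functors. -/
instance : Category.{w} TwoCat.{w} where
  Hom C D := StrictFunctor C D
  id C :=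
    { obj := fun x => x
      map := fun f => f
      map₂ := fun α => α
      src_map := fun _ => rfl
      tgt_map := fun _ => rfl
      dom_map₂ := fun _ => rfl
      cod_map₂ := fun _ => rfl
      map_one := fun _ => rfl
      map_comp := fun _ _ _ => rfl
      map₂_two := fun _ => rfl
      map₂_vcomp := fun _ _ _ => rfl
      map₂_hcomp := fun _ _ _ => rfl }
  comp {C D E} F G :=
    { obj := fun x => G.obj (F.obj x)
      map := fun f => G.map (F.map f)
      map₂ := fun α => G.map₂ (F.map₂ α)
      src_map := fun f => by rw [G.src_map, F.src_map]
      tgt_map := fun f => by rw [G.tgt_map, F.tgt_map]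
      dom_map₂ := fun α => by rw [G.dom_map₂, F.dom_map₂]
      cod_map₂ := fun α => by rw [G.cod_map₂, F.cod_map₂]
      map_one := fun x => by rw [F.map_one, G.map_one]
      map_comp := fun g f h => by simp only [F.map_comp, G.map_comp]
      map₂_two := fun f => by rw [F.map₂_two, G.map₂_two]
      map₂_vcomp := fun β α h => by simp only [F.map₂_vcomp, G.map₂_vcomp]
      map₂_hcomp := fun β α h => by simp only [F.map₂_hcomp, G.map₂_hcomp] }

/-- A normalised oplax 2-functor `F : C → D`, with constraints `F(g, f) : F(gf) ⇒ F(g)F(f)`. -/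
@[ext]
structure OplaxFunctor (C D : TwoCat.{w}) : Type w where
  obj : C.Obj → D.Obj
  map : C.One → D.One
  map₂ : C.Two → D.Two
  /-- the functoriality constraint `F(g, f)` -/
  constr : ∀ g f : C.One, C.src g = C.tgt f → D.Two
  src_map : ∀ f, D.src (map f) = obj (C.src f)
  tgt_map : ∀ f, D.tgt (map f) = obj (C.tgt f)
  dom_map₂ : ∀ α, D.dom (map₂ α) = map (C.dom α)
  cod_map₂ : ∀ α, D.cod (map₂ α) = map (C.cod α)
  dom_constr : ∀ g f h, D.dom (constr g f h) = map (C.comp g f h)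
  cod_constr : ∀ g f h, D.cod (constr g f h) =
    D.comp (map g) (map f) (by rw [src_map, tgt_map, h])
  -- normalisation
  map_one : ∀ x, map (C.one x) = D.one (obj x)
  constr_one_left : ∀ f, constr (C.one (C.tgt f)) f (C.src_one _) = D.two (map f)
  constr_one_right : ∀ f, constr f (C.one (C.src f)) (C.tgt_one _).symm = D.two (map f)
  -- cocycle condition
  cocycle : ∀ k g f (h₁ : C.src k = C.tgt g) (h₂ : C.src g = C.tgt f),
    D.vcomp
      (D.hcomp (D.two (map k)) (constr g f h₂)
        (by rw [D.dom_two, dom_constr, src_map, tgt_map, C.tgt_comp, h₁]))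
      (constr k (C.comp g f h₂) (h₁.trans (C.tgt_comp _ _ _).symm))
      (by simp only [D.dom_hcomp, D.dom_two, dom_constr, cod_constr]) =
    D.vcomp
      (D.hcomp (constr k g h₁) (D.two (map f))
        (by rw [D.dom_two, dom_constr, src_map, tgt_map, C.src_comp, h₂]))
      (constr (C.comp k g h₁) f ((C.src_comp _ _ _).trans h₂))
      (by simp only [D.dom_hcomp, D.dom_two, dom_constr, cod_constr])
  -- functoriality for vertical composition
  map₂_vcomp : ∀ β α h, map₂ (C.vcomp β α h) =
    D.vcomp (map₂ β) (map₂ α) (by rw [dom_map₂, cod_map₂, h])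
  map₂_two : ∀ f, map₂ (C.two f) = D.two (map f)
  -- naturality of the constraints: `F(l, g) F(β * α) = (F(β) * F(α)) F(k, f)`
  map₂_hcomp : ∀ β α (h : C.src (C.dom β) = C.tgt (C.dom α)),
    D.vcomp
      (constr (C.cod β) (C.cod α) ((C.src_cod β).trans (h.trans (C.tgt_cod α).symm)))
      (map₂ (C.hcomp β α h))
      (by rw [dom_constr, cod_map₂, C.cod_hcomp]) =
    D.vcomp
      (D.hcomp (map₂ β) (map₂ α) (by rw [dom_map₂, dom_map₂, src_map, tgt_map, h]))
      (constr (C.dom β) (C.dom α) h)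
      (by simp only [D.dom_hcomp, dom_map₂, cod_constr])

/-- A strict 2-functor, seen as a normalised oplax 2-functor with trivial constraints. -/
def StrictFunctor.toOplax {C D : TwoCat.{w}} (F : StrictFunctor C D) : OplaxFunctor C D where
  obj := F.obj
  map := F.map
  map₂ := F.map₂
  constr g f h := D.two (F.map (C.comp g f h))
  src_map := F.src_map
  tgt_map := F.tgt_map
  dom_map₂ := F.dom_map₂
  cod_map₂ := F.cod_map₂
  dom_constr g f h := D.dom_two _
  cod_constr g f h := by rw [D.cod_two, F.map_comp]
  map_one := F.map_one
  constr_one_left f := by rw [C.one_comp]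
  constr_one_right f := by rw [C.comp_one]
  cocycle k g f h₁ h₂ := by
    have e₁ := D.hcomp_two (F.map k) (F.map (C.comp g f h₂))
      (by rw [F.src_map, F.tgt_map, C.tgt_comp, h₁])
    have e₂ := D.hcomp_two (F.map (C.comp k g h₁)) (F.map f)
      (by rw [F.src_map, F.tgt_map, C.src_comp, h₂])
    have e₃ := F.map_comp k (C.comp g f h₂) (h₁.trans (C.tgt_comp _ _ _).symm)
    have e₄ := F.map_comp (C.comp k g h₁) f ((C.src_comp _ _ _).trans h₂)
    simp only [e₁, e₂, ← e₃, ← e₄, C.comp_assoc k g f h₁ h₂]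
  map₂_vcomp := F.map₂_vcomp
  map₂_two := F.map₂_two
  map₂_hcomp β α h := by
    have e₁ := D.two_vcomp (F.map₂ (C.hcomp β α h))
    have e₂ := D.vcomp_two (F.map₂ (C.hcomp β α h))
    simp only [F.cod_map₂, C.cod_hcomp, F.dom_map₂, C.dom_hcomp] at e₁ e₂
    rw [e₁]
    simp only [← F.map₂_hcomp β α h]
    exact e₂.symm

/-- A morphism of `2-Cat`, seen as a normalised oplax 2-functor. -/
abbrev oplax {C D : TwoCat.{w}} (F : C ⟶ D) : OplaxFunctor C D :=
  StrictFunctor.toOplax F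

theorem hcomp_two_vcomp (C : TwoCat.{w}) (k : C.One) (β α : C.Two) (h₁ : C.dom β = C.cod α)
    (h : C.src k = C.tgt (C.dom α)) :
    C.hcomp (C.two k) (C.vcomp β α h₁) (by rw [C.dom_two, C.dom_vcomp, h]) =
      C.vcomp (C.hcomp (C.two k) β (by rw [C.dom_two, h₁, C.tgt_cod, h]))
        (C.hcomp (C.two k) α (by rw [C.dom_two, h]))
        (by simp only [C.dom_hcomp, C.cod_hcomp, C.dom_two, C.cod_two, h₁]) := by
  rw [← C.interchange (C.two k) (C.two k) β α (by rw [C.dom_two, C.cod_two]) h₁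
    (by rw [C.dom_two, h])]
  have e := C.two_vcomp (C.two k)
  simp only [C.cod_two] at e
  simp only [e]

theorem hcomp_vcomp_two (C : TwoCat.{w}) (f : C.One) (β α : C.Two) (h₁ : C.dom β = C.cod α)
    (h : C.src (C.dom α) = C.tgt f) :
    C.hcomp (C.vcomp β α h₁) (C.two f) (by rw [C.dom_two, C.dom_vcomp, h]) =
      C.vcomp (C.hcomp β (C.two f) (by rw [C.dom_two, h₁, C.src_cod, h]))
        (C.hcomp α (C.two f) (by rw [C.dom_two, h]))
        (by simp only [C.dom_hcomp, C.cod_hcomp, C.dom_two, C.cod_two, h₁]) := by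
  rw [← C.interchange β α (C.two f) (C.two f) h₁ (by rw [C.dom_two, C.cod_two])
    (by rw [C.dom_two, h])]
  have e := C.two_vcomp (C.two f)
  simp only [C.cod_two] at e
  simp only [e]

theorem vcomp_middle (C : TwoCat.{w}) {a b c d e p : C.Two} {hab : C.dom a = C.cod b}
    {hcd : C.dom c = C.cod d} {hbc : C.dom b = C.cod c} {hae : C.dom a = C.cod e}
    {hep : C.dom e = C.cod p} {hpd : C.dom p = C.cod d}
    (H : C.vcomp e p hep = C.vcomp b c hbc)
    (h₁ : C.dom (C.vcomp a b hab) = C.cod (C.vcomp c d hcd))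
    (h₂ : C.dom (C.vcomp a e hae) = C.cod (C.vcomp p d hpd)) :
    C.vcomp (C.vcomp a b hab) (C.vcomp c d hcd) h₁ =
      C.vcomp (C.vcomp a e hae) (C.vcomp p d hpd) h₂ := by
  have e₁ := C.vcomp_assoc a b (C.vcomp c d hcd) hab (hbc.trans (C.cod_vcomp _ _ _).symm)
  have e₂ := C.vcomp_assoc b c d hbc hcd
  have e₃ := C.vcomp_assoc a e (C.vcomp p d hpd) hae (hep.trans (C.cod_vcomp _ _ _).symm)
  have e₄ := C.vcomp_assoc e p d hep hpd
  rw [e₁, e₃]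
  simp only [← e₂, ← e₄, H]

theorem OplaxFunctor.naturality {C D : TwoCat.{w}} (F : OplaxFunctor C D) (β α : C.Two)
    (g' f' g f : C.One) (hg' : C.cod β = g') (hf' : C.cod α = f') (hg : C.dom β = g)
    (hf : C.dom α = f) (h : C.src g = C.tgt f) (h' : C.src g' = C.tgt f') :
    D.vcomp (F.constr g' f' h') (F.map₂ (C.hcomp β α (by rw [hg, hf, h])))
      (by rw [F.dom_constr, F.cod_map₂, C.cod_hcomp]; subst hg' hf'; rfl) =
    D.vcomp (D.hcomp (F.map₂ β) (F.map₂ α)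
        (by rw [F.dom_map₂, F.dom_map₂, F.src_map, F.tgt_map, hg, hf, h]))
      (F.constr g f h)
      (by subst hg hf; rw [D.dom_hcomp, F.cod_constr]; simp only [F.dom_map₂]) := by
  subst hg' hf' hg hf
  exact F.map₂_hcomp β α h

/-- The composite `G ∘ F` of normalised oplax 2-functors; its constraint is
`G(F(g), F(f)) G(F(g, f))`. -/
def OplaxFunctor.comp {C D E : TwoCat.{w}} (G : OplaxFunctor D E) (F : OplaxFunctor C D) :
    OplaxFunctor C E where
  obj x := G.obj (F.obj x)
  map f := G.map (F.map f)
  map₂ α := G.map₂ (F.map₂ α)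
  constr g f h :=
    E.vcomp (G.constr (F.map g) (F.map f) (by rw [F.src_map, F.tgt_map, h]))
      (G.map₂ (F.constr g f h)) (by rw [G.dom_constr, G.cod_map₂, F.cod_constr])
  src_map f := by rw [G.src_map, F.src_map]
  tgt_map f := by rw [G.tgt_map, F.tgt_map]
  dom_map₂ α := by rw [G.dom_map₂, F.dom_map₂]
  cod_map₂ α := by rw [G.cod_map₂, F.cod_map₂]
  dom_constr g f h := by rw [E.dom_vcomp, G.dom_map₂, F.dom_constr]
  cod_constr g f h := by rw [E.cod_vcomp, G.cod_constr]
  map_one x := by rw [F.map_one, G.map_one]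
  constr_one_left f := by
    simp only [F.constr_one_left, G.map₂_two, F.map_one]
    have e := G.constr_one_left (F.map f)
    simp only [F.tgt_map] at e
    have e' := E.two_vcomp (E.two (G.map (F.map f)))
    simp only [e]
    simpa only [E.cod_two] using e'
  constr_one_right f := by
    simp only [F.constr_one_right, G.map₂_two, F.map_one]
    have e := G.constr_one_right (F.map f)
    simp only [F.src_map] at e
    have e' := E.two_vcomp (E.two (G.map (F.map f)))
    simp only [e]
    simpa only [E.cod_two] using e'
  cocycle k g f h₁ h₂ := by
    have hk : D.src (F.map k) = D.tgt (F.map g) := by rw [F.src_map, F.tgt_map, h₁]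
    have hg : D.src (F.map g) = D.tgt (F.map f) := by rw [F.src_map, F.tgt_map, h₂]
    have hkc : D.src (F.map k) = D.tgt (F.map (C.comp g f h₂)) := by
      rw [F.src_map, F.tgt_map, C.tgt_comp, h₁]
    have hcf : D.src (F.map (C.comp k g h₁)) = D.tgt (F.map f) := by
      rw [F.src_map, F.tgt_map, C.src_comp, h₂]
    have n₁ := G.naturality (D.two (F.map k)) (F.constr g f h₂) _ _ _ _ (D.cod_two _)
      (F.cod_constr g f h₂) (D.dom_two _) (F.dom_constr g f h₂) hkc
      (by rw [D.tgt_comp, hk])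
    have n₂ := G.naturality (F.constr k g h₁) (D.two (F.map f)) _ _ _ _
      (F.cod_constr k g h₁) (D.cod_two _) (F.dom_constr k g h₁) (D.dom_two _) hcf
      (by rw [D.src_comp, hg])
    have w₁ := E.hcomp_two_vcomp (G.map (F.map k)) (G.constr (F.map g) (F.map f) hg)
      (G.map₂ (F.constr g f h₂)) (by rw [G.dom_constr, G.cod_map₂, F.cod_constr])
      (by rw [G.dom_map₂, F.dom_constr, G.src_map, G.tgt_map, hkc])
    have w₂ := E.hcomp_vcomp_two (G.map (F.map f)) (G.constr (F.map k) (F.map g) hk)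
      (G.map₂ (F.constr k g h₁)) (by rw [G.dom_constr, G.cod_map₂, F.cod_constr])
      (by rw [G.dom_map₂, F.dom_constr, G.src_map, G.tgt_map, hcf])
    have cG := G.cocycle (F.map k) (F.map g) (F.map f) hk hg
    have cF := F.cocycle k g f h₁ h₂
    simp only [G.map₂_two] at n₁ n₂
    have cF' := congrArg G.map₂ cF
    rw [G.map₂_vcomp, G.map₂_vcomp] at cF'
    simp only [w₁, w₂]
    rw [E.vcomp_middle n₁, E.vcomp_middle n₂]
    · simp only [cG, cF']
    all_goals simp only [E.dom_vcomp, E.cod_vcomp, E.dom_hcomp, E.dom_two,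
      G.dom_constr, G.cod_constr, G.dom_map₂, G.cod_map₂, D.dom_hcomp, D.cod_hcomp, D.dom_two,
      D.cod_two, F.dom_constr, F.cod_constr]
  map₂_vcomp β α h := by simp only [F.map₂_vcomp, G.map₂_vcomp]
  map₂_two f := by rw [F.map₂_two, G.map₂_two]
  map₂_hcomp β α h := by
    have hd : D.src (F.map (C.dom β)) = D.tgt (F.map (C.dom α)) := by
      rw [F.src_map, F.tgt_map, h]
    have hc : D.src (F.map (C.cod β)) = D.tgt (F.map (C.cod α)) := by
      rw [F.src_map, F.tgt_map, C.src_cod, C.tgt_cod, h]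
    have n := G.naturality (F.map₂ β) (F.map₂ α) _ _ _ _ (F.cod_map₂ β) (F.cod_map₂ α)
      (F.dom_map₂ β) (F.dom_map₂ α) hd hc
    have e := congrArg G.map₂ (F.map₂_hcomp β α h)
    rw [G.map₂_vcomp, G.map₂_vcomp] at e
    have a₁ := E.vcomp_assoc (G.constr (F.map (C.cod β)) (F.map (C.cod α)) hc)
      (G.map₂ (F.constr (C.cod β) (C.cod α)
        ((C.src_cod β).trans (h.trans (C.tgt_cod α).symm))))
      (G.map₂ (F.map₂ (C.hcomp β α h))) (by rw [G.dom_constr, G.cod_map₂, F.cod_constr])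
      (by simp only [G.dom_map₂, G.cod_map₂, F.dom_constr, F.cod_map₂, C.cod_hcomp])
    have a₂ := E.vcomp_assoc (G.constr (F.map (C.cod β)) (F.map (C.cod α)) hc)
      (G.map₂ (D.hcomp (F.map₂ β) (F.map₂ α)
        (by rw [F.dom_map₂, F.dom_map₂, F.src_map, F.tgt_map, h])))
      (G.map₂ (F.constr (C.dom β) (C.dom α) h))
      (by simp only [G.dom_constr, G.cod_map₂, D.cod_hcomp, F.cod_map₂])
      (by simp only [G.dom_map₂, G.cod_map₂, D.dom_hcomp, F.dom_map₂, F.cod_constr])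
    have a₃ := E.vcomp_assoc (E.hcomp (G.map₂ (F.map₂ β)) (G.map₂ (F.map₂ α))
        (by rw [G.dom_map₂, G.dom_map₂, G.src_map, G.tgt_map, F.dom_map₂, F.dom_map₂, hd]))
      (G.constr (F.map (C.dom β)) (F.map (C.dom α)) hd)
      (G.map₂ (F.constr (C.dom β) (C.dom α) h))
      (by simp only [E.dom_hcomp, G.dom_map₂, F.dom_map₂, G.cod_constr])
      (by rw [G.dom_constr, G.cod_map₂, F.cod_constr])
    rw [a₁]
    simp only [e]
    rw [← a₂]
    simp only [n]
    exact a₃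

/-- The product of two 2-categories, formed componentwise. -/
abbrev prod (C D : TwoCat.{w}) : TwoCat.{w} where
  Obj := C.Obj × D.Obj
  One := C.One × D.One
  Two := C.Two × D.Two
  src f := (C.src f.1, D.src f.2)
  tgt f := (C.tgt f.1, D.tgt f.2)
  dom α := (C.dom α.1, D.dom α.2)
  cod α := (C.cod α.1, D.cod α.2)
  src_cod α := by rw [C.src_cod, D.src_cod]
  tgt_cod α := by rw [C.tgt_cod, D.tgt_cod]
  one x := (C.one x.1, D.one x.2)
  two f := (C.two f.1, D.two f.2)
  comp g f h := (C.comp g.1 f.1 (Prod.ext_iff.1 h).1, D.comp g.2 f.2 (Prod.ext_iff.1 h).2)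
  vcomp β α h := (C.vcomp β.1 α.1 (Prod.ext_iff.1 h).1, D.vcomp β.2 α.2 (Prod.ext_iff.1 h).2)
  hcomp β α h := (C.hcomp β.1 α.1 (Prod.ext_iff.1 h).1, D.hcomp β.2 α.2 (Prod.ext_iff.1 h).2)
  src_one x := by rw [C.src_one, D.src_one]
  tgt_one x := by rw [C.tgt_one, D.tgt_one]
  src_comp g f h := by rw [C.src_comp, D.src_comp]
  tgt_comp g f h := by rw [C.tgt_comp, D.tgt_comp]
  one_comp f := by simp only [C.one_comp, D.one_comp]
  comp_one f := by simp only [C.comp_one, D.comp_one]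
  comp_assoc k g f h₁ h₂ :=
    Prod.ext (C.comp_assoc k.1 g.1 f.1 (Prod.ext_iff.1 h₁).1 (Prod.ext_iff.1 h₂).1)
      (D.comp_assoc k.2 g.2 f.2 (Prod.ext_iff.1 h₁).2 (Prod.ext_iff.1 h₂).2)
  dom_two f := by rw [C.dom_two, D.dom_two]
  cod_two f := by rw [C.cod_two, D.cod_two]
  dom_vcomp β α h := by rw [C.dom_vcomp, D.dom_vcomp]
  cod_vcomp β α h := by rw [C.cod_vcomp, D.cod_vcomp]
  two_vcomp α := by simp only [C.two_vcomp, D.two_vcomp]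
  vcomp_two α := by simp only [C.vcomp_two, D.vcomp_two]
  vcomp_assoc γ β α h₁ h₂ :=
    Prod.ext (C.vcomp_assoc γ.1 β.1 α.1 (Prod.ext_iff.1 h₁).1 (Prod.ext_iff.1 h₂).1)
      (D.vcomp_assoc γ.2 β.2 α.2 (Prod.ext_iff.1 h₁).2 (Prod.ext_iff.1 h₂).2)
  dom_hcomp β α h := by rw [C.dom_hcomp, D.dom_hcomp]
  cod_hcomp β α h := by rw [C.cod_hcomp, D.cod_hcomp]
  one_hcomp α := by simp only [C.one_hcomp, D.one_hcomp]
  hcomp_one α := by simp only [C.hcomp_one, D.hcomp_one]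
  hcomp_assoc γ β α h₁ h₂ :=
    Prod.ext (C.hcomp_assoc γ.1 β.1 α.1 (Prod.ext_iff.1 h₁).1 (Prod.ext_iff.1 h₂).1)
      (D.hcomp_assoc γ.2 β.2 α.2 (Prod.ext_iff.1 h₁).2 (Prod.ext_iff.1 h₂).2)
  hcomp_two g f h :=
    Prod.ext (C.hcomp_two g.1 f.1 (Prod.ext_iff.1 h).1)
      (D.hcomp_two g.2 f.2 (Prod.ext_iff.1 h).2)
  interchange δ γ β α h₁ h₂ h :=
    Prod.ext (C.interchange δ.1 γ.1 β.1 α.1 (Prod.ext_iff.1 h₁).1 (Prod.ext_iff.1 h₂).1 (Prod.ext_iff.1 h).1)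
      (D.interchange δ.2 γ.2 β.2 α.2 (Prod.ext_iff.1 h₁).2 (Prod.ext_iff.1 h₂).2 (Prod.ext_iff.1 h).2)

/-- The second projection `C × D → D`. -/
def prodSnd (C D : TwoCat.{w}) : prod C D ⟶ D where
  obj := Prod.snd
  map := Prod.snd
  map₂ := Prod.snd
  src_map _ := rfl
  tgt_map _ := rfl
  dom_map₂ _ := rfl
  cod_map₂ _ := rfl
  map_one _ := rfl
  map_comp _ _ _ := rfl
  map₂_two _ := rfl
  map₂_vcomp _ _ _ := rfl
  map₂_hcomp _ _ _ := rfl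

/-- The 2-functor `1_C × F : C × D → C × E`. -/
def prodMap (C : TwoCat.{w}) {D E : TwoCat.{w}} (F : D ⟶ E) : prod C D ⟶ prod C E where
  obj x := (x.1, F.obj x.2)
  map f := (f.1, F.map f.2)
  map₂ α := (α.1, F.map₂ α.2)
  src_map f := by simp only [prod, F.src_map]
  tgt_map f := by simp only [prod, F.tgt_map]
  dom_map₂ α := by simp only [prod, F.dom_map₂]
  cod_map₂ α := by simp only [prod, F.cod_map₂]
  map_one x := by simp only [prod, F.map_one]
  map_comp g f h := by simp only [prod, F.map_comp]
  map₂_two f := by simp only [prod, F.map₂_two]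
  map₂_vcomp β α h := by simp only [prod, F.map₂_vcomp]
  map₂_hcomp β α h := by simp only [prod, F.map₂_hcomp]

/-- The 2-category attached to a preordered set `P`: its objects are the elements of `P`, there is
exactly one 1-cell `p → q` if `p ≤ q` and none otherwise, and all 2-cells are identities (so that
the set of 2-cells is the set of 1-cells). -/
def ofPreorder (P : Type w) [Preorder P] : TwoCat.{w} where
  Obj := P
  One := {p : P × P // p.1 ≤ p.2}
  Two := {p : P × P // p.1 ≤ p.2}
  src f := f.1.1
  tgt f := f.1.2
  dom α := α
  cod α := α
  src_cod _ := rfl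
  tgt_cod _ := rfl
  one x := ⟨(x, x), le_refl x⟩
  two f := f
  comp g f h := ⟨(f.1.1, g.1.2), f.2.trans (h.symm.le.trans g.2)⟩
  vcomp _ α _ := α
  hcomp g f h := ⟨(f.1.1, g.1.2), f.2.trans (h.symm.le.trans g.2)⟩
  src_one _ := rfl
  tgt_one _ := rfl
  src_comp _ _ _ := rfl
  tgt_comp _ _ _ := rfl
  one_comp _ := rfl
  comp_one _ := rfl
  comp_assoc _ _ _ _ _ := rfl
  dom_two _ := rfl
  cod_two _ := rfl
  dom_vcomp _ _ _ := rfl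
  cod_vcomp _ _ h := h.symm
  two_vcomp _ := rfl
  vcomp_two _ := rfl
  vcomp_assoc _ _ _ _ _ := rfl
  dom_hcomp _ _ _ := rfl
  cod_hcomp _ _ _ := rfl
  one_hcomp _ := rfl
  hcomp_one _ := rfl
  hcomp_assoc _ _ _ _ _ := rfl
  hcomp_two _ _ _ := rfl
  interchange _ _ _ _ _ _ _ := rfl

/-- The point `e`: the 2-category with one object and only identity cells. -/
def point : TwoCat.{w} := ofPreorder PUnit.{w + 1}

/-- The category `Δ₁ = {0 → 1}`, seen as a 2-category. -/
def interval : TwoCat.{w} := ofPreorder (ULift.{w} (Fin 2))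

/-- The constant 2-functor `C → D` with value the object `x`. -/
def const (C : TwoCat.{w}) {D : TwoCat.{w}} (x : D.Obj) : C ⟶ D where
  obj _ := x
  map _ := D.one x
  map₂ _ := D.two (D.one x)
  src_map _ := D.src_one x
  tgt_map _ := D.tgt_one x
  dom_map₂ _ := D.dom_two _
  cod_map₂ _ := D.cod_two _
  map_one _ := rfl
  map_comp _ _ _ := by
    have e := D.one_comp (D.one x)
    simp only [D.tgt_one] at e
    exact e.symm
  map₂_two _ := rfl
  map₂_vcomp _ _ _ := by
    have e := D.two_vcomp (D.two (D.one x))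
    simp only [D.cod_two] at e
    exact e.symm
  map₂_hcomp _ _ _ := by
    have e := D.one_hcomp (D.two (D.one x))
    simp only [D.dom_two, D.tgt_one] at e
    exact e.symm

/-- The object `ε` of `Δ₁`, for `ε = 0, 1`. -/
def endpt (ε : Fin 2) : interval.{w}.Obj := ULift.up ε

/-- The non-identity 1-cell `0 → 1` of `Δ₁`. -/
def arrow : interval.{w}.One := ⟨(ULift.up 0, ULift.up 1), ULift.up_le.2 (Fin.zero_le 1)⟩

/-- The 2-functor `∂_ε^A : A → Δ₁ × A`, `a ↦ (ε, a)`. -/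
def face (ε : Fin 2) (A : TwoCat.{w}) : A ⟶ prod interval A where
  obj x := (endpt ε, x)
  map f := (interval.one (endpt ε), f)
  map₂ α := (interval.two (interval.one (endpt ε)), α)
  src_map _ := rfl
  tgt_map _ := rfl
  dom_map₂ _ := rfl
  cod_map₂ _ := rfl
  map_one _ := rfl
  map_comp _ _ _ := rfl
  map₂_two _ := rfl
  map₂_vcomp _ _ _ := rfl
  map₂_hcomp _ _ _ := rfl

/-- A 2-functor `i : A → B` is a sieve if it is the inverse image of `∂₀ : e → Δ₁`, the inclusion
of the object `0`, along some 2-functor `χ : B → Δ₁`. -/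
def IsSieve {A B : TwoCat.{w}} (i : A ⟶ B) : Prop :=
  ∃ (χ : B ⟶ interval.{w}) (p : A ⟶ point.{w}),
    IsPullback i p χ (const point.{w} (endpt 0))

/-- A (normalised) oplax homotopy from `F` to `G`. -/
structure OplaxHomotopy {A B : TwoCat.{w}} (F G : OplaxFunctor A B) : Type w where
  H : OplaxFunctor (prod interval A) B
  at_zero : H.comp (oplax (face 0 A)) = F
  at_one : H.comp (oplax (face 1 A)) = G

/-- A structure of strong oplax deformation retract on `i : A → B` (where `i` is a sieve, seen as
an inclusion): a strict retraction `r` of `i` and a normalised oplax homotopy from `i r` to `1_B`,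
relative to `A`, which is strictly compatible with precomposition by the 1-cells of `A`. -/
structure StrongOplaxRetract {A B : TwoCat.{w}} (i : A ⟶ B) : Type w where
  r : B ⟶ A
  retraction : i ≫ r = 𝟙 A
  homotopy : OplaxHomotopy (oplax (r ≫ i)) (oplax (𝟙 B))
  -- `H (1 × i) = i p_A`
  relative : homotopy.H.comp (oplax (prodMap interval i)) = oplax (prodSnd interval A ≫ i)
  -- `H(0 → 1, g f) = H(0 → 1, g) H(0, f)` for composable `g` in `B` and `f` in `A`
  map_comp : ∀ (g : B.One) (f : A.One) (h : B.src g = B.tgt (i.map f)),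
    homotopy.H.map (arrow, B.comp g (i.map f) h) =
      B.comp (homotopy.H.map (arrow, g)) (homotopy.H.map (interval.one (endpt 0), i.map f))
        (by rw [homotopy.H.src_map, homotopy.H.tgt_map]; exact congrArg _ (Prod.ext rfl h))
  -- and the corresponding constraint is an identity
  constr_eq : ∀ (g : B.One) (f : A.One) (h : B.src g = B.tgt (i.map f)),
    homotopy.H.constr (arrow, g) (interval.one (endpt 0), i.map f)
        (Prod.ext rfl h) =
      B.two (homotopy.H.map (arrow, B.comp g (i.map f) h))

/-- A strong oplax deformation retract 2-sieve. -/
def IsStrongOplaxRetractSieve {A B : TwoCat.{w}} (i : A ⟶ B) : Prop :=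
  IsSieve i ∧ Nonempty (StrongOplaxRetract i)

end TwoCat

/-! Since `A` is a sieve, no cell of `B` goes from outside `A` into `A`. A 1-cell of `B'` is
therefore of one of three kinds: it lies in `A'`, or it comes from a 1-cell of `B` with source
outside `A`, or it is a composite `v(g) i'(k)` with `g` leaving `A` and `k` in `A'` (`one_cases`).
The 2-cells with target outside `A'` are the vertical composites of the analogous 2-cells
(`generated`). Put differently, for `c` outside `A`, the cells of `B'` from `A'` to `v(c)` form the
right `A'`-module induced along `u` from the right `A`-module of cells of `B` from `A` to `c`. That
`i'` is a sieve, and that `v` is injective outside `A`, is detected by a 2-functor from `B'` to the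
join of `A'` and `B`, which collapses parallel cells of `B` leaving `A` (`exists_sievePushout`).

The conditions on `H` amount to linearity over `A` (`IsLinear`): `H` is constant on `A`, and over
each 1-cell `ε` of `Δ₁` it commutes with precomposition by 1-cells of `A`, with identity
constraints. The cocycle condition then gives `H((ε,g),(η,fk)) = H((ε,g),(η,f)) * k` and
`H((ε,gk),(η,m)) = H((ε,g),(η,km))` (`con_cmp`, `cmp_con`). Hence a linear cylinder on `B'` is
determined by its values on `A'` and `B` (`IsLinear.agree`), which is uniqueness. The retraction
`r'` can only be glued from `1` and `ur`.

For existence, `vH` is linear, and each of its parts (the cells over a fixed `ε`, the constraints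
with one variable fixed) is a map of right modules, to be extended to the induced modules
(`HomMap.exists_extend`). This is a Yoneda argument, based on the universal property of the pushout.
Let `φ` be a linear map from the cells of `B` with target `c` to the cells of `W` with target `z`.
To each object `x` of `B'` is attached the category of 1-cells `w : o(x) → z` of `W`, equipped, when
`x` is outside `A'`, with a 1-cell of `B` (a tag) that `φ` sends to `w`. Here `A'` acts by
precomposition in `W` and `B` by precomposition of tags; linearity of `φ` says that the two actions
agree over `A`, so they glue to an action of `B'`. The extension of `φ` sends `f : x → v(c)` to the
result of letting `f` act on `φ(1_c)`, tagged by `1_c`.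

Constraints are 2-cells of the target `D`; they become 1-cells in the 2-category `horizontal D`,
where composition is horizontal composition, and the same extension theorem applies. The axioms of
an oplax 2-functor for the extended data follow by induction on composable pairs and triples
(`pair_induction`, `triple_induction`, `pair_induction₂`). -/

namespace TwoCat

/-! ### Composition operations extended to all pairs of cells -/

section Total

variable (C : TwoCat.{w})

open Classical in
/-- Composition of 1-cells, extended by `g` to pairs that are not composable. -/
noncomputable def cmp (g f : C.One) : C.One :=
  if h : C.src g = C.tgt f then C.comp g f h else g

open Classical in
/-- Vertical composition, extended by `β` to pairs that are not composable. -/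
noncomputable def vc (β α : C.Two) : C.Two :=
  if h : C.dom β = C.cod α then C.vcomp β α h else β

open Classical in
/-- Horizontal composition, extended by `β` to pairs that are not composable. -/
noncomputable def hc (β α : C.Two) : C.Two :=
  if h : C.src (C.dom β) = C.tgt (C.dom α) then C.hcomp β α h else β

variable {C}

/-- Passage to the total operations: their terms contain no proof of composability, so rewriting
inside them is unobstructed. -/
theorem comp_eq {g f : C.One} (h : C.src g = C.tgt f) : C.comp g f h = C.cmp g f :=
  (dif_pos h).symm

theorem vcomp_eq {β α : C.Two} (h : C.dom β = C.cod α) : C.vcomp β α h = C.vc β α :=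
  (dif_pos h).symm

theorem hcomp_eq {β α : C.Two} (h : C.src (C.dom β) = C.tgt (C.dom α)) :
    C.hcomp β α h = C.hc β α :=
  (dif_pos h).symm

theorem src_cmp {g f : C.One} (h : C.src g = C.tgt f) : C.src (C.cmp g f) = C.src f := by
  rw [← comp_eq h, C.src_comp]

@[simp] theorem tgt_cmp {g f : C.One} : C.tgt (C.cmp g f) = C.tgt g := by
  unfold cmp; split_ifs
  · rw [C.tgt_comp]
  · rfl

theorem one_cmp {x : C.Obj} {f : C.One} (h : x = C.tgt f) : C.cmp (C.one x) f = f := by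
  subst h; rw [← comp_eq (C.src_one _), C.one_comp]

theorem cmp_one {x : C.Obj} {f : C.One} (h : x = C.src f) : C.cmp f (C.one x) = f := by
  subst h; rw [← comp_eq (C.tgt_one _).symm, C.comp_one]

theorem cmp_assoc {k g f : C.One} (h₁ : C.src k = C.tgt g) (h₂ : C.src g = C.tgt f) :
    C.cmp (C.cmp k g) f = C.cmp k (C.cmp g f) := by
  have := C.comp_assoc k g f h₁ h₂
  simpa only [comp_eq] using this

theorem dom_vc {β α : C.Two} (h : C.dom β = C.cod α) : C.dom (C.vc β α) = C.dom α := by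
  rw [← vcomp_eq h, C.dom_vcomp]

@[simp] theorem cod_vc {β α : C.Two} : C.cod (C.vc β α) = C.cod β := by
  unfold vc; split_ifs
  · rw [C.cod_vcomp]
  · rfl

theorem two_vc {f : C.One} {α : C.Two} (h : f = C.cod α) : C.vc (C.two f) α = α := by
  subst h; rw [← vcomp_eq (C.dom_two _), C.two_vcomp]

theorem vc_two {f : C.One} {α : C.Two} (h : f = C.dom α) : C.vc α (C.two f) = α := by
  subst h; rw [← vcomp_eq (C.cod_two _).symm, C.vcomp_two]

theorem vc_assoc {γ β α : C.Two} (h₁ : C.dom γ = C.cod β) (h₂ : C.dom β = C.cod α) :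
    C.vc (C.vc γ β) α = C.vc γ (C.vc β α) := by
  have := C.vcomp_assoc γ β α h₁ h₂
  simpa only [vcomp_eq] using this

theorem dom_hc {β α : C.Two} (h : C.src (C.dom β) = C.tgt (C.dom α)) :
    C.dom (C.hc β α) = C.cmp (C.dom β) (C.dom α) := by
  rw [← hcomp_eq h, C.dom_hcomp, comp_eq]

theorem cod_hc {β α : C.Two} (h : C.src (C.dom β) = C.tgt (C.dom α)) :
    C.cod (C.hc β α) = C.cmp (C.cod β) (C.cod α) := by
  rw [← hcomp_eq h, C.cod_hcomp, comp_eq]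

@[simp] theorem tgt_dom_hc {β α : C.Two} : C.tgt (C.dom (C.hc β α)) = C.tgt (C.dom β) := by
  by_cases h : C.src (C.dom β) = C.tgt (C.dom α)
  · rw [dom_hc h, tgt_cmp]
  · rw [hc, dif_neg h]

theorem src_dom_hc {β α : C.Two} (h : C.src (C.dom β) = C.tgt (C.dom α)) :
    C.src (C.dom (C.hc β α)) = C.src (C.dom α) := by
  rw [dom_hc h, src_cmp h]

@[simp] theorem tgt_dom_vc {β α : C.Two} : C.tgt (C.dom (C.vc β α)) = C.tgt (C.dom β) := by
  by_cases h : C.dom β = C.cod α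
  · rw [dom_vc h, h, C.tgt_cod]
  · rw [vc, dif_neg h]

@[simp] theorem src_dom_vc {β α : C.Two} : C.src (C.dom (C.vc β α)) = C.src (C.dom β) := by
  by_cases h : C.dom β = C.cod α
  · rw [dom_vc h, h, C.src_cod]
  · rw [vc, dif_neg h]

theorem one_hc {x : C.Obj} {α : C.Two} (h : x = C.tgt (C.dom α)) :
    C.hc (C.two (C.one x)) α = α := by
  subst h
  rw [← hcomp_eq (by rw [C.dom_two, C.src_one]), C.one_hcomp]

theorem hc_one {x : C.Obj} {α : C.Two} (h : x = C.src (C.dom α)) :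
    C.hc α (C.two (C.one x)) = α := by
  subst h
  rw [← hcomp_eq (by rw [C.dom_two, C.tgt_one]), C.hcomp_one]

theorem hc_assoc {γ β α : C.Two} (h₁ : C.src (C.dom γ) = C.tgt (C.dom β))
    (h₂ : C.src (C.dom β) = C.tgt (C.dom α)) :
    C.hc (C.hc γ β) α = C.hc γ (C.hc β α) := by
  have := C.hcomp_assoc γ β α h₁ h₂
  simpa only [hcomp_eq] using this

theorem hc_two {g f : C.One} (h : C.src g = C.tgt f) :
    C.hc (C.two g) (C.two f) = C.two (C.cmp g f) := by
  have := C.hcomp_two g f h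
  simpa only [hcomp_eq, comp_eq] using this

theorem vc_hc_vc {δ γ β α : C.Two} (h₁ : C.dom δ = C.cod γ) (h₂ : C.dom β = C.cod α)
    (h : C.src (C.dom γ) = C.tgt (C.dom α)) :
    C.hc (C.vc δ γ) (C.vc β α) = C.vc (C.hc δ β) (C.hc γ α) := by
  have := C.interchange δ γ β α h₁ h₂ h
  simpa only [hcomp_eq, vcomp_eq] using this

theorem two_vc_two {f : C.One} : C.vc (C.two f) (C.two f) = C.two f :=
  two_vc (C.cod_two f).symm

theorem vc_hc_two {f : C.One} {β α : C.Two} (h₁ : C.dom β = C.cod α)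
    (h : C.src (C.dom α) = C.tgt f) :
    C.hc (C.vc β α) (C.two f) = C.vc (C.hc β (C.two f)) (C.hc α (C.two f)) := by
  rw [← vc_hc_vc h₁ (by rw [C.dom_two, C.cod_two]) (by rw [C.dom_two, h]), two_vc_two]

theorem two_hc_vc {f : C.One} {β α : C.Two} (h₁ : C.dom β = C.cod α)
    (h : C.src f = C.tgt (C.dom α)) :
    C.hc (C.two f) (C.vc β α) = C.vc (C.hc (C.two f) β) (C.hc (C.two f) α) := by
  rw [← vc_hc_vc (by rw [C.dom_two, C.cod_two]) h₁ (by rw [C.dom_two, h]), two_vc_two]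

end Total

attribute [simp] src_one tgt_one dom_two cod_two src_cod tgt_cod

section Functors

variable {C D E : TwoCat.{w}}

@[simp] theorem comp_obj (F : C ⟶ D) (G : D ⟶ E) (x : C.Obj) :
    (F ≫ G).obj x = G.obj (F.obj x) := rfl
@[simp] theorem comp_map (F : C ⟶ D) (G : D ⟶ E) (f : C.One) :
    (F ≫ G).map f = G.map (F.map f) := rfl
@[simp] theorem comp_map₂ (F : C ⟶ D) (G : D ⟶ E) (α : C.Two) :
    (F ≫ G).map₂ α = G.map₂ (F.map₂ α) := rfl
@[simp] theorem id_obj (x : C.Obj) : (𝟙 C : C ⟶ C).obj x = x := rfl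
@[simp] theorem id_map (f : C.One) : (𝟙 C : C ⟶ C).map f = f := rfl
@[simp] theorem id_map₂ (α : C.Two) : (𝟙 C : C ⟶ C).map₂ α = α := rfl

attribute [simp] StrictFunctor.src_map StrictFunctor.tgt_map StrictFunctor.dom_map₂
  StrictFunctor.cod_map₂ StrictFunctor.map_one StrictFunctor.map₂_two

theorem StrictFunctor.map_cmp (F : StrictFunctor C D) {g f : C.One} (h : C.src g = C.tgt f) :
    F.map (C.cmp g f) = D.cmp (F.map g) (F.map f) := by
  rw [← comp_eq h, F.map_comp, comp_eq]

theorem StrictFunctor.map₂_vc (F : StrictFunctor C D) {β α : C.Two} (h : C.dom β = C.cod α) :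
    F.map₂ (C.vc β α) = D.vc (F.map₂ β) (F.map₂ α) := by
  rw [← vcomp_eq h, F.map₂_vcomp, vcomp_eq]

theorem StrictFunctor.map₂_hc (F : StrictFunctor C D) {β α : C.Two}
    (h : C.src (C.dom β) = C.tgt (C.dom α)) :
    F.map₂ (C.hc β α) = D.hc (F.map₂ β) (F.map₂ α) := by
  rw [← hcomp_eq h, F.map₂_hcomp, hcomp_eq]

@[ext]
theorem functor_ext {F G : C ⟶ D} (h₀ : ∀ x, F.obj x = G.obj x) (h₁ : ∀ f, F.map f = G.map f)
    (h₂ : ∀ α, F.map₂ α = G.map₂ α) : F = G :=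
  StrictFunctor.ext (funext h₀) (funext h₁) (funext h₂)

theorem congr_functor_obj {F G : C ⟶ D} (h : F = G) (x : C.Obj) : F.obj x = G.obj x := by rw [h]
theorem congr_functor_map {F G : C ⟶ D} (h : F = G) (f : C.One) : F.map f = G.map f := by rw [h]
theorem congr_functor_map₂ {F G : C ⟶ D} (h : F = G) (α : C.Two) : F.map₂ α = G.map₂ α := by
  rw [h]

/-- A strict 2-functor, from its compatibility with the total composition operations. -/
def functorOfTotal (obj : C.Obj → D.Obj) (map : C.One → D.One) (map₂ : C.Two → D.Two)
    (src_map : ∀ f, D.src (map f) = obj (C.src f)) (tgt_map : ∀ f, D.tgt (map f) = obj (C.tgt f))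
    (dom_map₂ : ∀ α, D.dom (map₂ α) = map (C.dom α))
    (cod_map₂ : ∀ α, D.cod (map₂ α) = map (C.cod α))
    (map_one : ∀ x, map (C.one x) = D.one (obj x))
    (map_cmp : ∀ g f, C.src g = C.tgt f → map (C.cmp g f) = D.cmp (map g) (map f))
    (map₂_two : ∀ f, map₂ (C.two f) = D.two (map f))
    (map₂_vc : ∀ β α, C.dom β = C.cod α → map₂ (C.vc β α) = D.vc (map₂ β) (map₂ α))
    (map₂_hc : ∀ β α, C.src (C.dom β) = C.tgt (C.dom α) →
      map₂ (C.hc β α) = D.hc (map₂ β) (map₂ α)) : C ⟶ D where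
  obj := obj
  map := map
  map₂ := map₂
  src_map := src_map
  tgt_map := tgt_map
  dom_map₂ := dom_map₂
  cod_map₂ := cod_map₂
  map_one := map_one
  map_comp g f h := by rw [comp_eq, comp_eq, map_cmp g f h]
  map₂_two := map₂_two
  map₂_vcomp β α h := by rw [vcomp_eq, vcomp_eq, map₂_vc β α h]
  map₂_hcomp β α h := by rw [hcomp_eq, hcomp_eq, map₂_hc β α h]

end Functors

/-- A 2-category, from total composition operations satisfying the axioms of 2-categories on
composable cells. -/
def ofTotal (Obj One Two : Type w) (src tgt : One → Obj) (dom cod : Two → One)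
    (src_cod : ∀ α, src (cod α) = src (dom α)) (tgt_cod : ∀ α, tgt (cod α) = tgt (dom α))
    (one : Obj → One) (two : One → Two) (cmp : One → One → One) (vc hc : Two → Two → Two)
    (src_one : ∀ x, src (one x) = x) (tgt_one : ∀ x, tgt (one x) = x)
    (src_cmp : ∀ g f, src g = tgt f → src (cmp g f) = src f)
    (tgt_cmp : ∀ g f, src g = tgt f → tgt (cmp g f) = tgt g)
    (one_cmp : ∀ f, cmp (one (tgt f)) f = f) (cmp_one : ∀ f, cmp f (one (src f)) = f)
    (cmp_assoc : ∀ k g f, src k = tgt g → src g = tgt f →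
      cmp (cmp k g) f = cmp k (cmp g f))
    (dom_two : ∀ f, dom (two f) = f) (cod_two : ∀ f, cod (two f) = f)
    (dom_vc : ∀ β α, dom β = cod α → dom (vc β α) = dom α)
    (cod_vc : ∀ β α, dom β = cod α → cod (vc β α) = cod β)
    (two_vc : ∀ α, vc (two (cod α)) α = α) (vc_two : ∀ α, vc α (two (dom α)) = α)
    (vc_assoc : ∀ γ β α, dom γ = cod β → dom β = cod α → vc (vc γ β) α = vc γ (vc β α))
    (dom_hc : ∀ β α, src (dom β) = tgt (dom α) → dom (hc β α) = cmp (dom β) (dom α))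
    (cod_hc : ∀ β α, src (dom β) = tgt (dom α) → cod (hc β α) = cmp (cod β) (cod α))
    (one_hc : ∀ α, hc (two (one (tgt (dom α)))) α = α)
    (hc_one : ∀ α, hc α (two (one (src (dom α)))) = α)
    (hc_assoc : ∀ γ β α, src (dom γ) = tgt (dom β) → src (dom β) = tgt (dom α) →
      hc (hc γ β) α = hc γ (hc β α))
    (hc_two : ∀ g f, src g = tgt f → hc (two g) (two f) = two (cmp g f))
    (interchange : ∀ δ γ β α, dom δ = cod γ → dom β = cod α → src (dom γ) = tgt (dom α) →
      hc (vc δ γ) (vc β α) = vc (hc δ β) (hc γ α)) : TwoCat.{w} where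
  Obj := Obj
  One := One
  Two := Two
  src := src
  tgt := tgt
  dom := dom
  cod := cod
  src_cod := src_cod
  tgt_cod := tgt_cod
  one := one
  two := two
  comp g f _ := cmp g f
  vcomp β α _ := vc β α
  hcomp β α _ := hc β α
  src_one := src_one
  tgt_one := tgt_one
  src_comp := src_cmp
  tgt_comp := tgt_cmp
  one_comp := one_cmp
  comp_one := cmp_one
  comp_assoc := cmp_assoc
  dom_two := dom_two
  cod_two := cod_two
  dom_vcomp := dom_vc
  cod_vcomp := cod_vc
  two_vcomp := two_vc
  vcomp_two := vc_two
  vcomp_assoc := vc_assoc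
  dom_hcomp := dom_hc
  cod_hcomp := cod_hc
  one_hcomp := one_hc
  hcomp_one := hc_one
  hcomp_assoc := hc_assoc
  hcomp_two := hc_two
  interchange := interchange

end TwoCat

/-! ### Sub-2-categories and generation of pushouts -/

namespace TwoCat

/-- A sub-2-category, as a family of predicates on cells. -/
structure Sub (C : TwoCat.{w}) where
  P₀ : C.Obj → Prop
  P₁ : C.One → Prop
  P₂ : C.Two → Prop
  src : ∀ f, P₁ f → P₀ (C.src f)
  tgt : ∀ f, P₁ f → P₀ (C.tgt f)
  dom : ∀ α, P₂ α → P₁ (C.dom α)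
  cod : ∀ α, P₂ α → P₁ (C.cod α)
  one : ∀ x, P₀ x → P₁ (C.one x)
  two : ∀ f, P₁ f → P₂ (C.two f)
  cmp : ∀ g f, C.src g = C.tgt f → P₁ g → P₁ f → P₁ (C.cmp g f)
  vc : ∀ β α, C.dom β = C.cod α → P₂ β → P₂ α → P₂ (C.vc β α)
  hc : ∀ β α, C.src (C.dom β) = C.tgt (C.dom α) → P₂ β → P₂ α → P₂ (C.hc β α)

namespace Sub

variable {C D : TwoCat.{w}} (U : Sub C)

/-- The 2-category underlying a sub-2-category. -/
noncomputable abbrev toTwoCat : TwoCat.{w} where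
  Obj := {x // U.P₀ x}
  One := {f // U.P₁ f}
  Two := {α // U.P₂ α}
  src f := ⟨C.src f.1, U.src _ f.2⟩
  tgt f := ⟨C.tgt f.1, U.tgt _ f.2⟩
  dom α := ⟨C.dom α.1, U.dom _ α.2⟩
  cod α := ⟨C.cod α.1, U.cod _ α.2⟩
  one x := ⟨C.one x.1, U.one _ x.2⟩
  two f := ⟨C.two f.1, U.two _ f.2⟩
  comp g f h := ⟨C.cmp g.1 f.1, U.cmp _ _ (congrArg Subtype.val h) g.2 f.2⟩
  vcomp β α h := ⟨C.vc β.1 α.1, U.vc _ _ (congrArg Subtype.val h) β.2 α.2⟩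
  hcomp β α h := ⟨C.hc β.1 α.1, U.hc _ _ (congrArg Subtype.val h) β.2 α.2⟩
  src_cod _ := Subtype.ext (C.src_cod _)
  tgt_cod _ := Subtype.ext (C.tgt_cod _)
  src_one _ := Subtype.ext (C.src_one _)
  tgt_one _ := Subtype.ext (C.tgt_one _)
  src_comp _ _ h := Subtype.ext (src_cmp (congrArg Subtype.val h))
  tgt_comp _ _ _ := Subtype.ext tgt_cmp
  one_comp _ := Subtype.ext (one_cmp rfl)
  comp_one _ := Subtype.ext (cmp_one rfl)
  comp_assoc _ _ _ h₁ h₂ :=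
    Subtype.ext (cmp_assoc (congrArg Subtype.val h₁) (congrArg Subtype.val h₂))
  dom_two _ := Subtype.ext (C.dom_two _)
  cod_two _ := Subtype.ext (C.cod_two _)
  dom_vcomp _ _ h := Subtype.ext (dom_vc (congrArg Subtype.val h))
  cod_vcomp _ _ _ := Subtype.ext cod_vc
  two_vcomp _ := Subtype.ext (two_vc rfl)
  vcomp_two _ := Subtype.ext (vc_two rfl)
  vcomp_assoc _ _ _ h₁ h₂ :=
    Subtype.ext (vc_assoc (congrArg Subtype.val h₁) (congrArg Subtype.val h₂))
  dom_hcomp _ _ h := Subtype.ext (dom_hc (congrArg Subtype.val h))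
  cod_hcomp _ _ h := Subtype.ext (cod_hc (congrArg Subtype.val h))
  one_hcomp _ := Subtype.ext (one_hc rfl)
  hcomp_one _ := Subtype.ext (hc_one rfl)
  hcomp_assoc _ _ _ h₁ h₂ :=
    Subtype.ext (hc_assoc (congrArg Subtype.val h₁) (congrArg Subtype.val h₂))
  hcomp_two _ _ h := Subtype.ext (hc_two (congrArg Subtype.val h))
  interchange _ _ _ _ h₁ h₂ h := Subtype.ext
    (vc_hc_vc (congrArg Subtype.val h₁) (congrArg Subtype.val h₂) (congrArg Subtype.val h))

/-- The inclusion of a sub-2-category. -/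
noncomputable def incl : U.toTwoCat ⟶ C where
  obj := Subtype.val
  map := Subtype.val
  map₂ := Subtype.val
  src_map _ := rfl
  tgt_map _ := rfl
  dom_map₂ _ := rfl
  cod_map₂ _ := rfl
  map_one _ := rfl
  map_comp _ _ h := (comp_eq (congrArg Subtype.val h)).symm
  map₂_two _ := rfl
  map₂_vcomp _ _ h := (vcomp_eq (congrArg Subtype.val h)).symm
  map₂_hcomp _ _ h := (hcomp_eq (congrArg Subtype.val h)).symm

/-- The factorization of a 2-functor through a sub-2-category. -/
noncomputable def lift (F : D ⟶ C) (h₀ : ∀ x, U.P₀ (F.obj x)) (h₁ : ∀ f, U.P₁ (F.map f))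
    (h₂ : ∀ α, U.P₂ (F.map₂ α)) : D ⟶ U.toTwoCat where
  obj x := ⟨F.obj x, h₀ x⟩
  map f := ⟨F.map f, h₁ f⟩
  map₂ α := ⟨F.map₂ α, h₂ α⟩
  src_map _ := Subtype.ext (F.src_map _)
  tgt_map _ := Subtype.ext (F.tgt_map _)
  dom_map₂ _ := Subtype.ext (F.dom_map₂ _)
  cod_map₂ _ := Subtype.ext (F.cod_map₂ _)
  map_one _ := Subtype.ext (F.map_one _)
  map_comp g f h := Subtype.ext (by rw [comp_eq h]; exact F.map_cmp h)
  map₂_two _ := Subtype.ext (F.map₂_two _)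
  map₂_vcomp β α h := Subtype.ext (by rw [vcomp_eq h]; exact F.map₂_vc h)
  map₂_hcomp β α h := Subtype.ext (by rw [hcomp_eq h]; exact F.map₂_hc h)

/-- A pushout is generated by the images of the two coprojections. -/
theorem of_isPushout {A B A' B' : TwoCat.{w}} {i : A ⟶ B} {u : A ⟶ A'} {i' : A' ⟶ B'}
    {v : B ⟶ B'} (sq : IsPushout u i i' v) (U : Sub B')
    (a₀ : ∀ x, U.P₀ (i'.obj x)) (a₁ : ∀ f, U.P₁ (i'.map f)) (a₂ : ∀ α, U.P₂ (i'.map₂ α))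
    (b₀ : ∀ x, U.P₀ (v.obj x)) (b₁ : ∀ f, U.P₁ (v.map f)) (b₂ : ∀ α, U.P₂ (v.map₂ α)) :
    (∀ x, U.P₀ x) ∧ (∀ f, U.P₁ f) ∧ (∀ α, U.P₂ α) := by
  have hw : u ≫ U.lift i' a₀ a₁ a₂ = i ≫ U.lift v b₀ b₁ b₂ := by
    ext x
    · exact congr_functor_obj sq.w x
    · exact congr_functor_map sq.w x
    · exact congr_functor_map₂ sq.w x
  -- The corestrictions of `i'` and `v` induce a section of the inclusion of `U`, so every cell of
  -- `B'` belongs to `U`.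
  have e : sq.desc _ _ hw ≫ U.incl = 𝟙 B' := by
    apply sq.hom_ext
    · rw [← Category.assoc, sq.inl_desc]; rfl
    · rw [← Category.assoc, sq.inr_desc]; rfl
  refine ⟨fun x => ?_, fun f => ?_, fun α => ?_⟩
  · have := congr_functor_obj e x
    rw [id_obj] at this; rw [← this]; exact ((sq.desc _ _ hw).obj x).2
  · have := congr_functor_map e f
    rw [id_map] at this; rw [← this]; exact ((sq.desc _ _ hw).map f).2
  · have := congr_functor_map₂ e α
    rw [id_map₂] at this; rw [← this]; exact ((sq.desc _ _ hw).map₂ α).2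

end Sub

/-! ### The interval, and sieves in elementary terms -/

section Interval

theorem endpt_cases (j : interval.{w}.Obj) : j = endpt 0 ∨ j = endpt 1 := by
  obtain ⟨j⟩ := j
  fin_cases j
  · exact Or.inl rfl
  · exact Or.inr rfl

theorem endpt_ne : (endpt 0 : interval.{w}.Obj) ≠ endpt 1 := by
  intro h
  have := congrArg ULift.down h
  exact absurd this (by decide)

theorem interval_one_ext {e e' : interval.{w}.One} (h₁ : interval.src e = interval.src e')
    (h₂ : interval.tgt e = interval.tgt e') : e = e' :=
  Subtype.ext (Prod.ext h₁ h₂)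

theorem interval_src_eq (e : interval.{w}.One) (h : interval.tgt e = endpt 0) :
    interval.src e = endpt 0 := by
  have h' : e.1.1.down ≤ e.1.2.down := e.2
  have h₂ : e.1.2.down = 0 := congrArg ULift.down h
  rw [h₂] at h'
  exact ULift.down_injective (Fin.le_zero_iff.1 h')

theorem point_subsingleton {C : TwoCat.{w}} (F G : C ⟶ point.{w}) : F = G := by
  ext x
  · exact Subsingleton.elim (α := PUnit) _ _
  · exact Subtype.ext (Prod.ext (Subsingleton.elim (α := PUnit) _ _)
      (Subsingleton.elim (α := PUnit) _ _))
  · exact Subtype.ext (Prod.ext (Subsingleton.elim (α := PUnit) _ _)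
      (Subsingleton.elim (α := PUnit) _ _))

end Interval

/-- The elementary form of the condition that `i` is the inverse image along `χ` of the object `0`
of the interval. -/
structure IsSieveOf {A B : TwoCat.{w}} (i : A ⟶ B) (χ : B ⟶ interval.{w}) : Prop where
  obj_eq : ∀ a, χ.obj (i.obj a) = endpt 0
  inj₀ : ∀ {a b}, i.obj a = i.obj b → a = b
  inj₁ : ∀ {a b}, i.map a = i.map b → a = b
  inj₂ : ∀ {a b}, i.map₂ a = i.map₂ b → a = b
  surj₀ : ∀ x, χ.obj x = endpt 0 → ∃ a, i.obj a = x
  surj₁ : ∀ f, χ.obj (B.tgt f) = endpt 0 → ∃ k, i.map k = f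
  surj₂ : ∀ α, χ.obj (B.tgt (B.dom α)) = endpt 0 → ∃ k, i.map₂ k = α

section Sieve

variable {A B : TwoCat.{w}} {i : A ⟶ B} {χ : B ⟶ interval.{w}}

/-- Every 1-cell of `Δ₁` with target `0` has source `0`. This closes a sieve under precomposition,
and is why the target alone decides whether a cell belongs to it. -/
theorem src_eq_zero (χ : B ⟶ interval.{w}) (f : B.One) (h : χ.obj (B.tgt f) = endpt 0) :
    χ.obj (B.src f) = endpt 0 := by
  rw [← χ.src_map]
  exact interval_src_eq _ (by rw [χ.tgt_map, h])

/-- The full sub-2-category on the objects over `0`. -/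
def zeroFiber (χ : B ⟶ interval.{w}) : Sub B where
  P₀ x := χ.obj x = endpt 0
  P₁ f := χ.obj (B.tgt f) = endpt 0
  P₂ α := χ.obj (B.tgt (B.dom α)) = endpt 0
  src f h := src_eq_zero χ f h
  tgt f h := h
  dom α h := h
  cod α h := by rwa [B.tgt_cod]
  one x h := by rwa [B.tgt_one]
  two f h := by rwa [B.dom_two]
  cmp _ _ _ hg _ := by rwa [tgt_cmp]
  vc _ _ _ hβ _ := by rwa [tgt_dom_vc]
  hc _ _ _ hβ _ := by rwa [tgt_dom_hc]

/-- The full sub-2-category on the objects over `0` is compared with the pullback. The induced `ℓ`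
satisfies `ℓ ≫ i = incl`, whence surjectivity onto the cells over `0`; it is also a retraction of
the corestriction `s` of `i`, whence injectivity. -/
theorem IsSieve.exists_isSieveOf (hi : IsSieve i) : ∃ χ, IsSieveOf i χ := by
  obtain ⟨χ, p, hp⟩ := hi
  have h₀ : ∀ a, χ.obj (i.obj a) = endpt 0 := fun a => congr_functor_obj hp.w a
  let U := zeroFiber χ
  let s : A ⟶ U.toTwoCat := U.lift i h₀
    (fun f => by
      change χ.obj (B.tgt (i.map f)) = endpt 0
      rw [i.tgt_map, h₀])
    (fun α => by
      change χ.obj (B.tgt (B.dom (i.map₂ α))) = endpt 0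
      rw [i.dom_map₂, i.tgt_map, h₀])
  let q : U.toTwoCat ⟶ point.{w} := 
    { obj := fun _ => PUnit.unit
      map := fun _ => point.one PUnit.unit
      map₂ := fun _ => point.one PUnit.unit
      src_map := fun _ => rfl
      tgt_map := fun _ => rfl
      dom_map₂ := fun _ => rfl
      cod_map₂ := fun _ => rfl
      map_one := fun _ => rfl
      map_comp := fun _ _ _ => rfl
      map₂_two := fun _ => rfl
      map₂_vcomp := fun _ _ _ => rfl
      map₂_hcomp := fun _ _ _ => rfl }
  have one_ext : ∀ e : interval.{w}.One, interval.tgt e = endpt 0 →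
      e = interval.one (endpt 0) := fun e h => interval_one_ext (interval_src_eq e h) h
  have hq : U.incl ≫ χ = q ≫ const point.{w} (endpt 0) := by
    ext x
    · exact x.2
    · exact one_ext _ ((χ.tgt_map _).trans x.2)
    · refine one_ext _ ?_
      exact ((congrArg interval.tgt (χ.dom_map₂ x.1)).trans (χ.tgt_map _)).trans x.2
  let ℓ := hp.lift _ _ hq
  have hℓ : ℓ ≫ i = U.incl := hp.lift_fst _ _ hq
  have hs : s ≫ ℓ = 𝟙 A := by
    apply hp.hom_ext
    · rw [Category.assoc, hℓ]; rfl
    · exact point_subsingleton _ _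
  refine ⟨χ, h₀, ?_, ?_, ?_, ?_, ?_, ?_⟩
  · intro a b h
    have : s.obj a = s.obj b := Subtype.ext h
    simpa only [← comp_obj, hs, id_obj] using congrArg ℓ.obj this
  · intro a b h
    have : s.map a = s.map b := Subtype.ext h
    simpa only [← comp_map, hs, id_map] using congrArg ℓ.map this
  · intro a b h
    have : s.map₂ a = s.map₂ b := Subtype.ext h
    simpa only [← comp_map₂, hs, id_map₂] using congrArg ℓ.map₂ this
  · exact fun x h => ⟨ℓ.obj ⟨x, h⟩, congr_functor_obj hℓ ⟨x, h⟩⟩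
  · exact fun x h => ⟨ℓ.map ⟨x, h⟩, congr_functor_map hℓ ⟨x, h⟩⟩
  · exact fun x h => ⟨ℓ.map₂ ⟨x, h⟩, congr_functor_map₂ hℓ ⟨x, h⟩⟩

/-- Cells over `0` have unique preimages under `i`, so preimages chosen cell by cell are
automatically compatible with all the structure. -/
theorem IsSieveOf.isSieve (s : IsSieveOf i χ) : IsSieve i := by
  let pt : ∀ C : TwoCat.{w}, C ⟶ point.{w} := fun C => const C PUnit.unit
  have one_ext : ∀ e : interval.{w}.One, interval.tgt e = endpt 0 →
      e = interval.one (endpt 0) := fun e h => interval_one_ext (interval_src_eq e h) h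
  refine ⟨χ, pt A, ⟨⟨?_⟩, ⟨Limits.PullbackCone.IsLimit.mk _ ?_ ?_ ?_ ?_⟩⟩⟩
  · ext x
    · exact s.obj_eq x
    · exact one_ext _ (by rw [comp_map, χ.tgt_map, i.tgt_map, s.obj_eq])
    · refine one_ext _ ?_
      have := χ.dom_map₂ (i.map₂ x)
      exact (congrArg interval.tgt this).trans (by rw [χ.tgt_map, i.dom_map₂, i.tgt_map, s.obj_eq])
  · intro c
    have hc : ∀ x, χ.obj (c.fst.obj x) = endpt 0 := fun x => congr_functor_obj c.condition x
    choose o ho using fun x => s.surj₀ _ (hc x)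
    choose m hm using fun f => s.surj₁ (c.fst.map f) (by rw [c.fst.tgt_map, hc])
    choose t ht using fun α => s.surj₂ (c.fst.map₂ α) (by rw [c.fst.dom_map₂, c.fst.tgt_map, hc])
    have e₁ : ∀ f, A.src (m f) = o (c.pt.src f) := fun f => s.inj₀ (by
      rw [← i.src_map, hm, ho, c.fst.src_map])
    have e₂ : ∀ f, A.tgt (m f) = o (c.pt.tgt f) := fun f => s.inj₀ (by
      rw [← i.tgt_map, hm, ho, c.fst.tgt_map])
    have e₃ : ∀ f, A.dom (t f) = m (c.pt.dom f) := fun f => s.inj₁ (by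
      rw [← i.dom_map₂, ht, hm, c.fst.dom_map₂])
    have e₄ : ∀ f, A.cod (t f) = m (c.pt.cod f) := fun f => s.inj₁ (by
      rw [← i.cod_map₂, ht, hm, c.fst.cod_map₂])
    refine functorOfTotal o m t e₁ e₂ e₃ e₄ ?_ ?_ ?_ ?_ ?_
    · exact fun x => s.inj₁ (by rw [hm, i.map_one, c.fst.map_one, ho])
    · exact fun g f h => s.inj₁ (by
        rw [hm, i.map_cmp (by rw [e₁, e₂, h]), c.fst.map_cmp h, hm, hm])
    · exact fun f => s.inj₂ (by rw [ht, i.map₂_two, c.fst.map₂_two, hm])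
    · exact fun g f h => s.inj₂ (by
        rw [ht, i.map₂_vc (by rw [e₃, e₄, h]), c.fst.map₂_vc h, ht, ht])
    · exact fun g f h => s.inj₂ (by
        rw [ht, i.map₂_hc (by rw [e₃, e₃, e₁, e₂, h]), c.fst.map₂_hc h, ht, ht])
  · intro c
    have hc : ∀ x, χ.obj (c.fst.obj x) = endpt 0 := fun x => congr_functor_obj c.condition x
    ext x
    · exact Classical.choose_spec (s.surj₀ _ (hc x))
    · exact Classical.choose_spec (s.surj₁ (c.fst.map x) (by rw [c.fst.tgt_map, hc]))
    · exact Classical.choose_spec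
        (s.surj₂ (c.fst.map₂ x) (by rw [c.fst.dom_map₂, c.fst.tgt_map, hc]))
  · exact fun c => point_subsingleton _ _
  · intro c m h₁ h₂
    have hc : ∀ x, χ.obj (c.fst.obj x) = endpt 0 := fun x => congr_functor_obj c.condition x
    ext x
    · refine s.inj₀ ((congr_functor_obj h₁ x).trans ?_)
      exact (Classical.choose_spec (s.surj₀ _ (hc x))).symm
    · refine s.inj₁ ((congr_functor_map h₁ x).trans ?_)
      exact (Classical.choose_spec (s.surj₁ (c.fst.map x) (by rw [c.fst.tgt_map, hc]))).symm
    · refine s.inj₂ ((congr_functor_map₂ h₁ x).trans ?_)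
      exact (Classical.choose_spec
        (s.surj₂ (c.fst.map₂ x) (by rw [c.fst.dom_map₂, c.fst.tgt_map, hc]))).symm

namespace IsSieveOf

variable (s : IsSieveOf i χ)
include s

theorem tgt_map (k : A.One) : χ.obj (B.tgt (i.map k)) = endpt 0 := by
  rw [i.tgt_map, s.obj_eq]

theorem tgt_dom_map₂ (k : A.Two) : χ.obj (B.tgt (B.dom (i.map₂ k))) = endpt 0 := by
  rw [i.dom_map₂, s.tgt_map]

open Classical in
/-- Extension of a 2-functor from a sieve: the cells with target outside of the sieve have to be
given images compatible with composition. -/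
theorem extend {T : TwoCat.{w}} (G : A ⟶ T) (ob : B.Obj → T.Obj) (m₁ : B.One → T.One)
    (m₂ : B.Two → T.Two) (hob : ∀ a, ob (i.obj a) = G.obj a)
    (src : ∀ f, χ.obj (B.tgt f) ≠ endpt 0 → T.src (m₁ f) = ob (B.src f))
    (tgt : ∀ f, χ.obj (B.tgt f) ≠ endpt 0 → T.tgt (m₁ f) = ob (B.tgt f))
    (dom : ∀ α, χ.obj (B.tgt (B.dom α)) ≠ endpt 0 → T.dom (m₂ α) = m₁ (B.dom α))
    (cod : ∀ α, χ.obj (B.tgt (B.dom α)) ≠ endpt 0 → T.cod (m₂ α) = m₁ (B.cod α))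
    (one : ∀ x, χ.obj x ≠ endpt 0 → m₁ (B.one x) = T.one (ob x))
    (cmp : ∀ g f, χ.obj (B.tgt g) ≠ endpt 0 → χ.obj (B.tgt f) ≠ endpt 0 → B.src g = B.tgt f →
      m₁ (B.cmp g f) = T.cmp (m₁ g) (m₁ f))
    (cmp' : ∀ g k, χ.obj (B.tgt g) ≠ endpt 0 → B.src g = B.tgt (i.map k) →
      m₁ (B.cmp g (i.map k)) = T.cmp (m₁ g) (G.map k))
    (two : ∀ f, χ.obj (B.tgt f) ≠ endpt 0 → m₂ (B.two f) = T.two (m₁ f))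
    (vc : ∀ β α, χ.obj (B.tgt (B.dom β)) ≠ endpt 0 → B.dom β = B.cod α →
      m₂ (B.vc β α) = T.vc (m₂ β) (m₂ α))
    (hc : ∀ β α, χ.obj (B.tgt (B.dom β)) ≠ endpt 0 → χ.obj (B.tgt (B.dom α)) ≠ endpt 0 →
      B.src (B.dom β) = B.tgt (B.dom α) → m₂ (B.hc β α) = T.hc (m₂ β) (m₂ α))
    (hc' : ∀ β k, χ.obj (B.tgt (B.dom β)) ≠ endpt 0 →
      B.src (B.dom β) = B.tgt (B.dom (i.map₂ k)) →
      m₂ (B.hc β (i.map₂ k)) = T.hc (m₂ β) (G.map₂ k)) :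
    ∃ F : B ⟶ T, i ≫ F = G ∧ (∀ x, F.obj x = ob x) ∧
      (∀ f, χ.obj (B.tgt f) ≠ endpt 0 → F.map f = m₁ f) ∧
      (∀ α, χ.obj (B.tgt (B.dom α)) ≠ endpt 0 → F.map₂ α = m₂ α) := by
  -- By injectivity of `i` the chosen preimage is the only one: `M₁` and `M₂` restrict to `G` along
  -- `i`, and take the prescribed values on cells with target outside the sieve.
  let M₁ : B.One → T.One := fun f => if h : ∃ k, i.map k = f then G.map h.choose else m₁ f
  let M₂ : B.Two → T.Two := fun f => if h : ∃ k, i.map₂ k = f then G.map₂ h.choose else m₂ f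
  have a₁ : ∀ k, M₁ (i.map k) = G.map k := fun k => by
    have h : ∃ l, i.map l = i.map k := ⟨k, rfl⟩
    simp only [M₁, dif_pos h]
    rw [s.inj₁ h.choose_spec]
  have a₂ : ∀ k, M₂ (i.map₂ k) = G.map₂ k := fun k => by
    have h : ∃ l, i.map₂ l = i.map₂ k := ⟨k, rfl⟩
    simp only [M₂, dif_pos h]
    rw [s.inj₂ h.choose_spec]
  have b₁ : ∀ f, χ.obj (B.tgt f) ≠ endpt 0 → M₁ f = m₁ f := fun f hf => by
    have h : ¬ ∃ l, i.map l = f := by rintro ⟨l, rfl⟩; exact hf (s.tgt_map l)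
    simp only [M₁, dif_neg h]
  have b₂ : ∀ f, χ.obj (B.tgt (B.dom f)) ≠ endpt 0 → M₂ f = m₂ f := fun f hf => by
    have h : ¬ ∃ l, i.map₂ l = f := by rintro ⟨l, rfl⟩; exact hf (s.tgt_dom_map₂ l)
    simp only [M₂, dif_neg h]
  have c₁ : ∀ f, (∃ k, f = i.map k) ∨ χ.obj (B.tgt f) ≠ endpt 0 := fun f => by
    by_cases h : χ.obj (B.tgt f) = endpt 0
    · obtain ⟨k, hk⟩ := s.surj₁ f h; exact Or.inl ⟨k, hk.symm⟩
    · exact Or.inr h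
  have c₂ : ∀ f, (∃ k, f = i.map₂ k) ∨ χ.obj (B.tgt (B.dom f)) ≠ endpt 0 := fun f => by
    by_cases h : χ.obj (B.tgt (B.dom f)) = endpt 0
    · obtain ⟨k, hk⟩ := s.surj₂ f h; exact Or.inl ⟨k, hk.symm⟩
    · exact Or.inr h
  have tm := s.tgt_map
  have tm₂ := s.tgt_dom_map₂
  refine ⟨functorOfTotal ob M₁ M₂ ?_ ?_ ?_ ?_ ?_ ?_ ?_ ?_ ?_, ?_, fun _ => rfl, b₁, b₂⟩
  · intro f
    obtain ⟨k, rfl⟩ | h := c₁ f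
    · rw [a₁, G.src_map, i.src_map, hob]
    · rw [b₁ f h, src f h]
  · intro f
    obtain ⟨k, rfl⟩ | h := c₁ f
    · rw [a₁, G.tgt_map, i.tgt_map, hob]
    · rw [b₁ f h, tgt f h]
  · intro f
    obtain ⟨k, rfl⟩ | h := c₂ f
    · rw [a₂, G.dom_map₂, i.dom_map₂, a₁]
    · rw [b₂ f h, dom f h, b₁ _ h]
  · intro f
    obtain ⟨k, rfl⟩ | h := c₂ f
    · rw [a₂, G.cod_map₂, i.cod_map₂, a₁]
    · rw [b₂ f h, cod f h, b₁ _ (by rwa [B.tgt_cod])]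
  · intro x
    by_cases h : χ.obj x = endpt 0
    · obtain ⟨a, rfl⟩ := s.surj₀ x h
      rw [← i.map_one, a₁, G.map_one, hob]
    · rw [b₁ _ (by rwa [B.tgt_one]), one x h]
  · intro g f hgf
    obtain ⟨k, rfl⟩ | hg := c₁ g
    · obtain ⟨l, rfl⟩ | hf := c₁ f
      · have hkl : A.src k = A.tgt l := s.inj₀ (by rw [← i.src_map, ← i.tgt_map, hgf])
        rw [← i.map_cmp hkl, a₁, a₁, a₁, G.map_cmp hkl]
      -- A 1-cell of the sieve has its source over `0`, so it cannot be composed with an `f` whose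
      -- target is outside.
      · exact absurd (by rw [← hgf]; exact src_eq_zero χ _ (tm k)) hf
    · rw [b₁ _ (by rwa [tgt_cmp]), b₁ g hg]
      obtain ⟨l, rfl⟩ | hf := c₁ f
      · rw [a₁, cmp' g l hg hgf]
      · rw [b₁ f hf, cmp g f hg hf hgf]
  · intro f
    obtain ⟨k, rfl⟩ | h := c₁ f
    · rw [← i.map₂_two, a₂, a₁, G.map₂_two]
    · rw [b₁ f h, b₂ _ (by rwa [B.dom_two]), two f h]
  · intro g f hgf
    obtain ⟨k, rfl⟩ | hg := c₂ g
    · obtain ⟨l, rfl⟩ | hf := c₂ f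
      · have hkl : A.dom k = A.cod l := s.inj₁ (by rw [← i.dom_map₂, ← i.cod_map₂, hgf])
        rw [← i.map₂_vc hkl, a₂, a₂, a₂, G.map₂_vc hkl]
      · exact absurd (by rw [← B.tgt_cod, ← hgf]; exact tm₂ k) hf
    · rw [b₂ _ (by rwa [tgt_dom_vc]), b₂ g hg, b₂ f (by rwa [← B.tgt_cod, ← hgf]), vc g f hg hgf]
  · intro g f hgf
    obtain ⟨k, rfl⟩ | hg := c₂ g
    · obtain ⟨l, rfl⟩ | hf := c₂ f
      · have hkl : A.src (A.dom k) = A.tgt (A.dom l) := s.inj₀ (by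
          rw [← i.src_map, ← i.tgt_map, ← i.dom_map₂, ← i.dom_map₂, hgf])
        rw [← i.map₂_hc hkl, a₂, a₂, a₂, G.map₂_hc hkl]
      · exact absurd (by rw [← hgf]; exact src_eq_zero χ _ (tm₂ k)) hf
    · rw [b₂ _ (by rwa [tgt_dom_hc]), b₂ g hg]
      obtain ⟨l, rfl⟩ | hf := c₂ f
      · rw [a₂, hc' g l hg hgf]
      · rw [b₂ f hf, hc g f hg hf hgf]
  · ext x
    · exact hob x
    · exact a₁ x
    · exact a₂ x

end IsSieveOf

end Sieve

end TwoCat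

/-! ### The join of two 2-categories -/

namespace TwoCat

section Join

variable (A B : TwoCat.{w})

/-- The join of two 2-categories: their disjoint union, with a unique 1-cell (and its identity)
from every object of the first one to every object of the second one. -/
noncomputable def join : TwoCat.{w} :=
  ofTotal (A.Obj ⊕ B.Obj) (A.One ⊕ B.One ⊕ A.Obj × B.Obj) (A.Two ⊕ B.Two ⊕ A.Obj × B.Obj)
    (fun | .inl f => .inl (A.src f) | .inr (.inl f) => .inr (B.src f) | .inr (.inr p) => .inl p.1)
    (fun | .inl f => .inl (A.tgt f) | .inr (.inl f) => .inr (B.tgt f) | .inr (.inr p) => .inr p.2)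
    (fun
         | .inl f => .inl (A.dom f) | .inr (.inl f) => .inr (.inl (B.dom f))
         | .inr (.inr p) => .inr (.inr p))
    (fun
         | .inl f => .inl (A.cod f) | .inr (.inl f) => .inr (.inl (B.cod f))
         | .inr (.inr p) => .inr (.inr p))
    (src_cod := by rintro (a | a | a) <;> simp)
    (tgt_cod := by rintro (a | a | a) <;> simp)
    (one := fun
         | .inl x => .inl (A.one x) | .inr x => .inr (.inl (B.one x)))
    (two := fun
         | .inl f => .inl (A.two f) | .inr (.inl f) => .inr (.inl (B.two f))
         | .inr (.inr p) => .inr (.inr p))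
    (cmp := fun
         | .inl g, .inl f => .inl (A.cmp g f)
         | .inr (.inl g), .inr (.inl f) => .inr (.inl (B.cmp g f))
         | .inr (.inr p), .inl f => .inr (.inr (A.src f, p.2))
         | .inr (.inl g), .inr (.inr p) => .inr (.inr (p.1, B.tgt g))
         | g, _ => g)
    (vc := fun
         | .inl g, .inl f => .inl (A.vc g f)
         | .inr (.inl g), .inr (.inl f) => .inr (.inl (B.vc g f))
         -- Besides the non-composable pairs, this covers two composable mixed 2-cells, which are
         -- equal identities.
         | g, _ => g)
    (hc := fun
         | .inl g, .inl f => .inl (A.hc g f)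
         | .inr (.inl g), .inr (.inl f) => .inr (.inl (B.hc g f))
         | .inr (.inr p), .inl f => .inr (.inr (A.src (A.dom f), p.2))
         | .inr (.inl g), .inr (.inr p) => .inr (.inr (p.1, B.tgt (B.dom g)))
         | g, _ => g)
    (src_one := by rintro (a | a) <;> simp)
    (tgt_one := by rintro (a | a) <;> simp)
    (src_cmp := by
      rintro (a | a | a) (b | b | b) h <;> first | cases h | simp_all [src_cmp])
    (tgt_cmp := by
      rintro (a | a | a) (b | b | b) h <;> first | cases h | simp_all)
    (one_cmp := by rintro (a | a | a) <;> simp [one_cmp])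
    (cmp_one := by rintro (a | a | a) <;> simp [cmp_one])
    (cmp_assoc := by
      rintro (a | a | a) (b | b | b) (c | c | c) h h' <;>
      first | cases h | cases h' | simp_all [cmp_assoc, src_cmp])
    (dom_two := by rintro (a | a | a) <;> simp)
    (cod_two := by rintro (a | a | a) <;> simp)
    (dom_vc := by
      rintro (a | a | a) (b | b | b) h <;> first | (cases h; done) | simp_all [dom_vc])
    (cod_vc := by
      rintro (a | a | a) (b | b | b) h <;> first | (cases h; done) | simp_all)
    (two_vc := by rintro (a | a | a) <;> simp [two_vc])
    (vc_two := by rintro (a | a | a) <;> simp [vc_two])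
    (vc_assoc := by
      rintro (a | a | a) (b | b | b) (c | c | c) h h' <;>
      first | (cases h; done) | (cases h'; done) | simp_all [vc_assoc])
    (dom_hc := by
      rintro (a | a | a) (b | b | b) h <;> first | cases h | simp_all [dom_hc])
    (cod_hc := by
      rintro (a | a | a) (b | b | b) h <;> first | cases h | simp_all [cod_hc])
    (one_hc := by rintro (a | a | a) <;> simp [one_hc])
    (hc_one := by rintro (a | a | a) <;> simp [hc_one])
    (hc_assoc := by
      rintro (a | a | a) (b | b | b) (c | c | c) h h' <;>
      first | cases h | cases h' | simp_all [hc_assoc, src_dom_hc])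
    (hc_two := by
      rintro (a | a | a) (b | b | b) h <;> first | cases h | simp_all [hc_two])
    (interchange := by
      rintro (a | a | a) (b | b | b) (c | c | c) (d | d | d) h h' k <;>
      first | (cases h; done) | (cases h'; done) | cases k | simp_all [vc_hc_vc])

/-- The inclusion of the first 2-category in a join. -/
noncomputable def joinInl : A ⟶ join A B :=
  functorOfTotal (D := join A B) Sum.inl Sum.inl Sum.inl (fun _ => rfl) (fun _ => rfl)
    (fun _ => rfl) (fun _ => rfl) (fun _ => rfl)
    (fun g f h => comp_eq (C := join A B) (g := .inl g) (f := .inl f) (congrArg Sum.inl h))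
    (fun _ => rfl)
    (fun g f h => vcomp_eq (C := join A B) (β := .inl g) (α := .inl f) (congrArg Sum.inl h))
    (fun g f h => hcomp_eq (C := join A B) (β := .inl g) (α := .inl f) (congrArg Sum.inl h))

/-- The inclusion of the second 2-category in a join, on objects. -/
def joinB₀ (x : B.Obj) : (join A B).Obj := Sum.inr x
/-- The inclusion of the second 2-category in a join, on 1-cells. -/
def joinB₁ (f : B.One) : (join A B).One := Sum.inr (Sum.inl f)
/-- The inclusion of the second 2-category in a join, on 2-cells. -/
def joinB₂ (α : B.Two) : (join A B).Two := Sum.inr (Sum.inl α)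
/-- The 1-cells of a join between its two parts. -/
def joinMix₁ (a : A.Obj) (b : B.Obj) : (join A B).One := Sum.inr (Sum.inr (a, b))
/-- The 2-cells of a join between its two parts. -/
def joinMix₂ (a : A.Obj) (b : B.Obj) : (join A B).Two := Sum.inr (Sum.inr (a, b))

variable {A B}

theorem joinB₁_cmp {g f : B.One} (h : B.src g = B.tgt f) :
    (join A B).cmp (joinB₁ A B g) (joinB₁ A B f) = joinB₁ A B (B.cmp g f) :=
  (comp_eq (C := join A B) (g := joinB₁ A B g) (f := joinB₁ A B f) (congrArg Sum.inr h)).symm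

theorem joinB₁_cmp_mix {g : B.One} {a : A.Obj} {b : B.Obj} (h : B.src g = b) :
    (join A B).cmp (joinB₁ A B g) (joinMix₁ A B a b) = joinMix₁ A B a (B.tgt g) :=
  (comp_eq (C := join A B) (g := joinB₁ A B g) (f := joinMix₁ A B a b) (congrArg Sum.inr h)).symm

theorem joinMix₁_cmp {f : A.One} {a : A.Obj} {b : B.Obj} (h : a = A.tgt f) :
    (join A B).cmp (joinMix₁ A B a b) ((joinInl A B).map f) = joinMix₁ A B (A.src f) b :=
  (comp_eq (C := join A B) (g := joinMix₁ A B a b) (f := (joinInl A B).map f)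
    (congrArg Sum.inl h)).symm

theorem joinB₂_vc {g f : B.Two} (h : B.dom g = B.cod f) :
    (join A B).vc (joinB₂ A B g) (joinB₂ A B f) = joinB₂ A B (B.vc g f) :=
  (vcomp_eq (C := join A B) (β := joinB₂ A B g) (α := joinB₂ A B f)
    (congrArg (Sum.inr ∘ Sum.inl) h)).symm

theorem joinMix₂_vc {a : A.Obj} {b : B.Obj} :
    (join A B).vc (joinMix₂ A B a b) (joinMix₂ A B a b) = joinMix₂ A B a b :=
  (vcomp_eq (C := join A B) (β := joinMix₂ A B a b) (α := joinMix₂ A B a b) rfl).symm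

theorem joinB₂_hc {g f : B.Two} (h : B.src (B.dom g) = B.tgt (B.dom f)) :
    (join A B).hc (joinB₂ A B g) (joinB₂ A B f) = joinB₂ A B (B.hc g f) :=
  (hcomp_eq (C := join A B) (β := joinB₂ A B g) (α := joinB₂ A B f) (congrArg Sum.inr h)).symm

theorem joinB₂_hc_mix {g : B.Two} {a : A.Obj} {b : B.Obj} (h : B.src (B.dom g) = b) :
    (join A B).hc (joinB₂ A B g) (joinMix₂ A B a b) = joinMix₂ A B a (B.tgt (B.dom g)) :=
  (hcomp_eq (C := join A B) (β := joinB₂ A B g) (α := joinMix₂ A B a b) (congrArg Sum.inr h)).symm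

theorem joinMix₂_hc {f : A.Two} {a : A.Obj} {b : B.Obj} (h : a = A.tgt (A.dom f)) :
    (join A B).hc (joinMix₂ A B a b) ((joinInl A B).map₂ f) = joinMix₂ A B (A.src (A.dom f)) b :=
  (hcomp_eq (C := join A B) (β := joinMix₂ A B a b) (α := (joinInl A B).map₂ f)
    (congrArg Sum.inl h)).symm

end Join

end TwoCat

/-! ### The cells of a pushout along a sieve -/

namespace TwoCat

/-- A pushout square of 2-categories along a sieve, with the elementary properties of its cells. -/
structure SievePushout {A B A' B' : TwoCat.{w}} (u : A ⟶ A') (i : A ⟶ B) (i' : A' ⟶ B')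
    (v : B ⟶ B') (χ : B ⟶ interval.{w}) (χ' : B' ⟶ interval.{w}) : Prop where
  sq : IsPushout u i i' v
  sieve : IsSieveOf i χ
  sieve' : IsSieveOf i' χ'
  w : v ≫ χ' = χ
  inj₀ : ∀ {x y}, χ.obj x ≠ endpt 0 → v.obj x = v.obj y → x = y
  inj₁ : ∀ {x y}, χ.obj (B.src x) ≠ endpt 0 → v.map x = v.map y → x = y
  inj₂ : ∀ {x y}, χ.obj (B.src (B.dom x)) ≠ endpt 0 → v.map₂ x = v.map₂ y → x = y

section

variable {A B A' B' : TwoCat.{w}} {u : A ⟶ A'} {i : A ⟶ B} {i' : A' ⟶ B'} {v : B ⟶ B'}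
  {χ : B ⟶ interval.{w}} {χ' : B' ⟶ interval.{w}}

open Classical in
/-- The collapse of the cells of `B` onto the join of `A'` and `B`. -/
theorem IsSieveOf.exists_toJoin (s : IsSieveOf i χ) (u : A ⟶ A') :
    ∃ F : B ⟶ join A' B, i ≫ F = u ≫ joinInl A' B ∧
      (∀ x, χ.obj x ≠ endpt 0 → F.obj x = joinB₀ A' B x) ∧
      (∀ f, χ.obj (B.src f) ≠ endpt 0 → F.map f = joinB₁ A' B f) ∧
      (∀ α, χ.obj (B.src (B.dom α)) ≠ endpt 0 → F.map₂ α = joinB₂ A' B α) := by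
  let ob : B.Obj → (join A' B).Obj := fun x =>
    if h : ∃ a, i.obj a = x then (joinInl A' B).obj (u.obj h.choose) else joinB₀ A' B x
  have o₁ : ∀ a, ob (i.obj a) = (joinInl A' B).obj (u.obj a) := fun a => by
    have h : ∃ l, i.obj l = i.obj a := ⟨a, rfl⟩
    simp only [ob, dif_pos h]
    rw [s.inj₀ h.choose_spec]
  have o₂ : ∀ x, χ.obj x ≠ endpt 0 → ob x = joinB₀ A' B x := fun x hx => by
    have h : ¬ ∃ l, i.obj l = x := by rintro ⟨l, rfl⟩; exact hx (s.obj_eq l)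
    simp only [ob, dif_neg h]
  -- A cell that leaves `A` is remembered only through its endpoints. The values given to cells with
  -- target in `A` do not matter, as `extend` ignores them.
  let m : B.Two → (join A' B).Two := fun α =>
    if h : ∃ a, i.obj a = B.src (B.dom α) then joinMix₂ A' B (u.obj h.choose) (B.tgt (B.dom α))
    else joinB₂ A' B α
  let m₁ : B.One → (join A' B).One := fun f =>
    if h : ∃ a, i.obj a = B.src f then joinMix₁ A' B (u.obj h.choose) (B.tgt f)
    else joinB₁ A' B f
  have p₁ : ∀ f a, B.src f = i.obj a → m₁ f = joinMix₁ A' B (u.obj a) (B.tgt f) :=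
    fun f a ha => by
      have h : ∃ a, i.obj a = B.src f := ⟨a, ha.symm⟩
      simp only [m₁, dif_pos h]
      rw [s.inj₀ (h.choose_spec.trans ha)]
  have p₂ : ∀ f, χ.obj (B.src f) ≠ endpt 0 → m₁ f = joinB₁ A' B f := fun f hf => by
    have h : ¬ ∃ a, i.obj a = B.src f := by rintro ⟨l, hl⟩; rw [← hl] at hf; exact hf (s.obj_eq l)
    simp only [m₁, dif_neg h]
  have q₁ : ∀ α a, B.src (B.dom α) = i.obj a →
      m α = joinMix₂ A' B (u.obj a) (B.tgt (B.dom α)) := fun f a ha => by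
    have h : ∃ a, i.obj a = B.src (B.dom f) := ⟨a, ha.symm⟩
    simp only [m, dif_pos h]
    rw [s.inj₀ (h.choose_spec.trans ha)]
  have q₂ : ∀ α, χ.obj (B.src (B.dom α)) ≠ endpt 0 → m α = joinB₂ A' B α := fun f hf => by
    have h : ¬ ∃ a, i.obj a = B.src (B.dom f) := by
      rintro ⟨l, hl⟩; rw [← hl] at hf; exact hf (s.obj_eq l)
    simp only [m, dif_neg h]
  have c : ∀ x, (∃ a, x = i.obj a) ∨ χ.obj x ≠ endpt 0 := fun x => by
    by_cases h : χ.obj x = endpt 0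
    · obtain ⟨k, hk⟩ := s.surj₀ x h; exact Or.inl ⟨k, hk.symm⟩
    · exact Or.inr h
  obtain ⟨F, h₁, h₂, h₃, h₄⟩ := s.extend (u ≫ joinInl A' B) ob m₁ m o₁
    (fun f _ => by
      obtain ⟨a, ha⟩ | h := c (B.src f)
      · rw [p₁ f a ha, ha, o₁]; rfl
      · rw [p₂ f h, o₂ _ h]; rfl)
    (fun f hf => by
      obtain ⟨a, ha⟩ | h := c (B.src f)
      · rw [p₁ f a ha, o₂ _ hf]; rfl
      · rw [p₂ f h, o₂ _ hf]; rfl)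
    (fun f _ => by
      obtain ⟨a, ha⟩ | h := c (B.src (B.dom f))
      · rw [p₁ _ a ha, q₁ _ a ha]; rfl
      · rw [p₂ _ h, q₂ _ h]; rfl)
    (fun f _ => by
      obtain ⟨a, ha⟩ | h := c (B.src (B.dom f))
      · rw [p₁ _ a (by rw [B.src_cod, ha]), q₁ _ a ha, B.tgt_cod]; rfl
      · rw [p₂ _ (by rwa [B.src_cod]), q₂ _ h]; rfl)
    (fun x hx => by rw [p₂ _ (by rwa [B.src_one]), o₂ _ hx]; rfl)
    (fun g f _ hf hgf => by
      rw [p₂ g (by rwa [hgf])]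
      obtain ⟨a, ha⟩ | h := c (B.src f)
      · rw [p₁ f a ha, p₁ _ a (by rw [src_cmp hgf, ha]), tgt_cmp, joinB₁_cmp_mix hgf]
      · rw [p₂ f h, p₂ _ (by rwa [src_cmp hgf]), joinB₁_cmp hgf])
    (fun g k _ hgk => by
      rw [p₁ g (A.tgt k) (by rw [hgk, i.tgt_map]), p₁ _ (A.src k) (by rw [src_cmp hgk, i.src_map]),
        tgt_cmp, comp_map, joinMix₁_cmp (u.tgt_map k).symm, u.src_map])
    (fun f _ => by
      obtain ⟨a, ha⟩ | h := c (B.src f)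
      · rw [p₁ f a ha, q₁ _ a (by rw [B.dom_two, ha]), B.dom_two]; rfl
      · rw [p₂ f h, q₂ _ (by rwa [B.dom_two])]; rfl)
    (fun β α _ h => by
      obtain ⟨a, ha⟩ | hs := c (B.src (B.dom α))
      · have hb : B.src (B.dom β) = i.obj a := by rw [h, B.src_cod, ha]
        rw [q₁ α a ha, q₁ β a hb, q₁ _ a (by rw [src_dom_vc, hb]), tgt_dom_vc, h, B.tgt_cod,
          joinMix₂_vc]
      · have hb : χ.obj (B.src (B.dom β)) ≠ endpt 0 := by rwa [h, B.src_cod]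
        rw [q₂ α hs, q₂ β hb, q₂ _ (by rwa [src_dom_vc]), joinB₂_vc h])
    (fun g f _ hf hgf => by
      rw [q₂ g (by rwa [hgf])]
      obtain ⟨a, ha⟩ | h := c (B.src (B.dom f))
      · rw [q₁ f a ha, q₁ _ a (by rw [src_dom_hc hgf, ha]), tgt_dom_hc, joinB₂_hc_mix hgf]
      · rw [q₂ f h, q₂ _ (by rwa [src_dom_hc hgf]), joinB₂_hc hgf])
    (fun g k _ hgk => by
      rw [q₁ g (A.tgt (A.dom k)) (by rw [hgk, i.dom_map₂, i.tgt_map]),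
        q₁ _ (A.src (A.dom k)) (by rw [src_dom_hc hgk, i.dom_map₂, i.src_map]),
        tgt_dom_hc, comp_map₂, joinMix₂_hc (by rw [u.dom_map₂, u.tgt_map]), u.dom_map₂, u.src_map])
  have tg : ∀ f, χ.obj (B.src f) ≠ endpt 0 → χ.obj (B.tgt f) ≠ endpt 0 :=
    fun f hf h => hf (src_eq_zero χ f h)
  exact ⟨F, h₁, fun x hx => by rw [h₂, o₂ x hx], fun f hf => by rw [h₃ f (tg f hf), p₂ f hf],
    fun α hα => by rw [h₄ α (tg _ hα), q₂ _ hα]⟩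

/-- The objects of a pushout come from the two 2-categories that are glued. -/
theorem obj_cases_of_isPushout (sq : IsPushout u i i' v) (x : B'.Obj) :
    (∃ a, i'.obj a = x) ∨ ∃ b, v.obj b = x := by
  let P : B'.Obj → Prop := fun x => (∃ a, i'.obj a = x) ∨ ∃ b, v.obj b = x
  let U : Sub B' :=
    { P₀ := P
      P₁ := fun f => P (B'.src f) ∧ P (B'.tgt f)
      P₂ := fun α => P (B'.src (B'.dom α)) ∧ P (B'.tgt (B'.dom α))
      src := fun _ h => h.1
      tgt := fun _ h => h.2
      dom := fun _ h => h
      cod := fun _ h => by rwa [B'.src_cod, B'.tgt_cod]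
      one := fun _ h => by rw [B'.src_one, B'.tgt_one]; exact ⟨h, h⟩
      two := fun _ h => by rwa [B'.dom_two]
      cmp := fun _ _ h hg hf => by rw [src_cmp h, tgt_cmp]; exact ⟨hf.1, hg.2⟩
      vc := fun _ _ _ hg _ => by rwa [src_dom_vc, tgt_dom_vc]
      hc := fun _ _ h hg hf => by rw [src_dom_hc h, tgt_dom_hc]; exact ⟨hf.1, hg.2⟩ }
  have a₀ : ∀ a, P (i'.obj a) := fun a => Or.inl ⟨a, rfl⟩
  have b₀ : ∀ b, P (v.obj b) := fun b => Or.inr ⟨b, rfl⟩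
  refine (Sub.of_isPushout sq U a₀ ?_ ?_ b₀ ?_ ?_).1 x <;> intro f <;>
    simp only [U, StrictFunctor.dom_map₂, StrictFunctor.src_map, StrictFunctor.tgt_map, a₀, b₀,
      and_self]

/-- The inclusion of `A'` in the join and the collapse `F` of `B` glue to a 2-functor `J` on `B'`.
Since `i' ≫ J` is an inclusion, `i'` is injective; since `v ≫ J` is the inclusion of `B` on cells
with source outside `A`, `v` is injective there. The classifying map `χ'` glues the constant `0` and
`χ`, and generation of `B'` by the two images shows that cells over `0` come from `A'`. -/
theorem exists_sievePushout (sq : IsPushout u i i' v) (hi : IsSieve i) :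
    ∃ χ χ', SievePushout u i i' v χ χ' := by
  obtain ⟨χ, s⟩ := hi.exists_isSieveOf
  obtain ⟨F, hF, F₀, F₁, F₂⟩ := s.exists_toJoin u
  let J : B' ⟶ join A' B := sq.desc (joinInl A' B) F hF.symm
  have e₁ : i' ≫ J = joinInl A' B := sq.inl_desc _ _ _
  have e₂ : v ≫ J = F := sq.inr_desc _ _ _
  have one_ext : ∀ e : interval.{w}.One, interval.tgt e = endpt 0 →
      e = interval.one (endpt 0) := fun e h => interval_one_ext (interval_src_eq e h) h
  have hχ : u ≫ const A' (endpt 0) = i ≫ χ := by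
    ext x
    · exact (s.obj_eq x).symm
    · exact (one_ext _ (by rw [comp_map, χ.tgt_map, i.tgt_map, s.obj_eq])).symm
    · refine (one_ext _ ?_).symm
      have := χ.dom_map₂ (i.map₂ x)
      exact (congrArg interval.tgt this).trans (by rw [χ.tgt_map, i.dom_map₂, i.tgt_map, s.obj_eq])
  let χ' : B' ⟶ interval := sq.desc _ _ hχ
  have e₃ : i' ≫ χ' = const A' (endpt 0) := sq.inl_desc _ _ _
  have e₄ : v ≫ χ' = χ := sq.inr_desc _ _ _
  have k₀ : ∀ a, χ'.obj (i'.obj a) = endpt 0 := fun a => congr_functor_obj e₃ a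
  have k₁ : ∀ x, χ'.obj (v.obj x) = χ.obj x := fun x => congr_functor_obj e₄ x
  have j₀ : ∀ {a b}, i'.obj a = i'.obj b → a = b := fun {a b} h => by
    have := congrArg J.obj h
    rw [← comp_obj, ← comp_obj, e₁] at this
    exact Sum.inl_injective this
  have j₁ : ∀ {a b}, i'.map a = i'.map b → a = b := fun {a b} h => by
    have := congrArg J.map h
    rw [← comp_map, ← comp_map, e₁] at this
    exact Sum.inl_injective this
  have j₂ : ∀ {a b}, i'.map₂ a = i'.map₂ b → a = b := fun {a b} h => by
    have := congrArg J.map₂ h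
    rw [← comp_map₂, ← comp_map₂, e₁] at this
    exact Sum.inl_injective this
  have gen₀ : ∀ x, χ'.obj x = endpt 0 → ∃ a, i'.obj a = x := fun x h => by
    obtain ⟨a, rfl⟩ | ⟨b, rfl⟩ := obj_cases_of_isPushout sq x
    · exact ⟨a, rfl⟩
    · obtain ⟨a, rfl⟩ := s.surj₀ b (by rwa [k₁] at h)
      exact ⟨_, congr_functor_obj sq.w a⟩
  -- Coming from `A'` as soon as the target is over `0` is stable under composition: both factors
  -- then come from `A'`, where they are composable because `i'` is injective.
  let U : Sub B' :=
    { P₀ := fun x => χ'.obj x = endpt 0 → ∃ a, i'.obj a = x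
      P₁ := fun f => χ'.obj (B'.tgt f) = endpt 0 → ∃ a, i'.map a = f
      P₂ := fun α => χ'.obj (B'.tgt (B'.dom α)) = endpt 0 → ∃ a, i'.map₂ a = α
      src := fun _ _ => gen₀ _
      tgt := fun _ _ => gen₀ _
      dom := fun α h h' => by
        obtain ⟨k, rfl⟩ := h h'
        exact ⟨_, (i'.dom_map₂ k).symm⟩
      cod := fun α h h' => by
        obtain ⟨k, rfl⟩ := h (by rwa [B'.tgt_cod] at h')
        exact ⟨_, (i'.cod_map₂ k).symm⟩
      one := fun x h h' => by
        obtain ⟨k, rfl⟩ := h (by rwa [B'.tgt_one] at h')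
        exact ⟨_, i'.map_one k⟩
      two := fun f h h' => by
        obtain ⟨k, rfl⟩ := h (by rwa [B'.dom_two] at h')
        exact ⟨_, i'.map₂_two k⟩
      cmp := fun g f hgf hg hf h' => by
        rw [tgt_cmp] at h'
        obtain ⟨k, rfl⟩ := hg h'
        obtain ⟨l, rfl⟩ := hf (by rw [← hgf, i'.src_map, k₀])
        exact ⟨_, i'.map_cmp (j₀ (by rw [← i'.src_map, ← i'.tgt_map, hgf]))⟩
      vc := fun g f hgf hg hf h' => by
        rw [tgt_dom_vc] at h'
        obtain ⟨k, rfl⟩ := hg h'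
        obtain ⟨l, rfl⟩ := hf (by rwa [← B'.tgt_cod, ← hgf])
        exact ⟨_, i'.map₂_vc (j₁ (by rw [← i'.dom_map₂, ← i'.cod_map₂, hgf]))⟩
      hc := fun g f hgf hg hf h' => by
        rw [tgt_dom_hc] at h'
        obtain ⟨k, rfl⟩ := hg h'
        obtain ⟨l, rfl⟩ := hf (by rw [← hgf, i'.dom_map₂, i'.src_map, k₀])
        exact ⟨_, i'.map₂_hc (j₀ (by
          rw [← i'.src_map, ← i'.tgt_map, ← i'.dom_map₂, ← i'.dom_map₂, hgf]))⟩ }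
  have gen := Sub.of_isPushout sq U (fun x _ => ⟨x, rfl⟩) (fun x _ => ⟨x, rfl⟩)
    (fun x _ => ⟨x, rfl⟩)
    (fun _ => gen₀ _)
    (fun f h => by
      obtain ⟨a, rfl⟩ := s.surj₁ f (by rwa [v.tgt_map, k₁] at h)
      exact ⟨_, congr_functor_map sq.w a⟩)
    (fun f h => by
      obtain ⟨a, rfl⟩ := s.surj₂ f (by rwa [v.dom_map₂, v.tgt_map, k₁] at h)
      exact ⟨_, congr_functor_map₂ sq.w a⟩)
  refine ⟨χ, χ', sq, s, ⟨k₀, j₀, j₁, j₂, gen₀, gen.2.1, gen.2.2⟩, e₄, ?_, ?_, ?_⟩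
  · intro x y hx h
    have hy : χ.obj y ≠ endpt 0 := by rwa [← k₁, ← h, k₁]
    have := congrArg J.obj h
    rw [← comp_obj, ← comp_obj, e₂, F₀ x hx, F₀ y hy] at this
    exact Sum.inr_injective this
  · intro x y hx h
    have hy : χ.obj (B.src y) ≠ endpt 0 := by
      rwa [← k₁, ← v.src_map, ← h, v.src_map, k₁]
    have := congrArg J.map h
    rw [← comp_map, ← comp_map, e₂, F₁ x hx, F₁ y hy] at this
    exact Sum.inl_injective (Sum.inr_injective this)
  · intro x y hx h
    have hy : χ.obj (B.src (B.dom y)) ≠ endpt 0 := by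
      rwa [← k₁, ← v.src_map, ← v.dom_map₂, ← h, v.dom_map₂, v.src_map, k₁]
    have := congrArg J.map₂ h
    rw [← comp_map₂, ← comp_map₂, e₂, F₂ x hx, F₂ y hy] at this
    exact Sum.inl_injective (Sum.inr_injective this)

namespace SievePushout

theorem tgt_ne_zero {f : B.One} (h : χ.obj (B.src f) ≠ endpt 0) :
    χ.obj (B.tgt f) ≠ endpt 0 :=
  fun h' => h (src_eq_zero χ f h')

variable (P : SievePushout u i i' v χ χ')
include P

theorem comm₀ (a : A.Obj) : v.obj (i.obj a) = i'.obj (u.obj a) := (congr_functor_obj P.sq.w a).symm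
theorem comm₁ (a : A.One) : v.map (i.map a) = i'.map (u.map a) := (congr_functor_map P.sq.w a).symm
theorem comm₂ (a : A.Two) : v.map₂ (i.map₂ a) = i'.map₂ (u.map₂ a) :=
  (congr_functor_map₂ P.sq.w a).symm

theorem chi_obj (x : B.Obj) : χ'.obj (v.obj x) = χ.obj x := congr_functor_obj P.w x

theorem obj_cases (x : B'.Obj) : (∃ a, x = i'.obj a) ∨ ∃ b, χ.obj b ≠ endpt 0 ∧ x = v.obj b := by
  obtain ⟨a, rfl⟩ | ⟨b, rfl⟩ := obj_cases_of_isPushout P.sq x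
  · exact Or.inl ⟨a, rfl⟩
  · by_cases h : χ.obj b = endpt 0
    · obtain ⟨a, rfl⟩ := P.sieve.surj₀ b h
      exact Or.inl ⟨_, P.comm₀ a⟩
    · exact Or.inr ⟨b, h, rfl⟩

/-- A 1-cell of the pushout with target outside of `A'` comes from `B`, up to precomposition by a
1-cell of `A'`. -/
theorem one_cases (f : B'.One) :
    (∃ k, f = i'.map k) ∨ (∃ g, χ.obj (B.src g) ≠ endpt 0 ∧ f = v.map g) ∨
      ∃ g k, χ.obj (B.src g) = endpt 0 ∧ χ.obj (B.tgt g) ≠ endpt 0 ∧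
        B'.src (v.map g) = B'.tgt (i'.map k) ∧ f = B'.cmp (v.map g) (i'.map k) := by
  let Q : B'.One → Prop := fun f =>
    (∃ k, f = i'.map k) ∨ (∃ g, χ.obj (B.src g) ≠ endpt 0 ∧ f = v.map g) ∨
      ∃ g k, χ.obj (B.src g) = endpt 0 ∧ χ.obj (B.tgt g) ≠ endpt 0 ∧
        B'.src (v.map g) = B'.tgt (i'.map k) ∧ f = B'.cmp (v.map g) (i'.map k)
  have hi : ∀ k, Q (i'.map k) := fun k => Or.inl ⟨k, rfl⟩
  have hv : ∀ g, Q (v.map g) := fun g => by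
    by_cases h : χ.obj (B.tgt g) = endpt 0
    · obtain ⟨k, rfl⟩ := P.sieve.surj₁ g h
      exact Or.inl ⟨_, P.comm₁ k⟩
    · by_cases h' : χ.obj (B.src g) = endpt 0
      -- A 1-cell of `B` that leaves `A` takes the third form, with an identity of `A'` as second
      -- factor.
      · obtain ⟨a, ha⟩ := P.sieve.surj₀ _ h'
        have e : B'.src (v.map g) = i'.obj (u.obj a) := by rw [v.src_map, ← ha, P.comm₀]
        exact Or.inr (Or.inr ⟨g, A'.one (u.obj a), h', h, by rw [e, i'.tgt_map, A'.tgt_one],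
          by rw [i'.map_one, cmp_one e.symm]⟩)
      · exact Or.inr (Or.inl ⟨g, h', rfl⟩)
  have hc : ∀ g f, B'.src g = B'.tgt f → Q g → Q f → Q (B'.cmp g f) := by
    rintro g f h (⟨k, rfl⟩ | ⟨g, hg, rfl⟩ | ⟨g, k, hg, hg', hk, rfl⟩) hf
    · obtain ⟨l, rfl⟩ := P.sieve'.surj₁ f (by rw [← h, i'.src_map, P.sieve'.obj_eq])
      rw [← i'.map_cmp (P.sieve'.inj₀ (by rw [← i'.src_map, ← i'.tgt_map, h]))]
      exact hi _
    · obtain ⟨k, rfl⟩ | ⟨f, hf, rfl⟩ | ⟨f, k, hf, hf', hk, rfl⟩ := hf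
      · rw [v.src_map] at h
        exact absurd (by rw [← P.chi_obj, h, P.sieve'.tgt_map]) hg
      · rw [v.src_map, v.tgt_map] at h
        rw [← v.map_cmp (P.inj₀ hg h)]
        exact hv _
      · rw [tgt_cmp, v.src_map, v.tgt_map] at h
        have h' := P.inj₀ hg h
        rw [← cmp_assoc (by rw [v.src_map, v.tgt_map, h]) hk, ← v.map_cmp h']
        exact Or.inr (Or.inr ⟨_, k, by rwa [src_cmp h'], by rw [tgt_cmp]; exact tgt_ne_zero hg,
          by rw [v.src_map, src_cmp h', ← v.src_map, hk], rfl⟩)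
    -- The source of the left factor is in `A'`, hence so is `f`, which is absorbed into `k`.
    · rw [src_cmp hk, i'.src_map] at h
      obtain ⟨l, rfl⟩ := P.sieve'.surj₁ f (by rw [← h, P.sieve'.obj_eq])
      have h' : A'.src k = A'.tgt l := P.sieve'.inj₀ (by rw [h, i'.tgt_map])
      rw [cmp_assoc hk (by rw [i'.src_map, h]), ← i'.map_cmp h']
      exact Or.inr (Or.inr ⟨g, _, hg, hg', by rw [hk, i'.tgt_map, i'.tgt_map, tgt_cmp], rfl⟩)
  let U : Sub B' :=
    { P₀ := fun _ => True
      P₁ := Q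
      P₂ := fun α => Q (B'.dom α) ∧ Q (B'.cod α)
      src := fun _ _ => trivial
      tgt := fun _ _ => trivial
      dom := fun _ h => h.1
      cod := fun _ h => h.2
      one := fun x _ => by
        obtain ⟨a, rfl⟩ | ⟨b, _, rfl⟩ := P.obj_cases x
        · rw [← i'.map_one]; exact hi _
        · rw [← v.map_one]; exact hv _
      two := fun f h => by rw [B'.dom_two, B'.cod_two]; exact ⟨h, h⟩
      cmp := hc
      vc := fun β α h hβ hα => by rw [dom_vc h, cod_vc]; exact ⟨hα.1, hβ.2⟩
      hc := fun β α h hβ hα => by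
        rw [dom_hc h, cod_hc h]
        exact ⟨hc _ _ h hβ.1 hα.1, hc _ _ (by rw [B'.src_cod, B'.tgt_cod, h]) hβ.2 hα.2⟩ }
  refine (Sub.of_isPushout P.sq U (fun _ => trivial) hi ?_ (fun _ => trivial) hv ?_).2.1 f
  · intro α; simp only [U, i'.dom_map₂, i'.cod_map₂, hi, and_self]
  · intro α; simp only [U, v.dom_map₂, v.cod_map₂, hv, and_self]

end SievePushout

/-- The 2-cells of `B'` that are vertical composites of 2-cells of `B`, possibly precomposed by
2-cells of `A'`. -/
inductive Generated (i' : A' ⟶ B') (v : B ⟶ B') (χ : B ⟶ interval.{w}) : B'.Two → Prop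
  | of (α : B.Two) (h : χ.obj (B.src (B.dom α)) ≠ endpt 0) : Generated i' v χ (v.map₂ α)
  | of_hc (α : B.Two) (β : A'.Two) (h : χ.obj (B.src (B.dom α)) = endpt 0)
      (h' : χ.obj (B.tgt (B.dom α)) ≠ endpt 0)
      (hc : B'.src (B'.dom (v.map₂ α)) = B'.tgt (B'.dom (i'.map₂ β))) :
      Generated i' v χ (B'.hc (v.map₂ α) (i'.map₂ β))
  | vc (β α : B'.Two) (h : B'.dom β = B'.cod α) (hβ : Generated i' v χ β)
      (hα : Generated i' v χ α) : Generated i' v χ (B'.vc β α)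

namespace SievePushout

variable (P : SievePushout u i i' v χ χ')
include P

/-- The whiskering cell is absorbed into the second factor of a generator `of_hc`. It passes through
vertical composites by interchange, once written as the vertical composite of itself and an
identity. -/
theorem generated_hc_right {γ : B'.Two} (hγ : Generated i' v χ γ) : ∀ β : A'.Two,
    B'.src (B'.dom γ) = B'.tgt (B'.dom (i'.map₂ β)) →
    Generated i' v χ (B'.hc γ (i'.map₂ β)) := by
  induction hγ with
  | of α h =>
    intro β hβ
    rw [v.dom_map₂, v.src_map] at hβ
    exact absurd (by rw [← P.chi_obj, hβ, P.sieve'.tgt_dom_map₂]) h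
  | of_hc α β₀ h h' hc =>
    intro β hβ
    rw [src_dom_hc hc] at hβ
    rw [hc_assoc hc hβ, ← i'.map₂_hc (P.sieve'.inj₀ (by
      rw [← i'.src_map, ← i'.tgt_map, ← i'.dom_map₂, ← i'.dom_map₂, hβ]))]
    refine .of_hc _ _ h h' ?_
    rw [hc]
    simp only [i'.dom_map₂, i'.tgt_map, tgt_dom_hc]
  | vc γ₁ γ₂ h _ _ ih₁ ih₂ =>
    intro β hβ
    rw [src_dom_vc] at hβ
    have hβ' : B'.src (B'.dom γ₂) = B'.tgt (B'.dom (i'.map₂ β)) := by rw [← hβ, h, B'.src_cod]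
    have e : i'.map₂ β = B'.vc (i'.map₂ β) (i'.map₂ (A'.two (A'.dom β))) := by
      rw [← i'.map₂_vc (A'.cod_two _).symm, vc_two rfl]
    have e' : B'.dom (i'.map₂ (A'.two (A'.dom β))) = B'.dom (i'.map₂ β) := by
      rw [i'.dom_map₂, i'.dom_map₂, A'.dom_two]
    have e'' : B'.cod (i'.map₂ (A'.two (A'.dom β))) = B'.dom (i'.map₂ β) := by
      rw [i'.dom_map₂, i'.cod_map₂, A'.cod_two]
    rw [e, vc_hc_vc h e''.symm (by rw [e', hβ'])]
    refine .vc _ _ ?_ (ih₁ _ hβ) (ih₂ _ (by rw [e', hβ']))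
    rw [dom_hc hβ, cod_hc (by rw [e', hβ']), h, e'']

/-- A generator `of_hc` has its source in `A'`. So only cells of `B` occur here, and those that are
vertically composable in `B'` already are in `B`, by injectivity of `v` outside `A`. -/
theorem generated_of_src {γ : B'.Two} (hγ : Generated i' v χ γ) :
    χ'.obj (B'.src (B'.dom γ)) ≠ endpt 0 →
    ∃ α, χ.obj (B.src (B.dom α)) ≠ endpt 0 ∧ v.map₂ α = γ := by
  induction hγ with
  | of α h => exact fun _ => ⟨α, h, rfl⟩
  | of_hc α β h h' hc =>
    intro hs
    rw [src_dom_hc hc, i'.dom_map₂, i'.src_map, P.sieve'.obj_eq] at hs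
    exact absurd rfl hs
  | vc γ₁ γ₂ h _ _ ih₁ ih₂ =>
    intro hs
    rw [src_dom_vc] at hs
    obtain ⟨α₁, h₁, rfl⟩ := ih₁ hs
    obtain ⟨α₂, h₂, rfl⟩ := ih₂ (by rwa [h, B'.src_cod] at hs)
    rw [v.dom_map₂, v.cod_map₂] at h
    exact ⟨B.vc α₁ α₂, by rwa [src_dom_vc], v.map₂_vc (P.inj₁ h₁ h)⟩

/-- The left factor merges with the `B`-part of each generator, composability in `B` being given by
injectivity of `v` outside `A`. Vertical composites are treated by interchange. -/
theorem generated_hc_left {δ : B'.Two} (hδ : Generated i' v χ δ) : ∀ α : B.Two,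
    χ.obj (B.src (B.dom α)) ≠ endpt 0 → B'.src (B'.dom (v.map₂ α)) = B'.tgt (B'.dom δ) →
    Generated i' v χ (B'.hc (v.map₂ α) δ) := by
  induction hδ with
  | of β h =>
    intro α hα hαβ
    rw [v.dom_map₂, v.dom_map₂, v.src_map, v.tgt_map] at hαβ
    have := P.inj₀ hα hαβ
    rw [← v.map₂_hc this]
    exact .of _ (by rwa [src_dom_hc this])
  | of_hc β β₀ h h' hc =>
    intro α hα hαβ
    rw [tgt_dom_hc] at hαβ
    rw [← hc_assoc hαβ hc]
    rw [v.dom_map₂, v.dom_map₂, v.src_map, v.tgt_map] at hαβ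
    have e := P.inj₀ hα hαβ
    rw [← v.map₂_hc e]
    refine .of_hc _ _ (by rwa [src_dom_hc e]) (by rw [tgt_dom_hc]; exact tgt_ne_zero hα) ?_
    rw [← hc, v.dom_map₂, v.dom_map₂, v.src_map, v.src_map, src_dom_hc e]
  | vc γ₁ γ₂ h _ _ ih₁ ih₂ =>
    intro α hα hαβ
    rw [tgt_dom_vc] at hαβ
    have hβ' : B'.src (B'.dom (v.map₂ α)) = B'.tgt (B'.dom γ₂) := by rw [hαβ, h, B'.tgt_cod]
    have e : v.map₂ α = B'.vc (v.map₂ α) (v.map₂ (B.two (B.dom α))) := by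
      rw [← v.map₂_vc (B.cod_two _).symm, vc_two rfl]
    have e' : B'.dom (v.map₂ (B.two (B.dom α))) = B'.dom (v.map₂ α) := by
      rw [v.dom_map₂, v.dom_map₂, B.dom_two]
    have e'' : B'.cod (v.map₂ (B.two (B.dom α))) = B'.dom (v.map₂ α) := by
      rw [v.dom_map₂, v.cod_map₂, B.cod_two]
    rw [e, vc_hc_vc e''.symm h (by rw [e', hβ'])]
    refine .vc _ _ ?_ (ih₁ _ hα hαβ) (ih₂ _ (by rwa [B.dom_two]) (by rw [e', hβ']))
    rw [dom_hc hαβ, cod_hc (by rw [e', hβ']), h, e'']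

/-- The cells of `A'` and the generated cells together form a sub-2-category containing both images,
hence everything. -/
theorem generated (γ : B'.Two) (hγ : χ'.obj (B'.tgt (B'.dom γ)) ≠ endpt 0) :
    Generated i' v χ γ := by
  let Q : B'.Two → Prop := fun γ => (∃ β, γ = i'.map₂ β) ∨ Generated i' v χ γ
  have hi : ∀ β, Q (i'.map₂ β) := fun β => Or.inl ⟨β, rfl⟩
  have hv : ∀ α, Q (v.map₂ α) := fun α => by
    by_cases h : χ.obj (B.tgt (B.dom α)) = endpt 0
    · obtain ⟨k, rfl⟩ := P.sieve.surj₂ α h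
      exact Or.inl ⟨_, P.comm₂ k⟩
    · by_cases h' : χ.obj (B.src (B.dom α)) = endpt 0
      · obtain ⟨a, ha⟩ := P.sieve.surj₀ _ h'
        have e : B'.src (B'.dom (v.map₂ α)) = i'.obj (u.obj a) := by
          rw [v.dom_map₂, v.src_map, ← ha, P.comm₀]
        have e' : v.map₂ α = B'.hc (v.map₂ α) (i'.map₂ (A'.two (A'.one (u.obj a)))) := by
          rw [i'.map₂_two, i'.map_one, hc_one e.symm]
        rw [e']
        exact Or.inr (.of_hc _ _ h' h (by
          rw [e, i'.map₂_two, B'.dom_two, i'.tgt_map, A'.tgt_one]))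
      · exact Or.inr (.of α h')
  let U : Sub B' :=
    { P₀ := fun _ => True
      P₁ := fun _ => True
      P₂ := Q
      src := fun _ _ => trivial
      tgt := fun _ _ => trivial
      dom := fun _ _ => trivial
      cod := fun _ _ => trivial
      one := fun _ _ => trivial
      cmp := fun _ _ _ _ _ => trivial
      two := fun f _ => by
        obtain ⟨k, rfl⟩ | ⟨g, hg, rfl⟩ | ⟨g, k, hg, hg', hk, rfl⟩ := P.one_cases f
        · rw [← i'.map₂_two]; exact hi _
        · rw [← v.map₂_two]; exact hv _
        · rw [← hc_two hk, ← v.map₂_two, ← i'.map₂_two]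
          exact Or.inr (.of_hc _ _ (by rwa [B.dom_two]) (by rwa [B.dom_two]) (by
            rw [v.dom_map₂, i'.dom_map₂, B.dom_two, A'.dom_two, hk]))
      vc := by
        rintro γ δ h (⟨β, rfl⟩ | hγ) (⟨α, rfl⟩ | hδ)
        · rw [i'.dom_map₂, i'.cod_map₂] at h
          rw [← i'.map₂_vc (P.sieve'.inj₁ h)]
          exact hi _
        · obtain ⟨α, rfl⟩ := P.sieve'.surj₂ δ (by
            rw [← B'.tgt_cod, ← h, P.sieve'.tgt_dom_map₂])
          rw [i'.dom_map₂, i'.cod_map₂] at h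
          rw [← i'.map₂_vc (P.sieve'.inj₁ h)]
          exact hi _
        · obtain ⟨β, rfl⟩ := P.sieve'.surj₂ γ (by
            rw [h, B'.tgt_cod, P.sieve'.tgt_dom_map₂])
          rw [i'.dom_map₂, i'.cod_map₂] at h
          rw [← i'.map₂_vc (P.sieve'.inj₁ h)]
          exact hi _
        · exact Or.inr (.vc _ _ h hγ hδ)
      hc := by
        rintro γ δ h (⟨β, rfl⟩ | hγ) hδ
        · obtain ⟨α, rfl⟩ := P.sieve'.surj₂ δ (by
            rw [← h, i'.dom_map₂, i'.src_map, P.sieve'.obj_eq])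
          rw [i'.dom_map₂, i'.dom_map₂, i'.src_map, i'.tgt_map] at h
          rw [← i'.map₂_hc (P.sieve'.inj₀ h)]
          exact hi _
        · obtain ⟨β, rfl⟩ | hδ := hδ
          · exact Or.inr (P.generated_hc_right hγ β h)
          -- If the middle object is in `A'`, so is the right factor. Otherwise the left factor has
          -- its source outside `A'` and comes from a single 2-cell of `B`.
          · by_cases ht : χ'.obj (B'.tgt (B'.dom δ)) = endpt 0
            · obtain ⟨β, rfl⟩ := P.sieve'.surj₂ δ ht
              exact Or.inr (P.generated_hc_right hγ β h)
            · obtain ⟨α, hα, rfl⟩ := P.generated_of_src hγ (by rwa [h])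
              exact Or.inr (P.generated_hc_left hδ α hα h) }
  obtain ⟨β, rfl⟩ | h := (Sub.of_isPushout P.sq U (fun _ => trivial) (fun _ => trivial) hi
    (fun _ => trivial) (fun _ => trivial) hv).2.2 γ
  · exact absurd (P.sieve'.tgt_dom_map₂ β) hγ
  · exact h

end SievePushout

end

end TwoCat

/-! ### Families of categories, right modules of cells and tagged 1-cells -/

namespace TwoCat

section Family

variable {I : Type w} (Y : I → Type w) [∀ x, Category.{w} (Y x)]

/-- The 1-cells of the 2-category of a family of categories: functors, in the opposite direction. -/
structure FamilyOne where
  src : I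
  tgt : I
  fn : Y tgt ⥤ Y src

/-- The 2-cells of the 2-category of a family of categories: natural transformations. -/
structure FamilyTwo where
  src : I
  tgt : I
  dom : Y tgt ⥤ Y src
  cod : Y tgt ⥤ Y src
  nat : dom ⟶ cod

variable {Y}

/-- Composition of functors between members of a family. -/
def FamilyOne.comp : ∀ (g f : FamilyOne Y), g.src = f.tgt → FamilyOne Y
  | ⟨_, z, G⟩, ⟨x, _, F⟩, rfl => ⟨x, z, G ⋙ F⟩

/-- Vertical composition of natural transformations between members of a family. -/
def FamilyTwo.vcomp : ∀ (β α : FamilyTwo Y),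
    (⟨β.src, β.tgt, β.dom⟩ : FamilyOne Y) = ⟨α.src, α.tgt, α.cod⟩ → FamilyTwo Y
  | ⟨x, y, _, H, β⟩, ⟨_, _, F, _, α⟩, rfl => ⟨x, y, F, H, α ≫ β⟩

/-- Horizontal composition of natural transformations between members of a family. -/
def FamilyTwo.hcomp : ∀ (β α : FamilyTwo Y), β.src = α.tgt → FamilyTwo Y
  | ⟨_, z, G, G', β⟩, ⟨x, _, F, F', α⟩, rfl => ⟨x, z, G ⋙ F, G' ⋙ F', β ◫ α⟩

variable (Y)

/-- The 2-category whose objects index a family of categories, whose 1-cells from `x` to `y` are the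
functors from `Y y` to `Y x`, and whose 2-cells are the natural transformations. -/
abbrev ofFamily : TwoCat.{w} where
  Obj := I
  One := FamilyOne Y
  Two := FamilyTwo Y
  src := FamilyOne.src
  tgt := FamilyOne.tgt
  dom α := ⟨α.src, α.tgt, α.dom⟩
  cod α := ⟨α.src, α.tgt, α.cod⟩
  src_cod _ := rfl
  tgt_cod _ := rfl
  one x := ⟨x, x, 𝟭 _⟩
  two f := ⟨f.src, f.tgt, f.fn, f.fn, 𝟙 _⟩
  comp g f h := g.comp f h
  vcomp β α h := β.vcomp α h
  hcomp β α h := β.hcomp α h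
  src_one _ := rfl
  tgt_one _ := rfl
  src_comp := by rintro ⟨_, _, _⟩ ⟨_, _, _⟩ ⟨⟩; rfl
  tgt_comp := by rintro ⟨_, _, _⟩ ⟨_, _, _⟩ ⟨⟩; rfl
  one_comp := by rintro ⟨_, _, _⟩; rfl
  comp_one := by rintro ⟨_, _, _⟩; rfl
  comp_assoc := by rintro ⟨_, _, _⟩ ⟨_, _, _⟩ ⟨_, _, _⟩ ⟨⟩ ⟨⟩; rfl
  dom_two _ := rfl
  cod_two _ := rfl
  dom_vcomp := by rintro ⟨_, _, _, _, _⟩ ⟨_, _, _, _, _⟩ ⟨⟩; rfl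
  cod_vcomp := by rintro ⟨_, _, _, _, _⟩ ⟨_, _, _, _, _⟩ ⟨⟩; rfl
  two_vcomp := by rintro ⟨_, _, _, _, _⟩; simp [FamilyTwo.vcomp]
  vcomp_two := by rintro ⟨_, _, _, _, _⟩; simp [FamilyTwo.vcomp]
  vcomp_assoc := by
    rintro ⟨_, _, _, _, _⟩ ⟨_, _, _, _, _⟩ ⟨_, _, _, _, _⟩ ⟨⟩ ⟨⟩
    exact congrArg (FamilyTwo.mk _ _ _ _) (Category.assoc _ _ _).symm
  dom_hcomp := by rintro ⟨_, _, _, _, _⟩ ⟨_, _, _, _, _⟩ ⟨⟩; rfl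
  cod_hcomp := by rintro ⟨_, _, _, _, _⟩ ⟨_, _, _, _, _⟩ ⟨⟩; rfl
  one_hcomp := by
    rintro ⟨_, _, _, _, _⟩
    simp only [FamilyTwo.hcomp]
    congr 1
    ext; simp
  hcomp_one := by
    rintro ⟨_, _, _, _, _⟩
    simp only [FamilyTwo.hcomp]
    congr 1
    ext; simp
  hcomp_assoc := by
    rintro ⟨_, _, _, _, γ⟩ ⟨_, _, _, _, β⟩ ⟨_, _, _, _, α⟩ ⟨⟩ ⟨⟩
    have e : γ ◫ (β ◫ α) = (γ ◫ β) ◫ α := by ext; simp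
    exact congrArg (FamilyTwo.mk _ _ _ _) e.symm
  hcomp_two := by
    rintro ⟨_, _, G⟩ ⟨_, _, F⟩ ⟨⟩
    have e : 𝟙 G ◫ 𝟙 F = 𝟙 (G ⋙ F) := by ext; simp
    exact congrArg (FamilyTwo.mk _ _ _ _) e
  interchange := by
    rintro ⟨_, _, _, _, δ⟩ ⟨_, _, _, _, γ⟩ ⟨_, _, _, _, β⟩ ⟨_, _, _, _, α⟩ ⟨⟩ ⟨⟩ ⟨⟩
    have e : (γ ≫ δ) ◫ (α ≫ β) = (γ ◫ α) ≫ (δ ◫ β) := by ext; simp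
    exact congrArg (FamilyTwo.mk _ _ _ _) e

variable {Y}

theorem ofFamily_cmp {x y z : I} (G : Y z ⥤ Y y) (F : Y y ⥤ Y x) :
    (ofFamily Y).cmp ⟨y, z, G⟩ ⟨x, y, F⟩ = ⟨x, z, G ⋙ F⟩ :=
  (comp_eq (C := ofFamily Y) (g := ⟨y, z, G⟩) (f := ⟨x, y, F⟩) rfl).symm

theorem ofFamily_vc {x y : I} {F G H : Y y ⥤ Y x} (β : G ⟶ H) (α : F ⟶ G) :
    (ofFamily Y).vc ⟨x, y, G, H, β⟩ ⟨x, y, F, G, α⟩ = ⟨x, y, F, H, α ≫ β⟩ :=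
  (vcomp_eq (C := ofFamily Y) (β := ⟨x, y, G, H, β⟩) (α := ⟨x, y, F, G, α⟩) rfl).symm

theorem ofFamily_hc {x y z : I} {G G' : Y z ⥤ Y y} {F F' : Y y ⥤ Y x} (β : G ⟶ G')
    (α : F ⟶ F') :
    (ofFamily Y).hc ⟨y, z, G, G', β⟩ ⟨x, y, F, F', α⟩ = ⟨x, z, G ⋙ F, G' ⋙ F', β ◫ α⟩ :=
  (hcomp_eq (C := ofFamily Y) (β := ⟨y, z, G, G', β⟩) (α := ⟨x, y, F, F', α⟩) rfl).symm

/-- Compares natural transformations between functors that are only propositionally equal, as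
happens for the two sides of a horizontal composition law. -/
theorem FamilyTwo.mk_congr {x y : I} {F G F' G' : Y y ⥤ Y x} (hF : F = F') (hG : G = G')
    {η : F ⟶ G} {η' : F' ⟶ G'} (h : ∀ m, η.app m ≍ η'.app m) :
    (⟨x, y, F, G, η⟩ : FamilyTwo Y) = ⟨x, y, F', G', η'⟩ := by
  subst hF hG
  congr 1
  ext m
  exact eq_of_heq (h m)

end Family

/-- A map from the right `D`-module of cells of `X` with target `c`, where `D` acts through `j`, to
the right `D`-module of cells of `W` with target `z`, where `D` acts through `F`. -/
structure HomMap {D X W : TwoCat.{w}} (j : D ⟶ X) (F : D ⟶ W) (o : X.Obj → W.Obj) (c : X.Obj)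
    (z : W.Obj) where
  f₁ : X.One → W.One
  f₂ : X.Two → W.Two
  src : ∀ f, X.tgt f = c → W.src (f₁ f) = o (X.src f)
  tgt : ∀ f, X.tgt f = c → W.tgt (f₁ f) = z
  dom : ∀ α, X.tgt (X.dom α) = c → W.dom (f₂ α) = f₁ (X.dom α)
  cod : ∀ α, X.tgt (X.dom α) = c → W.cod (f₂ α) = f₁ (X.cod α)
  two : ∀ f, X.tgt f = c → f₂ (X.two f) = W.two (f₁ f)
  vc : ∀ β α, X.tgt (X.dom β) = c → X.dom β = X.cod α → f₂ (X.vc β α) = W.vc (f₂ β) (f₂ α)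
  act₁ : ∀ f k, X.tgt f = c → X.src f = X.tgt (j.map k) →
    f₁ (X.cmp f (j.map k)) = W.cmp (f₁ f) (F.map k)
  act₂ : ∀ α k, X.tgt (X.dom α) = c → X.src (X.dom α) = X.tgt (X.dom (j.map₂ k)) →
    f₂ (X.hc α (j.map₂ k)) = W.hc (f₂ α) (F.map₂ k)

namespace HomMap

variable {A B A' B' W : TwoCat.{w}} {u : A ⟶ A'} {i : A ⟶ B} {i' : A' ⟶ B'} {v : B ⟶ B'}
  {χ : B ⟶ interval.{w}} {χ' : B' ⟶ interval.{w}} {F : A' ⟶ W} {o : B'.Obj → W.Obj}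
  {c : B.Obj} {z : W.Obj}

/-- The 1-cells of `W` from `o x` to `z`, tagged by a 1-cell of `B` if `x` is outside of `A'`. -/
@[ext]
structure Tagged (χ' : B' ⟶ interval.{w}) (v : B ⟶ B') {D : TwoCat.{w}} {j : D ⟶ B} {G : D ⟶ W}
    (φ : HomMap j G (fun x => o (v.obj x)) c z) (x : B'.Obj) where
  w : W.One
  -- A 1-cell of `B` with target outside `A` has no image in `W` by which `w` could be precomposed;
  -- it acts on the tag instead. As a function of a proof that `x` is outside `A'`, the tag carries
  -- no information over `A'`.
  tag : χ'.obj x ≠ endpt 0 → B.One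
  src : W.src w = o x
  tgt : W.tgt w = z
  src_tag : ∀ h, v.obj (B.src (tag h)) = x
  tgt_tag : ∀ h, B.tgt (tag h) = c
  map_tag : ∀ h, φ.f₁ (tag h) = w

namespace Tagged

variable {D : TwoCat.{w}} {j : D ⟶ B} {G : D ⟶ W} {φ : HomMap j G (fun x => o (v.obj x)) c z}
  {x : B'.Obj}

/-- The 2-cells between tagged 1-cells. -/
@[ext]
structure Hom (m n : Tagged χ' v φ x) where
  w : W.Two
  tag : χ'.obj x ≠ endpt 0 → B.Two
  dom : W.dom w = m.w
  cod : W.cod w = n.w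
  dom_tag : ∀ h, B.dom (tag h) = m.tag h
  cod_tag : ∀ h, B.cod (tag h) = n.tag h
  map_tag : ∀ h, φ.f₂ (tag h) = w

noncomputable instance : Category (Tagged χ' v φ x) where
  Hom m n := Hom m n
  id m :=
    { w := W.two m.w
      tag := fun h => B.two (m.tag h)
      dom := W.dom_two _
      cod := W.cod_two _
      dom_tag := fun _ => B.dom_two _
      cod_tag := fun _ => B.cod_two _
      map_tag := fun h => by rw [φ.two _ (m.tgt_tag h), m.map_tag] }
  comp {m n p} α β :=
    { w := W.vc β.w α.w
      tag := fun h => B.vc (β.tag h) (α.tag h)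
      dom := by rw [dom_vc (by rw [β.dom, α.cod]), α.dom]
      cod := by rw [cod_vc, β.cod]
      dom_tag := fun h => by rw [dom_vc (by rw [β.dom_tag, α.cod_tag]), α.dom_tag]
      cod_tag := fun h => by rw [cod_vc, β.cod_tag]
      map_tag := fun h => by
        rw [φ.vc _ _ (by rw [β.dom_tag, n.tgt_tag]) (by rw [β.dom_tag, α.cod_tag]), α.map_tag,
          β.map_tag] }
  id_comp {m n} α := Hom.ext (vc_two α.dom.symm) (funext fun h => vc_two (α.dom_tag h).symm)
  comp_id {m n} α := Hom.ext (two_vc α.cod.symm) (funext fun h => two_vc (α.cod_tag h).symm)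
  assoc {m n p q} α β γ := Hom.ext
    (vc_assoc (by rw [γ.dom, β.cod]) (by rw [β.dom, α.cod])).symm
    (funext fun h => (vc_assoc (by rw [γ.dom_tag, β.cod_tag])
      (by rw [β.dom_tag, α.cod_tag])).symm)

theorem hom_ext {m n : Tagged χ' v φ x} {α β : m ⟶ n} (hw : Hom.w α = Hom.w β)
    (ht : ∀ h, Hom.tag α h = Hom.tag β h) : α = β :=
  Hom.ext hw (funext ht)

theorem hom_heq {m n m' n' : Tagged χ' v φ x} (hm : m = m') (hn : n = n') {α : m ⟶ n}
    {β : m' ⟶ n'} (hw : Hom.w α = Hom.w β) (ht : ∀ h, Hom.tag α h = Hom.tag β h) : α ≍ β := by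
  subst hm hn
  exact heq_of_eq (hom_ext hw ht)

theorem obj_ext {m n : Tagged χ' v φ x} (hw : m.w = n.w) (ht : ∀ h, m.tag h = n.tag h) : m = n :=
  Tagged.ext hw (funext ht)

theorem functor_ext {Z : Type*} [Category Z] {K L : Z ⥤ Tagged χ' v φ x}
    (h₁ : ∀ m, (K.obj m).w = (L.obj m).w) (h₂ : ∀ m h, (K.obj m).tag h = (L.obj m).tag h)
    (h₃ : ∀ {m n} (α : m ⟶ n), Hom.w (K.map α) = Hom.w (L.map α))
    (h₄ : ∀ {m n} (α : m ⟶ n) h, Hom.tag (K.map α) h = Hom.tag (L.map α) h) : K = L :=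
  have e : ∀ m, K.obj m = L.obj m := fun m => obj_ext (h₁ m) (h₂ m)
  Functor.hext e fun m n α => hom_heq (e m) (e n) (h₃ α) (h₄ α)

end Tagged

end HomMap

end TwoCat

/-! ### Precomposition functors between categories of tagged 1-cells -/

namespace TwoCat

namespace HomMap

variable {A B A' B' W : TwoCat.{w}} {u : A ⟶ A'} {i : A ⟶ B} {i' : A' ⟶ B'} {v : B ⟶ B'}
  {χ : B ⟶ interval.{w}} {χ' : B' ⟶ interval.{w}} {F : A' ⟶ W} {o : B'.Obj → W.Obj}
  {c : B.Obj} {z : W.Obj}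

namespace Tagged

section Left

variable {D : TwoCat.{w}} {j : D ⟶ B} {G : D ⟶ W} {φ : HomMap j G (fun x => o (v.obj x)) c z}
  (s' : IsSieveOf i' χ') (hF : ∀ a, F.obj a = o (i'.obj a)) (x y : B'.Obj)

/-- The action of a 1-cell of `A'` on tagged 1-cells. -/
noncomputable def pre (k : A'.One) (hx : i'.obj (A'.src k) = x) (hy : i'.obj (A'.tgt k) = y) :
    Tagged χ' v φ y ⥤ Tagged χ' v φ x :=
  have e : ∀ m : Tagged χ' v φ y, W.src m.w = W.tgt (F.map k) := fun m => by
    rw [m.src, F.tgt_map, hF, hy]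
  -- The object `x` is in `A'`, so every condition on tags over it is vacuous.
  have hn : ¬ χ'.obj x ≠ endpt 0 := fun h => h (by rw [← hx, s'.obj_eq])
  { obj := fun m =>
      { w := W.cmp m.w (F.map k)
        tag := fun h => (hn h).elim
        src := by rw [src_cmp (e m), F.src_map, hF, hx]
        tgt := by rw [tgt_cmp, m.tgt]
        src_tag := fun h => (hn h).elim
        tgt_tag := fun h => (hn h).elim
        map_tag := fun h => (hn h).elim }
    map := fun {m n} α =>
      { w := W.hc (Hom.w α) (W.two (F.map k))
        tag := fun h => (hn h).elim
        dom := by rw [dom_hc (by rw [α.dom, W.dom_two, e]), α.dom, W.dom_two]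
        cod := by rw [cod_hc (by rw [α.dom, W.dom_two, e]), α.cod, W.cod_two]
        dom_tag := fun h => (hn h).elim
        cod_tag := fun h => (hn h).elim
        map_tag := fun h => (hn h).elim }
    map_id := fun m => hom_ext (hc_two (e m)) (fun h => (hn h).elim)
    map_comp := fun {m n p} α β => hom_ext (vc_hc_two (by rw [β.dom, α.cod])
      (by rw [α.dom, e])) (fun h => (hn h).elim) }

/-- The action of a 2-cell of `A'` on tagged 1-cells. -/
noncomputable def preMap (κ : A'.Two) (k l : A'.One) (hk : A'.dom κ = k) (hl : A'.cod κ = l)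
    (hx : i'.obj (A'.src k) = x) (hy : i'.obj (A'.tgt k) = y)
    (hx' : i'.obj (A'.src l) = x) (hy' : i'.obj (A'.tgt l) = y) :
    (pre (φ := φ) s' hF x y k hx hy ⟶ pre s' hF x y l hx' hy') :=
  have e : ∀ m : Tagged χ' v φ y, W.src m.w = W.tgt (F.map k) := fun m => by
    rw [m.src, F.tgt_map, hF, hy]
  have hn : ¬ χ'.obj x ≠ endpt 0 := fun h => h (by rw [← hx, s'.obj_eq])
  { app := fun m =>
      { w := W.hc (W.two m.w) (F.map₂ κ)
        tag := fun h => (hn h).elim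
        dom := by
          rw [dom_hc (by rw [F.dom_map₂, W.dom_two, hk, e]), F.dom_map₂, W.dom_two, hk]; rfl
        cod := by
          rw [cod_hc (by rw [F.dom_map₂, W.dom_two, hk, e]), F.cod_map₂, W.cod_two, hl]; rfl
        dom_tag := fun h => (hn h).elim
        cod_tag := fun h => (hn h).elim
        map_tag := fun h => (hn h).elim }
    naturality := fun {m n} α => hom_ext (by
      have e₁ : W.src m.w = W.tgt (F.map (A'.dom κ)) := by rw [hk, e]
      change W.vc (W.hc (W.two n.w) (F.map₂ κ)) (W.hc (Hom.w α) (W.two (F.map k))) =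
        W.vc (W.hc (Hom.w α) (W.two (F.map l))) (W.hc (W.two m.w) (F.map₂ κ))
      rw [← vc_hc_vc, ← vc_hc_vc, two_vc α.cod.symm, vc_two α.dom.symm, vc_two, two_vc]
      · rw [F.cod_map₂, hl]
      · rw [F.dom_map₂, hk]
      · rw [W.cod_two, α.dom]
      · rw [W.dom_two, F.cod_map₂, hl]
      · rw [W.dom_two, F.dom_map₂, e₁]
      · rw [W.dom_two, α.cod]
      · rw [W.cod_two, F.dom_map₂, hk]
      · rw [α.dom, W.dom_two, e]) (fun h => (hn h).elim) }

end Left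

section Right

variable {φ : HomMap i (u ≫ F) (fun x => o (v.obj x)) c z}
  (P : SievePushout u i i' v χ χ') (x y : B'.Obj)

-- The source of the tag is known in `B'` only. Injectivity of `v` outside `A` lifts the equality to
-- `B`, where the tag can then be composed with `f`.
include P in
theorem src_tag_eq {f : B.One} (h : χ.obj (B.tgt f) ≠ endpt 0) (hy : v.obj (B.tgt f) = y)
    (m : Tagged χ' v φ y) (hn) : B.src (m.tag hn) = B.tgt f :=
  (P.inj₀ h (by rw [m.src_tag, hy])).symm

/-- The action of a 1-cell of `B` on tagged 1-cells. -/
noncomputable def act (f : B.One) (h : χ.obj (B.tgt f) ≠ endpt 0) (hx : v.obj (B.src f) = x)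
    (hy : v.obj (B.tgt f) = y) : Tagged χ' v φ y ⥤ Tagged χ' v φ x :=
  have hn : χ'.obj y ≠ endpt 0 := by rwa [← hy, P.chi_obj]
  have e : ∀ m : Tagged χ' v φ y, B.src (m.tag hn) = B.tgt f := fun m => src_tag_eq P y h hy m hn
  { obj := fun m =>
      -- The object `y` is outside `A'`, so `m` has a tag. The tag is what gets composed with `f`,
      -- and `φ` sends the result back to `W`.
      { w := φ.f₁ (B.cmp (m.tag hn) f)
        tag := fun _ => B.cmp (m.tag hn) f
        src := by rw [φ.src _ (by rw [tgt_cmp, m.tgt_tag]), src_cmp (e m), hx]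
        tgt := by rw [φ.tgt _ (by rw [tgt_cmp, m.tgt_tag])]
        src_tag := fun _ => by rw [src_cmp (e m), hx]
        tgt_tag := fun _ => by rw [tgt_cmp, m.tgt_tag]
        map_tag := fun _ => rfl }
    map := fun {m n} α =>
      have d : B.src (B.dom (Hom.tag α hn)) = B.tgt (B.dom (B.two f)) := by
        rw [α.dom_tag, B.dom_two, e]
      { w := φ.f₂ (B.hc (Hom.tag α hn) (B.two f))
        tag := fun _ => B.hc (Hom.tag α hn) (B.two f)
        dom := by
          rw [φ.dom _ (by rw [tgt_dom_hc, α.dom_tag, m.tgt_tag]), dom_hc d, α.dom_tag, B.dom_two]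
        cod := by
          rw [φ.cod _ (by rw [tgt_dom_hc, α.dom_tag, m.tgt_tag]), cod_hc d, α.cod_tag, B.cod_two]
        dom_tag := fun _ => by rw [dom_hc d, α.dom_tag, B.dom_two]
        cod_tag := fun _ => by rw [cod_hc d, α.cod_tag, B.cod_two]
        map_tag := fun _ => rfl }
    map_id := fun m => by
      refine hom_ext ?_ (fun _ => hc_two (e m))
      exact (congrArg φ.f₂ (hc_two (e m))).trans (φ.two _ (by rw [tgt_cmp, m.tgt_tag]))
    map_comp := fun {m n p} α β => by
      have k : B.hc (B.vc (Hom.tag β hn) (Hom.tag α hn)) (B.two f) =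
          B.vc (B.hc (Hom.tag β hn) (B.two f)) (B.hc (Hom.tag α hn) (B.two f)) :=
        vc_hc_two (by rw [β.dom_tag, α.cod_tag]) (by rw [α.dom_tag, e])
      refine hom_ext ((congrArg φ.f₂ k).trans (φ.vc _ _ ?_ ?_)) (fun _ => k)
      · rw [tgt_dom_hc, β.dom_tag, n.tgt_tag]
      · rw [dom_hc, cod_hc, β.dom_tag, α.cod_tag, B.dom_two, B.cod_two]
        · rw [α.dom_tag, B.dom_two, e]
        · rw [β.dom_tag, B.dom_two, e] }

/-- The action of a 2-cell of `B` on tagged 1-cells. -/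
noncomputable def actMap (α : B.Two) (f g : B.One) (hf : B.dom α = f) (hg : B.cod α = g)
    (h : χ.obj (B.tgt f) ≠ endpt 0) (hx : v.obj (B.src f) = x) (hy : v.obj (B.tgt f) = y)
    (h' : χ.obj (B.tgt g) ≠ endpt 0) (hx' : v.obj (B.src g) = x) (hy' : v.obj (B.tgt g) = y) :
    (act (φ := φ) P x y f h hx hy ⟶ act P x y g h' hx' hy') :=
  have hn : χ'.obj y ≠ endpt 0 := by rwa [← hy, P.chi_obj]
  have e : ∀ m : Tagged χ' v φ y, B.src (m.tag hn) = B.tgt f := fun m => src_tag_eq P y h hy m hn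
  { app := fun m =>
      have d : B.src (B.dom (B.two (m.tag hn))) = B.tgt (B.dom α) := by rw [B.dom_two, hf, e]
      { w := φ.f₂ (B.hc (B.two (m.tag hn)) α)
        tag := fun _ => B.hc (B.two (m.tag hn)) α
        dom := by
          rw [φ.dom _ (by rw [tgt_dom_hc, B.dom_two, m.tgt_tag]), dom_hc d, B.dom_two, hf]
          rfl
        cod := by
          rw [φ.cod _ (by rw [tgt_dom_hc, B.dom_two, m.tgt_tag]), cod_hc d, B.cod_two, hg]
          rfl
        dom_tag := fun _ => by rw [dom_hc d, B.dom_two, hf]; rfl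
        cod_tag := fun _ => by rw [cod_hc d, B.cod_two, hg]; rfl
        map_tag := fun _ => rfl }
    naturality := fun {m n} β => by
      have k : B.vc (B.hc (B.two (n.tag hn)) α) (B.hc (Hom.tag β hn) (B.two f)) =
          B.vc (B.hc (Hom.tag β hn) (B.two g)) (B.hc (B.two (m.tag hn)) α) := by
        rw [← vc_hc_vc, ← vc_hc_vc, two_vc (β.cod_tag _).symm, vc_two (β.dom_tag _).symm,
          vc_two hf.symm, two_vc hg.symm]
        · rw [B.cod_two, β.dom_tag]
        · rw [B.dom_two, hg]
        · rw [B.dom_two, hf, e]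
        · rw [B.dom_two, β.cod_tag]
        · rw [B.cod_two, hf]
        · rw [β.dom_tag, B.dom_two, e]
      refine hom_ext ?_ (fun _ => k)
      refine ((φ.vc _ _ ?_ ?_).symm.trans (congrArg φ.f₂ k)).trans (φ.vc _ _ ?_ ?_)
      · rw [tgt_dom_hc, B.dom_two, n.tgt_tag]
      · rw [dom_hc, cod_hc, B.dom_two, β.cod_tag, B.cod_two, hf]
        · rw [β.dom_tag, B.dom_two, e]
        · rw [B.dom_two, hf, e]
      · rw [tgt_dom_hc, β.dom_tag, m.tgt_tag]
      · rw [dom_hc, cod_hc, β.dom_tag, B.dom_two, B.cod_two, hg]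
        · rw [B.dom_two, hf, e]
        · rw [β.dom_tag, B.dom_two, e, ← hg, B.tgt_cod, hf] }

end Right

end Tagged

end HomMap

end TwoCat

/-! ### The actions of `A'` and `B` as 2-functors -/

namespace TwoCat

theorem hc_eq_vc {C : TwoCat.{w}} {β α : C.Two} (h : C.src (C.dom β) = C.tgt (C.dom α)) :
    C.hc β α = C.vc (C.hc β (C.two (C.cod α))) (C.hc (C.two (C.dom β)) α) := by
  rw [← vc_hc_vc (C.cod_two _).symm (C.dom_two _) (by rw [C.dom_two, h]), vc_two rfl, two_vc rfl]

/-- This is the shape of the component at `m` of the horizontal composite `◫` of the actions of `β`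
and `α`: first `α`, then `β`. -/
theorem two_hc_hc {C : TwoCat.{w}} {m : C.One} {β α : C.Two} (hm : C.src m = C.tgt (C.dom β))
    (h : C.src (C.dom β) = C.tgt (C.dom α)) :
    C.hc (C.two m) (C.hc β α) = C.vc (C.hc (C.hc (C.two m) β) (C.two (C.cod α)))
      (C.hc (C.two (C.cmp m (C.dom β))) α) := by
  have hm' : C.src (C.dom (C.two m)) = C.tgt (C.dom β) := by rw [C.dom_two, hm]
  rw [← hc_assoc hm' h, hc_eq_vc (by rw [src_dom_hc hm', h]), dom_hc hm', C.dom_two]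

namespace HomMap

variable {A B A' B' W : TwoCat.{w}} {u : A ⟶ A'} {i : A ⟶ B} {i' : A' ⟶ B'} {v : B ⟶ B'}
  {χ : B ⟶ interval.{w}} {χ' : B' ⟶ interval.{w}} {F : A' ⟶ W} {o : B'.Obj → W.Obj}
  {c : B.Obj} {z : W.Obj} (φ : HomMap i (u ≫ F) (fun x => o (v.obj x)) c z)

namespace Tagged

/-- The 2-category of categories of tagged 1-cells. -/
noncomputable abbrev target (χ' : B' ⟶ interval.{w}) : TwoCat.{w} := ofFamily (Tagged χ' v φ)

section Left

variable (s' : IsSieveOf i' χ') (hF : ∀ a, F.obj a = o (i'.obj a))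

/-- The action of a 1-cell of `A'`, as a 1-cell. -/
noncomputable def pre₁ (k : A'.One) : (target φ χ').One :=
  ⟨_, _, pre s' hF _ _ k rfl rfl⟩

/-- The action of a 2-cell of `A'`, as a 2-cell. -/
noncomputable def pre₂ (κ : A'.Two) : (target φ χ').Two :=
  ⟨_, _, _, _, preMap s' hF _ _ κ _ _ rfl rfl rfl rfl (by rw [A'.src_cod]) (by rw [A'.tgt_cod])⟩

variable {φ}

/-- The endpoints become variables, equal to the actual ones only propositionally. This places the
actions of composable or parallel cells between the same categories. -/
theorem pre₁_eq {x y : B'.Obj} (k : A'.One) (hx : i'.obj (A'.src k) = x)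
    (hy : i'.obj (A'.tgt k) = y) : pre₁ φ s' hF k = ⟨x, y, pre s' hF x y k hx hy⟩ := by
  subst hx hy; rfl

theorem pre₂_eq {x y : B'.Obj} (κ : A'.Two) (k l : A'.One) (hk : A'.dom κ = k)
    (hl : A'.cod κ = l)
    (hx : i'.obj (A'.src k) = x) (hy : i'.obj (A'.tgt k) = y)
    (hx' : i'.obj (A'.src l) = x) (hy' : i'.obj (A'.tgt l) = y) :
    pre₂ φ s' hF κ = ⟨x, y, _, _, preMap s' hF x y κ k l hk hl hx hy hx' hy'⟩ := by
  subst hk hl hx hy; rfl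

variable (φ)

/-- The action of `A'` on tagged 1-cells. -/
noncomputable def preFunctor : A' ⟶ target φ χ' := by
  have tw : ∀ (a : A'.Obj), ¬ χ'.obj (i'.obj a) ≠ endpt 0 := fun a h => h (s'.obj_eq a)
  refine functorOfTotal (D := target φ χ') i'.obj (pre₁ φ s' hF) (pre₂ φ s' hF) (fun _ => rfl)
    (fun _ => rfl) (fun _ => rfl) (fun κ => ?_) (fun a => ?_) (fun g f h => ?_) (fun f => ?_)
    (fun β α h => ?_) (fun β α h => ?_)
  · exact (pre₁_eq s' hF _ (by rw [A'.src_cod]; rfl) (by rw [A'.tgt_cod]; rfl)).symm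
  · rw [pre₁_eq s' hF (x := i'.obj a) (y := i'.obj a) _ (by rw [A'.src_one]) (by rw [A'.tgt_one])]
    refine congrArg (FamilyOne.mk _ _) (functor_ext (fun m => ?_) (fun _ h => (tw _ h).elim)
      (fun {m n} α => ?_) (fun _ h => (tw _ h).elim))
    · change W.cmp m.w (F.map (A'.one a)) = m.w
      rw [F.map_one, cmp_one (by rw [m.src, hF])]
    · change W.hc (Hom.w α) (W.two (F.map (A'.one a))) = Hom.w α
      rw [F.map_one, hc_one (by rw [α.dom, m.src, hF])]
  · have hx : i'.obj (A'.src (A'.cmp g f)) = i'.obj (A'.src f) := by rw [src_cmp h]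
    have hy : i'.obj (A'.tgt (A'.cmp g f)) = i'.obj (A'.tgt g) := by rw [tgt_cmp]
    rw [pre₁_eq s' hF _ hx hy, pre₁_eq s' hF g (congrArg i'.obj h) rfl,
      pre₁_eq s' hF f rfl rfl, ofFamily_cmp]
    have h' : W.src (F.map g) = W.tgt (F.map f) := by rw [F.src_map, F.tgt_map, h]
    refine congrArg (FamilyOne.mk _ _) (functor_ext (fun m => ?_) (fun _ h => (tw _ h).elim)
      (fun {m n} α => ?_) (fun _ h => (tw _ h).elim))
    · change W.cmp m.w (F.map (A'.cmp g f)) = W.cmp (W.cmp m.w (F.map g)) (F.map f)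
      rw [F.map_cmp h, cmp_assoc (by rw [m.src, F.tgt_map, hF]) h']
    · change W.hc (Hom.w α) (W.two (F.map (A'.cmp g f))) =
        W.hc (W.hc (Hom.w α) (W.two (F.map g))) (W.two (F.map f))
      rw [F.map_cmp h, ← hc_two h', hc_assoc (by rw [α.dom, m.src, W.dom_two, F.tgt_map, hF])
        (by rw [W.dom_two, W.dom_two, h'])]
  · rw [pre₂_eq s' hF (x := i'.obj (A'.src f)) (y := i'.obj (A'.tgt f)) _ f f (A'.dom_two _)
      (A'.cod_two _) rfl rfl rfl rfl]
    refine congrArg (FamilyTwo.mk _ _ _ _) (NatTrans.ext (funext fun m =>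
      hom_ext ?_ (fun h => (tw _ h).elim)))
    change W.hc (W.two m.w) (F.map₂ (A'.two f)) = W.two (W.cmp m.w (F.map f))
    rw [F.map₂_two, hc_two (by rw [m.src, F.tgt_map, hF])]
  · have c₁ : A'.src (A'.dom β) = A'.src (A'.dom α) := by rw [h, A'.src_cod]
    have c₂ : A'.tgt (A'.dom β) = A'.tgt (A'.dom α) := by rw [h, A'.tgt_cod]
    rw [pre₂_eq s' hF (x := i'.obj (A'.src (A'.dom α))) (y := i'.obj (A'.tgt (A'.dom α)))
      (A'.vc β α) (A'.dom α) (A'.cod β) (dom_vc h) cod_vc rfl rfl (by rw [A'.src_cod, c₁])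
      (by rw [A'.tgt_cod, c₂]),
      pre₂_eq s' hF (x := i'.obj (A'.src (A'.dom α))) (y := i'.obj (A'.tgt (A'.dom α)))
      β (A'.cod α) (A'.cod β) h rfl (by rw [A'.src_cod]) (by rw [A'.tgt_cod])
      (by rw [A'.src_cod, c₁]) (by rw [A'.tgt_cod, c₂]),
      pre₂_eq s' hF (x := i'.obj (A'.src (A'.dom α))) (y := i'.obj (A'.tgt (A'.dom α)))
      α (A'.dom α) (A'.cod α) rfl rfl rfl rfl (by rw [A'.src_cod]) (by rw [A'.tgt_cod]),
      ofFamily_vc]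
    refine congrArg (FamilyTwo.mk _ _ _ _) (NatTrans.ext (funext fun m =>
      hom_ext ?_ (fun h => (tw _ h).elim)))
    change W.hc (W.two m.w) (F.map₂ (A'.vc β α)) =
      W.vc (W.hc (W.two m.w) (F.map₂ β)) (W.hc (W.two m.w) (F.map₂ α))
    rw [F.map₂_vc h, two_hc_vc (by rw [F.dom_map₂, F.cod_map₂, h])
      (by rw [m.src, F.dom_map₂, F.tgt_map, hF])]
  · have h₂ : A'.src (A'.cod β) = A'.tgt (A'.cod α) := by rw [A'.src_cod, A'.tgt_cod, h]
    rw [pre₂_eq s' hF (x := i'.obj (A'.src (A'.dom α))) (y := i'.obj (A'.tgt (A'.dom β)))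
      (A'.hc β α) (A'.cmp (A'.dom β) (A'.dom α)) (A'.cmp (A'.cod β) (A'.cod α)) (dom_hc h)
      (cod_hc h) (by rw [src_cmp h]) (by rw [tgt_cmp]) (by rw [src_cmp h₂, A'.src_cod])
      (by rw [tgt_cmp, A'.tgt_cod]),
      pre₂_eq s' hF (x := i'.obj (A'.tgt (A'.dom α))) (y := i'.obj (A'.tgt (A'.dom β)))
      β _ _ rfl rfl (by rw [h]) rfl (by rw [A'.src_cod, h]) (by rw [A'.tgt_cod]),
      pre₂_eq s' hF (x := i'.obj (A'.src (A'.dom α))) (y := i'.obj (A'.tgt (A'.dom α)))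
      α _ _ rfl rfl rfl rfl (by rw [A'.src_cod]) (by rw [A'.tgt_cod]),
      ofFamily_hc]
    have key : ∀ f g, A'.src g = A'.tgt f → ∀ m : W.One, W.src m = W.tgt (F.map g) →
        W.cmp m (F.map (A'.cmp g f)) = W.cmp (W.cmp m (F.map g)) (F.map f) := fun f g hgf m hm => by
      rw [F.map_cmp hgf, cmp_assoc hm (by rw [F.src_map, F.tgt_map, hgf])]
    have key₂ : ∀ f g, A'.src g = A'.tgt f → ∀ (m : W.Two), W.src (W.dom m) = W.tgt (F.map g) →
        W.hc m (W.two (F.map (A'.cmp g f))) = W.hc (W.hc m (W.two (F.map g))) (W.two (F.map f)) :=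
      fun f g hgf m hm => by
        have h' : W.src (F.map g) = W.tgt (F.map f) := by rw [F.src_map, F.tgt_map, hgf]
        rw [F.map_cmp hgf, ← hc_two h', hc_assoc (by rw [W.dom_two, hm])
          (by rw [W.dom_two, W.dom_two, h'])]
    have st : ∀ m : Tagged χ' v φ (i'.obj (A'.tgt (A'.dom β))),
        W.src m.w = W.tgt (F.map (A'.dom β)) := fun m => by rw [m.src, F.tgt_map, hF]
    have st' : ∀ m : Tagged χ' v φ (i'.obj (A'.tgt (A'.dom β))),
        W.src m.w = W.tgt (F.map (A'.cod β)) := fun m => by rw [m.src, F.tgt_map, hF, A'.tgt_cod]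
    have eF : ∀ m : Tagged χ' v φ (i'.obj (A'.tgt (A'.dom β))),
        W.hc (W.two m.w) (F.map₂ (A'.hc β α)) =
        W.vc (W.hc (W.hc (W.two m.w) (F.map₂ β)) (W.two (F.map (A'.cod α))))
          (W.hc (W.two (W.cmp m.w (F.map (A'.dom β)))) (F.map₂ α)) := fun m => by
      rw [F.map₂_hc h, two_hc_hc (by rw [F.dom_map₂, st])
        (by rw [F.dom_map₂, F.dom_map₂, F.src_map, F.tgt_map, h]), F.cod_map₂, F.dom_map₂]
    refine FamilyTwo.mk_congr ?_ ?_ (fun m => hom_heq ?_ ?_ ?_ (fun h => (tw _ h).elim))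
    · exact functor_ext (fun m => key _ _ h _ (st m)) (fun _ h => (tw _ h).elim)
        (fun {m n} η => key₂ _ _ h _ (by rw [η.dom, st])) (fun _ h => (tw _ h).elim)
    · exact functor_ext (fun m => key _ _ h₂ _ (st' m)) (fun _ h => (tw _ h).elim)
        (fun {m n} η => key₂ _ _ h₂ _ (by rw [η.dom, st'])) (fun _ h => (tw _ h).elim)
    · exact obj_ext (key _ _ h _ (st m)) (fun h => (tw _ h).elim)
    · exact obj_ext (key _ _ h₂ _ (st' m)) (fun h => (tw _ h).elim)
    · exact eF m

end Left

section Right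

variable (P : SievePushout u i i' v χ χ')

open Classical in
/-- The action of a 1-cell of `B` with target outside of `A`, as a 1-cell. -/
noncomputable def act₁ (f : B.One) : (target φ χ').One :=
  if h : χ.obj (B.tgt f) ≠ endpt 0 then ⟨_, _, act P _ _ f h rfl rfl⟩
  else ⟨v.obj (B.src f), _, 𝟭 _⟩

open Classical in
/-- The action of a 2-cell of `B` with target outside of `A`, as a 2-cell. -/
noncomputable def act₂ (α : B.Two) : (target φ χ').Two :=
  if h : χ.obj (B.tgt (B.dom α)) ≠ endpt 0 then
    ⟨_, _, _, _, actMap P _ _ α _ _ rfl rfl h rfl rfl (by rwa [B.tgt_cod]) (by rw [B.src_cod])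
      (by rw [B.tgt_cod])⟩
  else ⟨v.obj (B.src (B.dom α)), _, 𝟭 _, 𝟭 _, 𝟙 _⟩

variable {φ}

theorem act₁_eq {x y : B'.Obj} (f : B.One) (h : χ.obj (B.tgt f) ≠ endpt 0)
    (hx : v.obj (B.src f) = x) (hy : v.obj (B.tgt f) = y) :
    act₁ φ P f = ⟨x, y, act P x y f h hx hy⟩ := by
  subst hx hy; exact dif_pos h

theorem act₂_eq {x y : B'.Obj} (α : B.Two) (f g : B.One) (hf : B.dom α = f) (hg : B.cod α = g)
    (h : χ.obj (B.tgt f) ≠ endpt 0) (hx : v.obj (B.src f) = x) (hy : v.obj (B.tgt f) = y)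
    (h' : χ.obj (B.tgt g) ≠ endpt 0) (hx' : v.obj (B.src g) = x) (hy' : v.obj (B.tgt g) = y) :
    act₂ φ P α = ⟨x, y, _, _, actMap P x y α f g hf hg h hx hy h' hx' hy'⟩ := by
  subst hf hg hx hy; exact dif_pos h

variable (φ)

include P in
theorem src_tag_eq' {y : B'.Obj} (m : Tagged χ' v φ y) (hn : χ'.obj y ≠ endpt 0) (f : B.One)
    (hy : v.obj (B.tgt f) = y) : B.src (m.tag hn) = B.tgt f :=
  (P.inj₀ (by rwa [← P.chi_obj, hy]) (by rw [m.src_tag, hy])).symm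

theorem act_cmp {x y t : B'.Obj} {g f : B.One} (hgf : B.src g = B.tgt f) (hg) (hy) (ht) (hf) (hx)
    (hy') (h) (hx') (ht') :
    act (φ := φ) P x t (B.cmp g f) h hx' ht' = act P y t g hg hy ht ⋙ act P x y f hf hx hy' := by
  have hn : χ'.obj t ≠ endpt 0 := by rwa [← ht, P.chi_obj]
  have e : ∀ (m : Tagged χ' v φ t),
      B.cmp (m.tag hn) (B.cmp g f) = B.cmp (B.cmp (m.tag hn) g) f :=
    fun m => (cmp_assoc (src_tag_eq' φ P m hn g ht) hgf).symm
  have e₂ : ∀ {m n : Tagged χ' v φ t} (η : m ⟶ n),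
      B.hc (Hom.tag η hn) (B.two (B.cmp g f)) =
        B.hc (B.hc (Hom.tag η hn) (B.two g)) (B.two f) := fun {m n} η => by
    rw [← hc_two hgf, hc_assoc (by rw [η.dom_tag, src_tag_eq' φ P m hn g ht, B.dom_two])
      (by rw [B.dom_two, B.dom_two, hgf])]
  exact functor_ext (fun m => congrArg φ.f₁ (e m))
    (fun m _ => e m) (fun {m n} η => congrArg φ.f₂ (e₂ η)) (fun {m n} η _ => e₂ η)

/-- Linearity of `φ` enters here: after reassociation in `B`, `φ.act₁` and `φ.act₂` turn
precomposition of the tag by a cell of `A` into precomposition in `W`. This is what makes the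
actions of `B` and `A'` compatible. -/
theorem act_cmp_map (hF : ∀ a, F.obj a = o (i'.obj a)) {x y t : B'.Obj} {g : B.One} {k : A.One}
    (hgk : B.src g = B.tgt (i.map k)) (hg) (hy) (ht) (hx) (hy') (h) (hx') (ht') :
    act (φ := φ) P x t (B.cmp g (i.map k)) h hx' ht' =
      act P y t g hg hy ht ⋙ pre P.sieve' hF x y (u.map k) hx hy' := by
  have hn : χ'.obj t ≠ endpt 0 := by rwa [← ht, P.chi_obj]
  have tw : ¬ χ'.obj x ≠ endpt 0 := fun h => h (by rw [← hx]; exact P.sieve'.obj_eq _)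
  refine functor_ext (fun m => ?_) (fun _ h => (tw h).elim)
    (fun {m n} η => ?_) (fun _ h => (tw h).elim)
  · have hm := src_tag_eq' φ P m hn g ht
    refine (congrArg φ.f₁ (cmp_assoc hm hgk).symm).trans (φ.act₁ _ _ ?_ ?_)
    · rw [tgt_cmp, m.tgt_tag]
    · rw [src_cmp hm, hgk]
  · have hm := src_tag_eq' φ P m hn g ht
    have hm' : B.src (B.dom (Hom.tag η hn)) = B.tgt (B.dom (B.two g)) := by
      rw [η.dom_tag, B.dom_two, hm]
    have hk : B.src (B.dom (B.two g)) = B.tgt (B.dom (B.two (i.map k))) := by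
      rw [B.dom_two, B.dom_two, hgk]
    have := φ.act₂ (B.hc (Hom.tag η hn) (B.two g)) (A.two k)
      (by rw [tgt_dom_hc, η.dom_tag, m.tgt_tag])
      (by rw [src_dom_hc hm', hk, i.map₂_two])
    rw [i.map₂_two, hc_assoc hm' hk, hc_two hgk, (u ≫ F).map₂_two] at this
    exact this

/-- On `A` the action is imposed by that of `A'`; elsewhere `B` acts on tags. The conditions of
`extend` then split into associativity in `B` (`act_cmp`) and the mixed case, which is linearity
(`act_cmp_map`). -/
theorem exists_functor (hF : ∀ a, F.obj a = o (i'.obj a)) :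
    ∃ G : B ⟶ target φ χ', i ≫ G = u ≫ preFunctor φ P.sieve' hF ∧
      (∀ x, G.obj x = v.obj x) ∧ (∀ f, χ.obj (B.tgt f) ≠ endpt 0 → G.map f = act₁ φ P f) ∧
      (∀ α, χ.obj (B.tgt (B.dom α)) ≠ endpt 0 → G.map₂ α = act₂ φ P α) := by
  refine P.sieve.extend (T := target φ χ') (u ≫ preFunctor φ P.sieve' hF) v.obj
    (act₁ φ P) (act₂ φ P) P.comm₀
    (fun f h => by rw [act₁_eq P f h rfl rfl]) (fun f h => by rw [act₁_eq P f h rfl rfl])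
    (fun α h => ?_) (fun α h => ?_) (fun x h => ?_) (fun g f hg hf hgf => ?_)
    (fun g k hg hgk => ?_) (fun f h => ?_) (fun β α h hβα => ?_) (fun β α hβ hα h => ?_)
    (fun β κ hβ h => ?_)
  · have h' : χ.obj (B.tgt (B.cod α)) ≠ endpt 0 := by rwa [B.tgt_cod]
    rw [act₂_eq P α _ _ rfl rfl h rfl rfl h' (by rw [B.src_cod]) (by rw [B.tgt_cod]),
      act₁_eq P _ h rfl rfl]
  · have h' : χ.obj (B.tgt (B.cod α)) ≠ endpt 0 := by rwa [B.tgt_cod]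
    rw [act₂_eq P α _ _ rfl rfl h rfl rfl h' (by rw [B.src_cod]) (by rw [B.tgt_cod]),
      act₁_eq P _ h' (by rw [B.src_cod]) (by rw [B.tgt_cod])]
  · rw [act₁_eq P (x := v.obj x) (y := v.obj x) _ (by rwa [B.tgt_one]) (by rw [B.src_one])
      (by rw [B.tgt_one])]
    have e : ∀ (m : Tagged χ' v φ (v.obj x)) hn, B.cmp (m.tag hn) (B.one x) = m.tag hn :=
      fun m hn => cmp_one (by rw [src_tag_eq' φ P m hn (B.one x) (by rw [B.tgt_one]), B.tgt_one])
    have e₂ : ∀ {m n : Tagged χ' v φ (v.obj x)} (η : m ⟶ n) hn,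
        B.hc (Hom.tag η hn) (B.two (B.one x)) = Hom.tag η hn :=
      fun {m n} η hn => hc_one (by
        rw [η.dom_tag, src_tag_eq' φ P m hn (B.one x) (by rw [B.tgt_one]), B.tgt_one])
    have hn : χ'.obj (v.obj x) ≠ endpt 0 := by rwa [P.chi_obj]
    -- An identity replaces the underlying cell `w` by the image under `φ` of its tag, which is `w`
    -- itself by `map_tag`.
    exact congrArg (FamilyOne.mk _ _) (functor_ext
      (fun m => (congrArg φ.f₁ (e m hn)).trans (m.map_tag hn)) e
      (fun {m n} η => (congrArg φ.f₂ (e₂ η hn)).trans (η.map_tag hn)) e₂)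
  · have hn : χ'.obj (v.obj (B.tgt g)) ≠ endpt 0 := by rwa [P.chi_obj]
    rw [act₁_eq P (x := v.obj (B.src f)) (y := v.obj (B.tgt g)) (B.cmp g f) (by rwa [tgt_cmp])
      (by rw [src_cmp hgf]) (by rw [tgt_cmp]), act₁_eq P g hg (congrArg v.obj hgf) rfl,
      act₁_eq P f hf rfl rfl, ofFamily_cmp]
    exact congrArg (FamilyOne.mk _ _) (act_cmp φ P hgf ..)
  · have hn : χ'.obj (v.obj (B.tgt g)) ≠ endpt 0 := by rwa [P.chi_obj]
    have hsk : v.obj (B.src (i.map k)) = i'.obj (A'.src (u.map k)) := by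
      rw [i.src_map, P.comm₀, u.src_map]
    have htk : v.obj (B.src g) = i'.obj (A'.tgt (u.map k)) := by
      rw [hgk, i.tgt_map, P.comm₀, u.tgt_map]
    have tw : ¬ χ'.obj (i'.obj (A'.src (u.map k))) ≠ endpt 0 := fun h => h (P.sieve'.obj_eq _)
    rw [act₁_eq P (y := v.obj (B.tgt g)) (B.cmp g (i.map k)) (by rwa [tgt_cmp])
      (by rw [src_cmp hgk, hsk]) (by rw [tgt_cmp]), act₁_eq P g hg htk rfl]
    refine Eq.trans ?_ (ofFamily_cmp _ _).symm
    exact congrArg (FamilyOne.mk _ _) (act_cmp_map φ P hF hgk ..)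
  · rw [act₁_eq P f h rfl rfl,
      act₂_eq P (x := v.obj (B.src f)) (y := v.obj (B.tgt f)) _ f f (B.dom_two _) (B.cod_two _) h
        rfl rfl h rfl rfl]
    have hn : χ'.obj (v.obj (B.tgt f)) ≠ endpt 0 := by rwa [P.chi_obj]
    have e : ∀ (m : Tagged χ' v φ (v.obj (B.tgt f))),
        B.hc (B.two (m.tag hn)) (B.two f) = B.two (B.cmp (m.tag hn) f) :=
      fun m => hc_two (src_tag_eq' φ P m hn f rfl)
    refine congrArg (FamilyTwo.mk _ _ _ _) (NatTrans.ext (funext fun m =>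
      hom_ext ?_ (fun _ => e m)))
    exact (congrArg φ.f₂ (e m)).trans (φ.two _ (by rw [tgt_cmp, m.tgt_tag]))
  · have hn : χ'.obj (v.obj (B.tgt (B.dom α))) ≠ endpt 0 := by
      rwa [P.chi_obj, ← B.tgt_cod, ← hβα]
    have c₁ : B.src (B.dom β) = B.src (B.dom α) := by rw [hβα, B.src_cod]
    have c₂ : B.tgt (B.dom β) = B.tgt (B.dom α) := by rw [hβα, B.tgt_cod]
    have h₁ : χ.obj (B.tgt (B.dom α)) ≠ endpt 0 := by rwa [← c₂]
    have h₂ : χ.obj (B.tgt (B.cod α)) ≠ endpt 0 := by rwa [B.tgt_cod]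
    have h₃ : χ.obj (B.tgt (B.cod β)) ≠ endpt 0 := by rwa [B.tgt_cod]
    rw [act₂_eq P (x := v.obj (B.src (B.dom α))) (y := v.obj (B.tgt (B.dom α)))
      (B.vc β α) (B.dom α) (B.cod β) (dom_vc hβα) cod_vc h₁ rfl rfl h₃ (by rw [B.src_cod, c₁])
      (by rw [B.tgt_cod, c₂]),
      act₂_eq P (x := v.obj (B.src (B.dom α))) (y := v.obj (B.tgt (B.dom α)))
      β (B.cod α) (B.cod β) hβα rfl h₂ (by rw [B.src_cod]) (by rw [B.tgt_cod])
      h₃ (by rw [B.src_cod, c₁]) (by rw [B.tgt_cod, c₂]),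
      act₂_eq P (x := v.obj (B.src (B.dom α))) (y := v.obj (B.tgt (B.dom α)))
      α (B.dom α) (B.cod α) rfl rfl h₁ rfl rfl h₂ (by rw [B.src_cod]) (by rw [B.tgt_cod]),
      ofFamily_vc]
    have e : ∀ (m : Tagged χ' v φ (v.obj (B.tgt (B.dom α)))),
        B.hc (B.two (m.tag hn)) (B.vc β α) =
          B.vc (B.hc (B.two (m.tag hn)) β) (B.hc (B.two (m.tag hn)) α) :=
      fun m => two_hc_vc hβα (src_tag_eq' φ P m hn _ rfl)
    refine congrArg (FamilyTwo.mk _ _ _ _) (NatTrans.ext (funext fun m =>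
      hom_ext ?_ (fun _ => e m)))
    have hm := src_tag_eq' φ P m hn _ rfl
    refine (congrArg φ.f₂ (e m)).trans (φ.vc _ _ ?_ ?_)
    · rw [tgt_dom_hc, B.dom_two, m.tgt_tag]
    · rw [dom_hc (by rw [B.dom_two, hm, c₂]), cod_hc (by rw [B.dom_two, hm]), B.dom_two, B.cod_two,
        hβα]
  · have hn : χ'.obj (v.obj (B.tgt (B.dom β))) ≠ endpt 0 := by rwa [P.chi_obj]
    have h₂ : B.src (B.cod β) = B.tgt (B.cod α) := by rw [B.src_cod, B.tgt_cod, h]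
    have hβ' : χ.obj (B.tgt (B.cod β)) ≠ endpt 0 := by rwa [B.tgt_cod]
    have hα' : χ.obj (B.tgt (B.cod α)) ≠ endpt 0 := by rwa [B.tgt_cod]
    rw [act₂_eq P (x := v.obj (B.src (B.dom α))) (y := v.obj (B.tgt (B.dom β)))
      (B.hc β α) (B.cmp (B.dom β) (B.dom α)) (B.cmp (B.cod β) (B.cod α)) (dom_hc h)
      (cod_hc h) (by rwa [tgt_cmp]) (by rw [src_cmp h]) (by rw [tgt_cmp]) (by rwa [tgt_cmp])
      (by rw [src_cmp h₂, B.src_cod]) (by rw [tgt_cmp, B.tgt_cod]),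
      act₂_eq P (x := v.obj (B.tgt (B.dom α))) (y := v.obj (B.tgt (B.dom β)))
      β _ _ rfl rfl hβ (by rw [h]) rfl hβ' (by rw [B.src_cod, h]) (by rw [B.tgt_cod]),
      act₂_eq P (x := v.obj (B.src (B.dom α))) (y := v.obj (B.tgt (B.dom α)))
      α _ _ rfl rfl hα rfl rfl hα' (by rw [B.src_cod]) (by rw [B.tgt_cod]),
      ofFamily_hc]
    have e : ∀ (m : Tagged χ' v φ (v.obj (B.tgt (B.dom β)))),
        B.hc (B.two (m.tag hn)) (B.hc β α) =
        B.vc (B.hc (B.hc (B.two (m.tag hn)) β) (B.two (B.cod α)))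
          (B.hc (B.two (B.cmp (m.tag hn) (B.dom β))) α) :=
      fun m => two_hc_hc (src_tag_eq' φ P m hn _ rfl) h
    have a₁ := act_cmp (x := v.obj (B.src (B.dom α))) (y := v.obj (B.tgt (B.dom α)))
      (t := v.obj (B.tgt (B.dom β))) φ P h hβ (by rw [h]) rfl hα rfl rfl (by rwa [tgt_cmp])
      (by rw [src_cmp h]) (by rw [tgt_cmp])
    have a₂ := act_cmp (x := v.obj (B.src (B.dom α))) (y := v.obj (B.tgt (B.dom α)))
      (t := v.obj (B.tgt (B.dom β))) φ P h₂ hβ' (by rw [B.src_cod, h]) (by rw [B.tgt_cod]) hα'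
      (by rw [B.src_cod]) (by rw [B.tgt_cod]) (by rwa [tgt_cmp])
      (by rw [src_cmp h₂, B.src_cod]) (by rw [tgt_cmp, B.tgt_cod])
    refine FamilyTwo.mk_congr a₁ a₂ (fun m => hom_heq (by rw [a₁]) (by rw [a₂]) ?_ (fun _ => e m))
    have hm : B.src (B.dom (B.two (m.tag hn))) = B.tgt (B.dom β) := by
      rw [B.dom_two, src_tag_eq' φ P m hn _ rfl]
    refine (congrArg φ.f₂ (e m)).trans (φ.vc _ _ ?_ ?_)
    · rw [tgt_dom_hc, tgt_dom_hc, B.dom_two, m.tgt_tag]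
    · rw [dom_hc (by rw [src_dom_hc hm, h, B.dom_two, B.tgt_cod]),
        cod_hc (by rw [B.dom_two, src_cmp (by rwa [B.dom_two] at hm), h]), dom_hc hm, B.dom_two,
        B.dom_two, B.cod_two]
  · have hn : χ'.obj (v.obj (B.tgt (B.dom β))) ≠ endpt 0 := by rwa [P.chi_obj]
    have h₂ : B.src (B.cod β) = B.tgt (B.cod (i.map₂ κ)) := by rw [B.src_cod, B.tgt_cod, h]
    have hβ' : χ.obj (B.tgt (B.cod β)) ≠ endpt 0 := by rwa [B.tgt_cod]
    have hs : v.obj (B.src (B.dom (i.map₂ κ))) = i'.obj (A'.src (A'.dom (u.map₂ κ))) := by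
      rw [i.dom_map₂, i.src_map, P.comm₀, u.dom_map₂, u.src_map]
    have ht : v.obj (B.tgt (B.dom (i.map₂ κ))) = i'.obj (A'.tgt (A'.dom (u.map₂ κ))) := by
      rw [i.dom_map₂, i.tgt_map, P.comm₀, u.dom_map₂, u.tgt_map]
    have tw : ¬ χ'.obj (i'.obj (A'.src (A'.dom (u.map₂ κ)))) ≠ endpt 0 :=
      fun h => h (P.sieve'.obj_eq _)
    have hd : B.src (B.dom β) = B.tgt (i.map (A.dom κ)) := by rw [h, i.dom_map₂]
    have hc : B.src (B.cod β) = B.tgt (i.map (A.cod κ)) := by rw [h₂, i.cod_map₂]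
    rw [act₂_eq P (x := i'.obj (A'.src (A'.dom (u.map₂ κ)))) (y := v.obj (B.tgt (B.dom β)))
      (B.hc β (i.map₂ κ)) (B.cmp (B.dom β) (i.map (A.dom κ)))
      (B.cmp (B.cod β) (i.map (A.cod κ))) (by rw [dom_hc h, i.dom_map₂])
      (by rw [cod_hc h, i.cod_map₂]) (by rwa [tgt_cmp])
      (by rw [src_cmp hd, ← i.dom_map₂, hs]) (by rw [tgt_cmp]) (by rwa [tgt_cmp])
      (by rw [src_cmp hc, ← i.cod_map₂, B.src_cod, hs]) (by rw [tgt_cmp, B.tgt_cod]),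
      act₂_eq P (x := i'.obj (A'.tgt (A'.dom (u.map₂ κ)))) (y := v.obj (B.tgt (B.dom β)))
      β _ _ rfl rfl hβ (by rw [h, ht]) rfl hβ' (by rw [B.src_cod, h, ht]) (by rw [B.tgt_cod])]
    refine Eq.trans ?_ (congrArg _ (pre₂_eq P.sieve' hF
      (x := i'.obj (A'.src (A'.dom (u.map₂ κ)))) (y := i'.obj (A'.tgt (A'.dom (u.map₂ κ))))
      (u.map₂ κ) (u.map (A.dom κ)) (u.map (A.cod κ)) (u.dom_map₂ κ) (u.cod_map₂ κ)
      (by rw [u.dom_map₂]) (by rw [u.dom_map₂]) (by rw [← u.cod_map₂, A'.src_cod])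
      (by rw [← u.cod_map₂, A'.tgt_cod]))).symm
    rw [ofFamily_hc]
    have a₁ := act_cmp_map (x := i'.obj (A'.src (A'.dom (u.map₂ κ))))
      (y := i'.obj (A'.tgt (A'.dom (u.map₂ κ))))
      (t := v.obj (B.tgt (B.dom β))) φ P hF hd hβ (by rw [h, ht]) rfl (by rw [u.dom_map₂])
      (by rw [u.dom_map₂]) (by rwa [tgt_cmp])
      (by rw [src_cmp hd, ← i.dom_map₂, hs]) (by rw [tgt_cmp])
    have a₂ := act_cmp_map (x := i'.obj (A'.src (A'.dom (u.map₂ κ))))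
      (y := i'.obj (A'.tgt (A'.dom (u.map₂ κ))))
      (t := v.obj (B.tgt (B.dom β))) φ P hF hc hβ' (by rw [B.src_cod, h, ht]) (by rw [B.tgt_cod])
      (by rw [← u.cod_map₂, A'.src_cod]) (by rw [← u.cod_map₂, A'.tgt_cod]) (by rwa [tgt_cmp])
      (by rw [src_cmp hc, ← i.cod_map₂, B.src_cod, hs]) (by rw [tgt_cmp, B.tgt_cod])
    refine FamilyTwo.mk_congr a₁ a₂ (fun m => hom_heq (by rw [a₁]) (by rw [a₂]) ?_
      (fun h => (tw h).elim))
    have hm : B.src (B.dom (B.two (m.tag hn))) = B.tgt (B.dom β) := by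
      rw [B.dom_two, src_tag_eq' φ P m hn _ rfl]
    have hw : B.tgt (B.dom (B.hc (B.two (m.tag hn)) β)) = c := by
      rw [tgt_dom_hc, B.dom_two, m.tgt_tag]
    -- Linearity turns the whiskering by `κ` into one in `W`. Splitting it with `hc_eq_vc` then
    -- gives the component of `◫`.
    have e := φ.act₂ (B.hc (B.two (m.tag hn)) β) κ hw (by rw [src_dom_hc hm, h])
    have hk : W.src (W.dom (φ.f₂ (B.hc (B.two (m.tag hn)) β))) =
        W.tgt (W.dom ((u ≫ F).map₂ κ)) := by
      rw [φ.dom _ hw, φ.src _ (by rw [hw]), src_dom_hc hm, h, (u ≫ F).dom_map₂, (u ≫ F).tgt_map,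
        i.dom_map₂, i.tgt_map, comp_obj, hF, P.comm₀]
    rw [hc_assoc hm h, hc_eq_vc hk, φ.dom _ hw, dom_hc hm, B.dom_two, (u ≫ F).cod_map₂] at e
    exact e

end Right

end Tagged

end HomMap

end TwoCat

/-! ### Extension of maps of right modules by evaluation at the tagged unit -/

namespace TwoCat

namespace HomMap

variable {A B A' B' W : TwoCat.{w}} {u : A ⟶ A'} {i : A ⟶ B} {i' : A' ⟶ B'} {v : B ⟶ B'}
  {χ : B ⟶ interval.{w}} {χ' : B' ⟶ interval.{w}} {F : A' ⟶ W} {o : B'.Obj → W.Obj}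
  {c : B.Obj} {z : W.Obj} (φ : HomMap i (u ≫ F) (fun x => o (v.obj x)) c z)

namespace Tagged

variable (χ')

/-- The tagged 1-cell attached to the identity of `c`. -/
noncomputable def unit (y : B'.Obj) (h : v.obj c = y) : Tagged χ' v φ y where
  -- Not an identity in general: for the homotopy over `0 → 1`, it is the image under `v` of the
  -- component of `H` at `c`.
  w := φ.f₁ (B.one c)
  tag _ := B.one c
  src := by rw [φ.src _ (B.tgt_one c), B.src_one, h]
  tgt := φ.tgt _ (B.tgt_one c)
  src_tag _ := by rw [B.src_one, h]
  tgt_tag _ := B.tgt_one c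
  map_tag _ := rfl

open Classical in
/-- The value of a functor of tagged 1-cells at `unit`. -/
noncomputable def ev₁ (q : (target φ χ').One) : W.One :=
  -- The default value plays no role: only 1-cells with target `v(c)` are evaluated.
  if h : v.obj c = q.tgt then (q.fn.obj (unit χ' φ q.tgt h)).w else W.one z

open Classical in
/-- The value of a natural transformation of tagged 1-cells at `unit`. -/
noncomputable def ev₂ (q : (target φ χ').Two) : W.Two :=
  if h : v.obj c = q.tgt then Hom.w (q.nat.app (unit χ' φ q.tgt h)) else W.two (W.one z)

variable {χ'}

theorem ev₁_eq {x y : B'.Obj} (q : Tagged χ' v φ y ⥤ Tagged χ' v φ x) (h : v.obj c = y) :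
    ev₁ χ' φ ⟨x, y, q⟩ = (q.obj (unit χ' φ y h)).w := dif_pos h

theorem ev₂_eq {x y : B'.Obj} {q r : Tagged χ' v φ y ⥤ Tagged χ' v φ x} (η : q ⟶ r)
    (h : v.obj c = y) :
    ev₂ χ' φ ⟨x, y, q, r, η⟩ = Hom.w (η.app (unit χ' φ y h)) := dif_pos h

theorem src_ev₁ (q : (target φ χ').One) (h : v.obj c = q.tgt) : W.src (ev₁ χ' φ q) = o q.src := by
  obtain ⟨x, y, q⟩ := q
  rw [ev₁_eq φ q h, Tagged.src]

theorem tgt_ev₁ (q : (target φ χ').One) (h : v.obj c = q.tgt) : W.tgt (ev₁ χ' φ q) = z := by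
  obtain ⟨x, y, q⟩ := q
  rw [ev₁_eq φ q h, Tagged.tgt]

theorem dom_ev₂ (q : (target φ χ').Two) (h : v.obj c = q.tgt) :
    W.dom (ev₂ χ' φ q) = ev₁ χ' φ ((target φ χ').dom q) := by
  obtain ⟨x, y, q, r, η⟩ := q
  rw [ev₂_eq φ η h, ev₁_eq φ q h, Hom.dom]

theorem cod_ev₂ (q : (target φ χ').Two) (h : v.obj c = q.tgt) :
    W.cod (ev₂ χ' φ q) = ev₁ χ' φ ((target φ χ').cod q) := by
  obtain ⟨x, y, q, r, η⟩ := q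
  rw [ev₂_eq φ η h, ev₁_eq φ r h, Hom.cod]

theorem ev₂_two (q : (target φ χ').One) (h : v.obj c = q.tgt) :
    ev₂ χ' φ ((target φ χ').two q) = W.two (ev₁ χ' φ q) := by
  obtain ⟨x, y, q⟩ := q
  rw [ev₁_eq φ q h]
  exact ev₂_eq φ (𝟙 q) h

theorem ev₂_vc (q p : (target φ χ').Two) (h : v.obj c = q.tgt)
    (e : (target φ χ').dom q = (target φ χ').cod p) :
    ev₂ χ' φ ((target φ χ').vc q p) = W.vc (ev₂ χ' φ q) (ev₂ χ' φ p) := by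
  obtain ⟨x, y, q, r, η⟩ := q
  obtain ⟨x', y', q', r', η'⟩ := p
  cases e
  rw [ofFamily_vc, ev₂_eq φ η h, ev₂_eq φ η' h, ev₂_eq φ _ h]
  rfl

theorem ev₁_cmp (s' : IsSieveOf i' χ') (hF : ∀ a, F.obj a = o (i'.obj a)) (q : (target φ χ').One)
    (k : A'.One) (h : v.obj c = q.tgt) (e : q.src = i'.obj (A'.tgt k)) :
    ev₁ χ' φ ((target φ χ').cmp q (pre₁ φ s' hF k)) = W.cmp (ev₁ χ' φ q) (F.map k) := by
  obtain ⟨x, y, q⟩ := q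
  change x = _ at e
  subst e
  rw [pre₁, ofFamily_cmp, ev₁_eq φ _ h, ev₁_eq φ _ h]
  rfl

theorem ev₂_hc (s' : IsSieveOf i' χ') (hF : ∀ a, F.obj a = o (i'.obj a)) (q : (target φ χ').Two)
    (k : A'.Two) (h : v.obj c = q.tgt) (e : q.src = i'.obj (A'.tgt (A'.dom k))) :
    ev₂ χ' φ ((target φ χ').hc q (pre₂ φ s' hF k)) = W.hc (ev₂ χ' φ q) (F.map₂ k) := by
  obtain ⟨x, y, q, r, η⟩ := q
  change x = _ at e
  subst e
  have hs : W.src (W.dom (Hom.w (η.app (unit χ' φ y h)))) = W.tgt (W.dom (F.map₂ k)) := by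
    rw [Hom.dom, Tagged.src, F.dom_map₂, F.tgt_map, hF]
  rw [pre₂, ofFamily_hc, ev₂_eq φ _ h, ev₂_eq φ _ h, hc_eq_vc hs, Hom.dom, F.cod_map₂]
  rfl

/-- Acting on the tag `1_c` by `f` gives the tag `1_c f = f`, whose underlying 1-cell is `φ(f)`. -/
theorem ev₁_act₁ (P : SievePushout u i i' v χ χ') (hc : χ.obj c ≠ endpt 0) (f : B.One)
    (h : B.tgt f = c) : ev₁ χ' φ (act₁ φ P f) = φ.f₁ f := by
  subst h
  rw [act₁_eq P f hc rfl rfl, ev₁_eq φ _ rfl]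
  exact congrArg φ.f₁ (one_cmp rfl)

theorem ev₂_act₂ (P : SievePushout u i i' v χ χ') (hc : χ.obj c ≠ endpt 0) (f : B.Two)
    (h : B.tgt (B.dom f) = c) : ev₂ χ' φ (act₂ φ P f) = φ.f₂ f := by
  subst h
  rw [act₂_eq P f _ _ rfl rfl hc rfl rfl (by rwa [B.tgt_cod]) (by rw [B.src_cod])
    (by rw [B.tgt_cod]), ev₂_eq φ _ rfl]
  exact congrArg φ.f₂ (one_hc rfl)

end Tagged

open Tagged

/-- Extension of a map of right modules along a pushout of a sieve. -/
theorem exists_extend (P : SievePushout u i i' v χ χ') (hc : χ.obj c ≠ endpt 0)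
    (hF : ∀ a, F.obj a = o (i'.obj a)) :
    ∃ ψ : HomMap i' F o (v.obj c) z, (∀ f, B.tgt f = c → ψ.f₁ (v.map f) = φ.f₁ f) ∧
      ∀ α, B.tgt (B.dom α) = c → ψ.f₂ (v.map₂ α) = φ.f₂ α := by
  obtain ⟨G, hG, G₀, G₁, G₂⟩ := exists_functor φ P hF
  -- The actions of `A'` and `B` agree over `A`, so they glue to an action of `B'`, again the
  -- identity on objects.
  let L : B' ⟶ target φ χ' := P.sq.desc (preFunctor φ P.sieve' hF) G hG.symm
  have e₁ : i' ≫ L = preFunctor φ P.sieve' hF := P.sq.inl_desc _ _ _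
  have e₂ : v ≫ L = G := P.sq.inr_desc _ _ _
  have L₀ : ∀ x, L.obj x = x := fun x => by
    obtain ⟨a, rfl⟩ | ⟨b, -, rfl⟩ := P.obj_cases x
    · exact congr_functor_obj e₁ a
    · exact (congr_functor_obj e₂ b).trans (G₀ b)
  have L₁ : ∀ k, L.map (i'.map k) = pre₁ φ P.sieve' hF k := congr_functor_map e₁
  have L₂ : ∀ k, L.map₂ (i'.map₂ k) = pre₂ φ P.sieve' hF k := congr_functor_map₂ e₁
  have s₁ : ∀ f, (L.map f).src = B'.src f := fun f => (L.src_map f).trans (L₀ _)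
  have t₁ : ∀ f, (L.map f).tgt = B'.tgt f := fun f => (L.tgt_map f).trans (L₀ _)
  have s₂ : ∀ α, (L.map₂ α).src = B'.src (B'.dom α) := fun α =>
    (congrArg FamilyOne.src (L.dom_map₂ α)).trans (s₁ _)
  have t₂ : ∀ α, (L.map₂ α).tgt = B'.tgt (B'.dom α) := fun α =>
    (congrArg FamilyOne.tgt (L.dom_map₂ α)).trans (t₁ _)
  -- As in the Yoneda lemma, the value at a cell with target `v(c)` is the result of its action on
  -- the tagged unit.
  refine ⟨{ f₁ := fun f => ev₁ χ' φ (L.map f)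
            f₂ := fun α => ev₂ χ' φ (L.map₂ α)
            src := fun f h => ?_
            tgt := fun f h => ?_
            dom := fun α h => ?_
            cod := fun α h => ?_
            two := fun f h => ?_
            vc := fun β α h hβα => ?_
            act₁ := fun f k h hk => ?_
            act₂ := fun α k h hk => ?_ }, fun f h => ?_, fun α h => ?_⟩
  · rw [src_ev₁ φ _ (by rw [t₁, h]), s₁]
  · rw [tgt_ev₁ φ _ (by rw [t₁, h])]
  · rw [dom_ev₂ φ _ (by rw [t₂, h]), L.dom_map₂]
  · rw [cod_ev₂ φ _ (by rw [t₂, h]), L.cod_map₂]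
  · rw [L.map₂_two, ev₂_two φ _ (by rw [t₁, h])]
  · rw [L.map₂_vc hβα, ev₂_vc φ _ _ (by rw [t₂, h]) (by rw [L.dom_map₂, L.cod_map₂, hβα])]
  · rw [L.map_cmp hk, L₁, ev₁_cmp φ _ _ _ _ (by rw [t₁, h]) (by rw [s₁, hk, i'.tgt_map])]
  · rw [L.map₂_hc hk, L₂, ev₂_hc φ _ _ _ _ (by rw [t₂, h])
      (by rw [s₂, hk, i'.dom_map₂, i'.tgt_map])]
  · have e : L.map (v.map f) = Tagged.act₁ φ P f := by
      rw [← G₁ f (by rwa [h]), ← e₂]; rfl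
    change ev₁ χ' φ (L.map (v.map f)) = _
    rw [e, ev₁_act₁ φ P hc f h]
  · have e : L.map₂ (v.map₂ α) = Tagged.act₂ φ P α := by
      rw [← G₂ α (by rwa [h]), ← e₂]; rfl
    change ev₂ χ' φ (L.map₂ (v.map₂ α)) = _
    rw [e, ev₂_act₂ φ P hc α h]

end HomMap

end TwoCat

/-! ### Oplax 2-functors on a cylinder -/

namespace TwoCat

section Oplax

variable {C D E X : TwoCat.{w}}

theorem oplaxFunctor_ext {F G : OplaxFunctor C D} (h₀ : ∀ x, F.obj x = G.obj x)
    (h₁ : ∀ f, F.map f = G.map f) (h₂ : ∀ α, F.map₂ α = G.map₂ α)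
    (h₃ : ∀ g f h, F.constr g f h = G.constr g f h) : F = G :=
  OplaxFunctor.ext (funext h₀) (funext h₁) (funext h₂)
    (funext fun g => funext fun f => funext fun h => h₃ g f h)

theorem constr_comp_oplax (G : OplaxFunctor D E) (F : C ⟶ D) (g f : C.One)
    (h : C.src g = C.tgt f) :
    (G.comp (oplax F)).constr g f h =
      G.constr (F.map g) (F.map f) (by rw [F.src_map, F.tgt_map, h]) := by
  refine (vcomp_eq _).trans ?_
  change E.vc _ (G.map₂ (D.two (F.map (C.comp g f h)))) = _
  rw [G.map₂_two]
  refine vc_two ?_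
  rw [G.dom_constr, F.map_comp]
  rfl

theorem constr_oplax_comp (G : D ⟶ E) (F : OplaxFunctor C D) (g f : C.One)
    (h : C.src g = C.tgt f) :
    ((oplax G).comp F).constr g f h = G.map₂ (F.constr g f h) := by
  refine (vcomp_eq _).trans (two_vc ?_)
  change G.map _ = E.cod (G.map₂ _)
  rw [G.cod_map₂, F.cod_constr]

end Oplax

/-- A normalised oplax 2-functor from `Δ₁ × C` to `D`, presented by total operations. -/
structure Cyl (C D : TwoCat.{w}) where
  obj : interval.{w}.Obj → C.Obj → D.Obj
  map : interval.{w}.One → C.One → D.One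
  -- All 2-cells of `Δ₁` are identities, hence the 1-cell as first argument.
  map₂ : interval.{w}.One → C.Two → D.Two
  con : interval.{w}.One → interval.{w}.One → C.One → C.One → D.Two
  src_map : ∀ ε f, D.src (map ε f) = obj (interval.src ε) (C.src f)
  tgt_map : ∀ ε f, D.tgt (map ε f) = obj (interval.tgt ε) (C.tgt f)
  dom_map₂ : ∀ ε α, D.dom (map₂ ε α) = map ε (C.dom α)
  cod_map₂ : ∀ ε α, D.cod (map₂ ε α) = map ε (C.cod α)
  dom_con : ∀ ε η g f, interval.src ε = interval.tgt η → C.src g = C.tgt f →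
    D.dom (con ε η g f) = map (interval.cmp ε η) (C.cmp g f)
  cod_con : ∀ ε η g f, interval.src ε = interval.tgt η → C.src g = C.tgt f →
    D.cod (con ε η g f) = D.cmp (map ε g) (map η f)
  map_one : ∀ j x, map (interval.one j) (C.one x) = D.one (obj j x)
  con_one_left : ∀ η f, con (interval.one (interval.tgt η)) η (C.one (C.tgt f)) f =
    D.two (map η f)
  con_one_right : ∀ ε g, con ε (interval.one (interval.src ε)) g (C.one (C.src g)) =
    D.two (map ε g)
  cocycle : ∀ δ ε η k g f, interval.src δ = interval.tgt ε → interval.src ε = interval.tgt η →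
    C.src k = C.tgt g → C.src g = C.tgt f →
    D.vc (D.hc (D.two (map δ k)) (con ε η g f)) (con δ (interval.cmp ε η) k (C.cmp g f)) =
      D.vc (D.hc (con δ ε k g) (D.two (map η f))) (con (interval.cmp δ ε) η (C.cmp k g) f)
  map₂_vc : ∀ ε β α, C.dom β = C.cod α → map₂ ε (C.vc β α) = D.vc (map₂ ε β) (map₂ ε α)
  map₂_two : ∀ ε f, map₂ ε (C.two f) = D.two (map ε f)
  naturality : ∀ ε η β α, interval.src ε = interval.tgt η → C.src (C.dom β) = C.tgt (C.dom α) →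
    D.vc (con ε η (C.cod β) (C.cod α)) (map₂ (interval.cmp ε η) (C.hc β α)) =
      D.vc (D.hc (map₂ ε β) (map₂ η α)) (con ε η (C.dom β) (C.dom α))

namespace Cyl

variable {A B C D E : TwoCat.{w}}

/-- The oplax 2-functor on the cylinder presented by `c`. -/
noncomputable def toOplax (c : Cyl C D) : OplaxFunctor (prod interval C) D where
  obj x := c.obj x.1 x.2
  map f := c.map f.1 f.2
  map₂ α := c.map₂ α.1 α.2
  constr g f _ := c.con g.1 f.1 g.2 f.2
  src_map f := c.src_map _ _
  tgt_map f := c.tgt_map _ _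
  dom_map₂ α := c.dom_map₂ _ _
  cod_map₂ α := c.cod_map₂ _ _
  dom_constr g f h := by
    obtain ⟨h₁, h₂⟩ := Prod.ext_iff.1 h
    refine (c.dom_con _ _ _ _ h₁ h₂).trans ?_
    rw [← comp_eq h₁, ← comp_eq h₂]
  cod_constr g f h := by
    obtain ⟨h₁, h₂⟩ := Prod.ext_iff.1 h
    refine (c.cod_con _ _ _ _ h₁ h₂).trans ?_
    rw [comp_eq]
  map_one x := c.map_one _ _
  constr_one_left f := c.con_one_left _ _
  constr_one_right f := c.con_one_right _ _
  cocycle k g f h h' := by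
    have h₁ : interval.src k.1 = interval.tgt g.1 := (Prod.ext_iff.1 h).1
    have h₂ : C.src k.2 = C.tgt g.2 := (Prod.ext_iff.1 h).2
    have h₁' : interval.src g.1 = interval.tgt f.1 := (Prod.ext_iff.1 h').1
    have h₂' : C.src g.2 = C.tgt f.2 := (Prod.ext_iff.1 h').2
    have e := c.cocycle _ _ _ _ _ _ h₁ h₁' h₂ h₂'
    rw [← comp_eq h₁, ← comp_eq h₂, ← comp_eq h₁', ← comp_eq h₂'] at e
    simp only [vcomp_eq, hcomp_eq]
    exact e
  map₂_vcomp := by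
    rintro ⟨ε, β⟩ ⟨ε', α⟩ h
    obtain ⟨h₁, h₂⟩ := Prod.ext_iff.1 h
    cases h₁
    have e := c.map₂_vc ε β α h₂
    rw [← vcomp_eq h₂] at e
    exact e.trans (vcomp_eq _).symm
  map₂_two f := c.map₂_two _ _
  map₂_hcomp β α h := by
    have h₁ : interval.src β.1 = interval.tgt α.1 := (Prod.ext_iff.1 h).1
    have h₂ : C.src (C.dom β.2) = C.tgt (C.dom α.2) := (Prod.ext_iff.1 h).2
    have e := c.naturality β.1 α.1 _ _ h₁ h₂
    rw [← comp_eq h₁, ← hcomp_eq h₂] at e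
    refine (vcomp_eq _).trans (Eq.trans e ?_)
    rw [vcomp_eq, hcomp_eq]
    rfl

section OfOplax

variable (F : OplaxFunctor (prod interval.{w} C) D)

open Classical in
/-- The constraint of an oplax 2-functor on the cylinder, extended to all pairs of 1-cells. -/
noncomputable def totalConstr (ε η : interval.{w}.One) (g f : C.One) : D.Two :=
  if h : (prod interval C).src (ε, g) = (prod interval C).tgt (η, f) then F.constr (ε, g) (η, f) h
  else D.two (F.map (ε, g))

variable {F} in
theorem totalConstr_eq {ε η : interval.{w}.One} {g f : C.One}
    (h₁ : interval.src ε = interval.tgt η) (h₂ : C.src g = C.tgt f) :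
    totalConstr F ε η g f = F.constr (ε, g) (η, f) (Prod.ext h₁ h₂) :=
  dif_pos (Prod.ext h₁ h₂)

/-- The presentation by total operations of an oplax 2-functor on the cylinder. -/
noncomputable def ofOplax : Cyl C D where
  obj j x := F.obj (j, x)
  map ε f := F.map (ε, f)
  map₂ ε α := F.map₂ (ε, α)
  con := totalConstr F
  src_map ε f := F.src_map _
  tgt_map ε f := F.tgt_map _
  dom_map₂ ε α := F.dom_map₂ _
  cod_map₂ ε α := F.cod_map₂ _
  dom_con ε η g f h₁ h₂ := by
    rw [totalConstr_eq h₁ h₂, F.dom_constr, ← comp_eq h₁, ← comp_eq h₂]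
  cod_con ε η g f h₁ h₂ := by rw [totalConstr_eq h₁ h₂, F.cod_constr, comp_eq]
  map_one j x := F.map_one (j, x)
  con_one_left η f := by
    rw [totalConstr_eq (interval.src_one _) (C.src_one _)]
    exact F.constr_one_left (η, f)
  con_one_right ε g := by
    rw [totalConstr_eq (interval.tgt_one _).symm (C.tgt_one _).symm]
    exact F.constr_one_right (ε, g)
  cocycle δ ε η k g f h₁ h₁' h₂ h₂' := by
    rw [totalConstr_eq h₁' h₂', totalConstr_eq h₁ h₂,
      totalConstr_eq (by rw [tgt_cmp, h₁]) (by rw [tgt_cmp, h₂]),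
      totalConstr_eq (by rw [src_cmp h₁, h₁']) (by rw [src_cmp h₂, h₂'])]
    have e := F.cocycle (δ, k) (ε, g) (η, f) (Prod.ext h₁ h₂) (Prod.ext h₁' h₂')
    simp only [vcomp_eq, hcomp_eq] at e
    simp only [← comp_eq h₁, ← comp_eq h₂, ← comp_eq h₁', ← comp_eq h₂']
    exact e
  map₂_vc ε β α h := by
    rw [← vcomp_eq h]
    exact (F.map₂_vcomp (ε, β) (ε, α) (Prod.ext rfl h)).trans (vcomp_eq _)
  map₂_two ε f := F.map₂_two (ε, f)
  naturality ε η β α h₁ h₂ := by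
    rw [totalConstr_eq h₁ (by rw [C.src_cod, C.tgt_cod, h₂]), totalConstr_eq h₁ h₂]
    have e := F.map₂_hcomp (ε, β) (η, α) (Prod.ext h₁ h₂)
    simp only [vcomp_eq, hcomp_eq] at e
    rw [← comp_eq h₁]
    exact e

end OfOplax

/-- Postcomposition with a strict 2-functor. -/
noncomputable def postcomp (c : Cyl C D) (F : D ⟶ E) : Cyl C E where
  obj j x := F.obj (c.obj j x)
  map ε f := F.map (c.map ε f)
  map₂ ε α := F.map₂ (c.map₂ ε α)
  con ε η g f := F.map₂ (c.con ε η g f)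
  src_map ε f := by rw [F.src_map, c.src_map]
  tgt_map ε f := by rw [F.tgt_map, c.tgt_map]
  dom_map₂ ε α := by rw [F.dom_map₂, c.dom_map₂]
  cod_map₂ ε α := by rw [F.cod_map₂, c.cod_map₂]
  dom_con ε η g f h₁ h₂ := by rw [F.dom_map₂, c.dom_con _ _ _ _ h₁ h₂]
  cod_con ε η g f h₁ h₂ := by
    rw [F.cod_map₂, c.cod_con _ _ _ _ h₁ h₂, F.map_cmp]
    rw [c.src_map, c.tgt_map, h₁, h₂]
  map_one j x := by rw [c.map_one, F.map_one]
  con_one_left η f := by rw [c.con_one_left, F.map₂_two]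
  con_one_right ε g := by rw [c.con_one_right, F.map₂_two]
  cocycle δ ε η k g f h₁ h₁' h₂ h₂' := by
    have a₁ : interval.src δ = interval.tgt (interval.cmp ε η) := by rw [tgt_cmp, h₁]
    have a₂ : C.src k = C.tgt (C.cmp g f) := by rw [tgt_cmp, h₂]
    have b₁ : interval.src (interval.cmp δ ε) = interval.tgt η := by rw [src_cmp h₁, h₁']
    have b₂ : C.src (C.cmp k g) = C.tgt f := by rw [src_cmp h₂, h₂']
    have x₁ : D.src (D.dom (D.two (c.map δ k))) = D.tgt (D.dom (c.con ε η g f)) := by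
      rw [D.dom_two, c.dom_con _ _ _ _ h₁' h₂', c.src_map, c.tgt_map, tgt_cmp, tgt_cmp, h₁, h₂]
    have x₂ : D.src (D.dom (c.con δ ε k g)) = D.tgt (D.dom (D.two (c.map η f))) := by
      rw [D.dom_two, c.dom_con _ _ _ _ h₁ h₂, c.src_map, c.tgt_map, b₁, b₂]
    have e := congrArg F.map₂ (c.cocycle δ ε η k g f h₁ h₁' h₂ h₂')
    rw [F.map₂_vc, F.map₂_hc x₁, F.map₂_vc, F.map₂_hc x₂, F.map₂_two, F.map₂_two] at e
    · exact e
    · rw [dom_hc x₂, D.dom_two, c.cod_con _ _ _ _ b₁ b₂, c.dom_con _ _ _ _ h₁ h₂]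
    · rw [dom_hc x₁, D.dom_two, c.cod_con _ _ _ _ a₁ a₂, c.dom_con _ _ _ _ h₁' h₂']
  map₂_vc ε β α h := by rw [c.map₂_vc _ _ _ h, F.map₂_vc (by rw [c.dom_map₂, c.cod_map₂, h])]
  map₂_two ε f := by rw [c.map₂_two, F.map₂_two]
  naturality ε η β α h₁ h₂ := by
    have h₂' : C.src (C.cod β) = C.tgt (C.cod α) := by rw [C.src_cod, C.tgt_cod, h₂]
    have x : D.src (D.dom (c.map₂ ε β)) = D.tgt (D.dom (c.map₂ η α)) := by
      rw [c.dom_map₂, c.dom_map₂, c.src_map, c.tgt_map, h₁, h₂]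
    have e := congrArg F.map₂ (c.naturality ε η β α h₁ h₂)
    rw [F.map₂_vc, F.map₂_vc, F.map₂_hc x] at e
    · exact e
    · rw [dom_hc x, c.cod_con _ _ _ _ h₁ h₂, c.dom_map₂, c.dom_map₂]
    · rw [c.dom_con _ _ _ _ h₁ h₂', c.cod_map₂, cod_hc h₂]

/-- The cylinder on a strict 2-functor that does not depend on the first variable. -/
noncomputable def ofStrict (F : C ⟶ D) : Cyl C D where
  obj _ x := F.obj x
  map _ f := F.map f
  map₂ _ α := F.map₂ α
  con _ _ g f := D.two (F.map (C.cmp g f))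
  src_map ε f := F.src_map f
  tgt_map ε f := F.tgt_map f
  dom_map₂ ε α := F.dom_map₂ α
  cod_map₂ ε α := F.cod_map₂ α
  dom_con ε η g f h₁ h₂ := D.dom_two _
  cod_con ε η g f h₁ h₂ := by rw [D.cod_two, F.map_cmp h₂]
  map_one j x := F.map_one x
  con_one_left η f := by rw [one_cmp rfl]
  con_one_right ε g := by rw [cmp_one rfl]
  cocycle δ ε η k g f h₁ h₁' h₂ h₂' := by
    have e : D.hc (D.two (F.map k)) (D.two (F.map (C.cmp g f))) =
        D.two (F.map (C.cmp k (C.cmp g f))) := by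
      rw [hc_two (by rw [F.src_map, F.tgt_map, tgt_cmp, h₂]),
        F.map_cmp (g := k) (by rw [tgt_cmp, h₂])]
    have e' : D.hc (D.two (F.map (C.cmp k g))) (D.two (F.map f)) =
        D.two (F.map (C.cmp (C.cmp k g) f)) := by
      rw [hc_two (by rw [F.src_map, F.tgt_map, src_cmp h₂, h₂']),
        F.map_cmp (f := f) (by rw [src_cmp h₂, h₂'])]
    rw [e, e', cmp_assoc h₂ h₂']
  map₂_vc ε β α h := F.map₂_vc h
  map₂_two ε f := F.map₂_two f
  naturality ε η β α h₁ h₂ := by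
    rw [← F.map₂_hc h₂, two_vc, vc_two]
    · rw [F.dom_map₂, dom_hc h₂]
    · rw [F.cod_map₂, cod_hc h₂]

/-- The cylinder with the first variable frozen to `j`. -/
noncomputable def freeze (c : Cyl C D) (j : interval.{w}.Obj) : Cyl C D :=
  have e : interval.cmp (interval.one j) (interval.one j) = interval.one j :=
    one_cmp (interval.tgt_one j).symm
  have e' : interval.src (interval.one j) = interval.tgt (interval.one j) := by
    rw [interval.src_one, interval.tgt_one]
  { obj := fun _ x => c.obj j x
    map := fun _ f => c.map (interval.one j) f
    map₂ := fun _ α => c.map₂ (interval.one j) α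
    con := fun _ _ g f => c.con (interval.one j) (interval.one j) g f
    src_map := fun ε f => by rw [c.src_map, interval.src_one]
    tgt_map := fun ε f => by rw [c.tgt_map, interval.tgt_one]
    dom_map₂ := fun ε α => c.dom_map₂ _ _
    cod_map₂ := fun ε α => c.cod_map₂ _ _
    dom_con := fun ε η g f h₁ h₂ => by rw [c.dom_con _ _ _ _ e' h₂, e]
    cod_con := fun ε η g f h₁ h₂ => c.cod_con _ _ _ _ e' h₂
    map_one := fun _ x => c.map_one _ _
    con_one_left := fun η f => by
      have := c.con_one_left (interval.one j) f
      rwa [interval.tgt_one] at this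
    con_one_right := fun ε g => by
      have := c.con_one_right (interval.one j) g
      rwa [interval.src_one] at this
    cocycle := fun δ ε η k g f h₁ h₁' h₂ h₂' => by
      have := c.cocycle _ _ _ k g f e' e' h₂ h₂'
      rwa [e] at this
    map₂_vc := fun ε => c.map₂_vc _
    map₂_two := fun ε => c.map₂_two _
    naturality := fun ε η β α h₁ h₂ => by
      have := c.naturality _ _ β α e' h₂
      rwa [e] at this }

end Cyl

end TwoCat

/-! ### Linear cylinders -/

namespace TwoCat

namespace Cyl

variable {A B D E : TwoCat.{w}}

/-- A cylinder on `B` is linear with respect to `i : A → B` and `F : A → D` if it is constant with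
value `F` on `A` and strictly compatible with precomposition by the 1-cells of `A`. -/
structure IsLinear (i : A ⟶ B) (F : A ⟶ D) (c : Cyl B D) : Prop where
  obj : ∀ j a, c.obj j (i.obj a) = F.obj a
  map : ∀ ε k, c.map ε (i.map k) = F.map k
  map₂ : ∀ ε κ, c.map₂ ε (i.map₂ κ) = F.map₂ κ
  con : ∀ ε η g f, interval.src ε = interval.tgt η → A.src g = A.tgt f →
    c.con ε η (i.map g) (i.map f) = D.two (F.map (A.cmp g f))
  map_cmp : ∀ ε g k, B.src g = B.tgt (i.map k) →
    c.map ε (B.cmp g (i.map k)) = D.cmp (c.map ε g) (F.map k)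
  con_one : ∀ ε g k, B.src g = B.tgt (i.map k) →
    c.con ε (interval.one (interval.src ε)) g (i.map k) = D.two (c.map ε (B.cmp g (i.map k)))

namespace IsLinear

variable {i : A ⟶ B} {F : A ⟶ D} {c : Cyl B D} (l : IsLinear i F c)
include l

theorem src_map {ε : interval.{w}.One} {g : B.One} {k : A.One} (h : B.src g = B.tgt (i.map k)) :
    D.src (c.map ε g) = D.tgt (F.map k) := by
  rw [c.src_map, h, i.tgt_map, l.obj, F.tgt_map]

theorem src_dom_con {ε η : interval.{w}.One} {g f : B.One} {k : A.One}
    (hεη : interval.src ε = interval.tgt η)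
    (hgf : B.src g = B.tgt f) (hfk : B.src f = B.tgt (i.map k)) :
    D.src (D.dom (c.con ε η g f)) = D.tgt (F.map k) := by
  rw [c.dom_con _ _ _ _ hεη hgf, c.src_map, src_cmp hgf, hfk, i.tgt_map, l.obj, F.tgt_map]

/-- In the naturality square at `(ε, α)` and `(1, κ)`, both constraints are identities by `con_one`.
-/
theorem map₂_hc (ε : interval.{w}.One) (α : B.Two) (κ : A.Two)
    (h : B.src (B.dom α) = B.tgt (B.dom (i.map₂ κ))) :
    c.map₂ ε (B.hc α (i.map₂ κ)) = D.hc (c.map₂ ε α) (F.map₂ κ) := by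
  have hd : B.src (B.dom α) = B.tgt (i.map (A.dom κ)) := by rw [h, i.dom_map₂]
  have hc : B.src (B.cod α) = B.tgt (i.map (A.cod κ)) := by
    rw [B.src_cod, h, ← i.cod_map₂, B.tgt_cod]
  have hε : interval.cmp ε (interval.one (interval.src ε)) = ε := cmp_one rfl
  have e := c.naturality ε (interval.one (interval.src ε)) α (i.map₂ κ)
    (interval.tgt_one _).symm h
  have hs : D.src (D.dom (c.map₂ ε α)) = D.tgt (D.dom (F.map₂ κ)) := by
    rw [c.dom_map₂, F.dom_map₂, l.src_map hd]
  rw [i.cod_map₂, i.dom_map₂, l.con_one _ _ _ hc, l.con_one _ _ _ hd, hε, l.map₂, two_vc, vc_two]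
    at e
  · exact e
  · rw [dom_hc hs, l.map_cmp _ _ _ hd, c.dom_map₂, F.dom_map₂]
  · rw [c.cod_map₂, cod_hc h, i.cod_map₂]

/-- Cocycle condition at `(ε, g)`, `(η, f)`, `(1, k)`: the two constraints whose second term is `(1,
k)` are identities by `con_one`. -/
theorem con_cmp (ε η : interval.{w}.One) (g f : B.One) (k : A.One)
    (hεη : interval.src ε = interval.tgt η)
    (hgf : B.src g = B.tgt f) (hfk : B.src f = B.tgt (i.map k)) :
    c.con ε η g (B.cmp f (i.map k)) = D.hc (c.con ε η g f) (D.two (F.map k)) := by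
  have hη : interval.cmp η (interval.one (interval.src η)) = η := cmp_one rfl
  have hgk : B.src (B.cmp g f) = B.tgt (i.map k) := by rw [src_cmp hgf, hfk]
  have hg : B.src g = B.tgt (B.cmp f (i.map k)) := by rw [tgt_cmp, hgf]
  have x : D.src (c.map ε g) = D.tgt (c.map η (B.cmp f (i.map k))) := by
    rw [c.src_map, c.tgt_map, hεη, hg]
  have x' : D.src (D.dom (c.con ε η g f)) = D.tgt (D.dom (D.two (F.map k))) := by
    rw [D.dom_two, l.src_dom_con hεη hgf hfk]
  have e := c.cocycle ε η (interval.one (interval.src η)) g f (i.map k) hεη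
    (interval.tgt_one _).symm hgf hfk
  have e₁ := l.con_one (interval.cmp ε η) _ _ hgk
  rw [src_cmp hεη] at e₁
  rw [l.con_one _ _ _ hfk, hη, l.map, e₁, hc_two x, two_vc, vc_two] at e
  · exact e
  · rw [dom_hc x', D.dom_two, c.dom_con _ _ _ _ hεη hgf, l.map_cmp _ _ _ hgk]
  · rw [c.cod_con _ _ _ _ hεη hg]

/-- The case of an identity `f` in `con_cmp`. Constraints whose second term lies over `A` are thus
determined by those at identities. -/
theorem con_map (ε η : interval.{w}.One) (g : B.One) (k : A.One)
    (hεη : interval.src ε = interval.tgt η) (h : B.src g = B.tgt (i.map k)) :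
    c.con ε η g (i.map k) = D.hc (c.con ε η g (B.one (B.src g))) (D.two (F.map k)) := by
  rw [← l.con_cmp ε η g _ k hεη (B.tgt_one _).symm (by rw [B.src_one, h]), one_cmp h]

/-- Cocycle condition at `(ε, g)`, `(1, k)`, `(η, m)`: the constraint of `(1, k)` and `(η, m)` is an
identity because both lie over `A`, that of `(ε, g)` and `(1, k)` by `con_one`. -/
theorem cmp_con (ε η : interval.{w}.One) (g : B.One) (k m : A.One)
    (hεη : interval.src ε = interval.tgt η) (h : B.src g = B.tgt (i.map k))
    (h' : A.src k = A.tgt m) :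
    c.con ε η (B.cmp g (i.map k)) (i.map m) = c.con ε η g (i.map (A.cmp k m)) := by
  have hi : B.src (i.map k) = B.tgt (i.map m) := by rw [i.src_map, i.tgt_map, h']
  have hη : interval.cmp (interval.one (interval.src ε)) η = η := one_cmp hεη
  have hε : interval.cmp ε (interval.one (interval.src ε)) = ε := cmp_one rfl
  have hF : D.src (F.map k) = D.tgt (F.map m) := by rw [F.src_map, F.tgt_map, h']
  have hg : B.src g = B.tgt (i.map (A.cmp k m)) := by rw [h, i.tgt_map, i.tgt_map, tgt_cmp]
  have x : D.src (c.map ε g) = D.tgt (F.map k) := l.src_map h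
  have hgk : B.src (B.cmp g (i.map k)) = B.tgt (i.map m) := by rw [src_cmp h, hi]
  have e := c.cocycle ε (interval.one (interval.src ε)) η g (i.map k) (i.map m)
    (interval.tgt_one _).symm (by rw [interval.src_one, hεη]) h hi
  rw [l.con _ _ _ _ (by rw [interval.src_one, hεη]) h', hη, hε, ← i.map_cmp h', l.con_one _ _ _ h,
    l.map_cmp _ _ _ h, l.map, hc_two, hc_two, two_vc, two_vc] at e
  · exact e.symm
  · rw [c.cod_con _ _ _ _ hεη hgk, l.map_cmp _ _ _ h, l.map]
  · rw [c.cod_con _ _ _ _ hεη hg, l.map]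
  · rw [src_cmp x, hF]
  · rw [x, F.tgt_map, F.tgt_map, tgt_cmp]

/-- This makes the constraint at `(ε, g)` and `(η, 1)` linear in `g`, which allows its extension as
a map of modules. -/
theorem con_one_cmp (ε η : interval.{w}.One) (g : B.One) (k : A.One)
    (hεη : interval.src ε = interval.tgt η) (h : B.src g = B.tgt (i.map k)) :
    c.con ε η (B.cmp g (i.map k)) (B.one (B.src (i.map k))) =
      D.hc (c.con ε η g (B.one (B.src g))) (D.two (F.map k)) := by
  rw [i.src_map, ← i.map_one, l.cmp_con ε η g k _ hεη h (A.tgt_one _).symm, cmp_one rfl,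
    l.con_map ε η g k hεη h]

theorem postcomp (G : D ⟶ E) : IsLinear i (F ≫ G) (c.postcomp G) where
  obj j a := congrArg G.obj (l.obj j a)
  map ε k := congrArg G.map (l.map ε k)
  map₂ ε κ := congrArg G.map₂ (l.map₂ ε κ)
  con ε η g f h h' := (congrArg G.map₂ (l.con ε η g f h h')).trans (G.map₂_two _)
  map_cmp ε g k h := (congrArg G.map (l.map_cmp ε g k h)).trans (G.map_cmp (l.src_map h))
  con_one ε g k h := (congrArg G.map₂ (l.con_one ε g k h)).trans (G.map₂_two _)

theorem freeze (j : interval.{w}.Obj) : IsLinear i F (c.freeze j) where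
  obj _ a := l.obj j a
  map _ k := l.map _ k
  map₂ _ κ := l.map₂ _ κ
  con _ _ g f _ h' := l.con _ _ g f (by rw [interval.src_one, interval.tgt_one]) h'
  map_cmp _ g k h := l.map_cmp _ g k h
  con_one _ g k h := by
    have := l.con_one (interval.one j) g k h
    rwa [interval.src_one] at this

end IsLinear

theorem isLinear_ofStrict {i : A ⟶ B} {F : A ⟶ D} {G : B ⟶ D} (h : i ≫ G = F) :
    IsLinear i F (ofStrict G) := by
  subst h
  exact
  { obj := fun _ _ => rfl
    map := fun _ _ => rfl
    map₂ := fun _ _ => rfl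
    con := fun _ _ g f _ h' => congrArg D.two (congrArg G.map (i.map_cmp h').symm)
    map_cmp := fun _ _ _ h => G.map_cmp h
    con_one := fun _ _ _ _ => rfl }

/-- The cylinder `c'` extends `c` along `v`. -/
structure Agree {B B' : TwoCat.{w}} (v : B ⟶ B') (c : Cyl B D) (c' : Cyl B' D) : Prop where
  obj : ∀ j x, c'.obj j (v.obj x) = c.obj j x
  map : ∀ ε f, c'.map ε (v.map f) = c.map ε f
  map₂ : ∀ ε α, c'.map₂ ε (v.map₂ α) = c.map₂ ε α
  con : ∀ ε η g f, interval.src ε = interval.tgt η → B.src g = B.tgt f →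
    c'.con ε η (v.map g) (v.map f) = c.con ε η g f

theorem toOplax_ofOplax (H : OplaxFunctor (prod interval.{w} B) D) : (ofOplax H).toOplax = H :=
  oplaxFunctor_ext (fun _ => rfl) (fun _ => rfl) (fun _ => rfl)
    (fun _ _ h => totalConstr_eq (Prod.ext_iff.1 h).1 (Prod.ext_iff.1 h).2)

theorem toOplax_ofStrict (F : B ⟶ D) : (ofStrict F).toOplax = oplax (prodSnd interval B ≫ F) :=
  oplaxFunctor_ext (fun _ => rfl) (fun _ => rfl) (fun _ => rfl)
    (fun _ _ h => congrArg (fun x => D.two (F.map x)) (comp_eq (Prod.ext_iff.1 h).2).symm)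

theorem toOplax_postcomp (c : Cyl B D) (F : D ⟶ E) :
    (c.postcomp F).toOplax = (oplax F).comp c.toOplax :=
  oplaxFunctor_ext (fun _ => rfl) (fun _ => rfl) (fun _ => rfl)
    (fun g f h => (constr_oplax_comp F c.toOplax g f h).symm)

/-- The constraint of a composite with a strict 2-functor has an identity factor, so equality of the
composites reduces to equality of values. -/
theorem toOplax_comp_prodMap_iff {B' : TwoCat.{w}} {v : B ⟶ B'} {c : Cyl B D} {c' : Cyl B' D} :
    c'.toOplax.comp (oplax (prodMap interval v)) = c.toOplax ↔ Agree v c c' := by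
  refine ⟨fun e => ⟨fun j x => congrFun (congrArg OplaxFunctor.obj e) (j, x),
    fun ε f => congrFun (congrArg OplaxFunctor.map e) (ε, f),
    fun ε α => congrFun (congrArg OplaxFunctor.map₂ e) (ε, α), fun ε η g f h h' => ?_⟩,
    fun a => oplaxFunctor_ext (fun _ => a.obj _ _) (fun _ => a.map _ _) (fun _ => a.map₂ _ _)
      (fun g f h => ?_)⟩
  · have hx : (prod interval B).src (ε, g) = (prod interval B).tgt (η, f) := Prod.ext h h'
    exact (constr_comp_oplax c'.toOplax (prodMap interval v) (ε, g) (η, f) hx).symm.trans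
      (congrFun (congrFun (congrFun (congrArg OplaxFunctor.constr e) (ε, g)) (η, f)) hx)
  · exact (constr_comp_oplax c'.toOplax (prodMap interval v) g f h).trans
      (a.con _ _ _ _ (Prod.ext_iff.1 h).1 (Prod.ext_iff.1 h).2)

theorem toOplax_comp_face_iff {c : Cyl B D} {F : B ⟶ D} {j : Fin 2} :
    c.toOplax.comp (oplax (face j B)) = oplax F ↔
      Agree (𝟙 B) (ofStrict F) (c.freeze (endpt j)) := by
  refine ⟨fun e => ⟨fun _ x => congrFun (congrArg OplaxFunctor.obj e) x,
    fun _ f => congrFun (congrArg OplaxFunctor.map e) f,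
    fun _ α => congrFun (congrArg OplaxFunctor.map₂ e) α, fun ε η g f _ h => ?_⟩,
    fun a => oplaxFunctor_ext (fun x => a.obj (endpt j) x)
      (fun f => a.map (interval.one (endpt j)) f)
      (fun α => a.map₂ (interval.one (endpt j)) α) (fun g f h => ?_)⟩
  · exact ((constr_comp_oplax c.toOplax (face j B) g f h).symm.trans
      (congrFun (congrFun (congrFun (congrArg OplaxFunctor.constr e) g) f) h)).trans
      (congrArg (fun x => D.two (F.map x)) (comp_eq h))
  · exact (constr_comp_oplax c.toOplax (face j B) g f h).trans
      ((a.con (interval.one (endpt j)) (interval.one (endpt j)) g f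
        (by rw [interval.src_one, interval.tgt_one]) h).trans
        (congrArg (fun x => D.two (F.map x)) (comp_eq h).symm))

end Cyl

theorem interval_one_cases (ε : interval.{w}.One) :
    ε = interval.one (endpt 0) ∨ ε = arrow ∨ ε = interval.one (endpt 1) := by
  obtain h | h := endpt_cases (interval.src ε) <;> obtain h' | h' := endpt_cases (interval.tgt ε)
  · exact Or.inl (interval_one_ext h h')
  · exact Or.inr (Or.inl (interval_one_ext h h'))
  · rw [interval_src_eq ε h'] at h
    exact absurd h endpt_ne
  · exact Or.inr (Or.inr (interval_one_ext h h'))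

namespace StrongOplaxRetract

open Cyl

variable {A B : TwoCat.{w}} {i : A ⟶ B} (S : StrongOplaxRetract i)

/-- The cylinder underlying a strong oplax deformation retract structure. -/
noncomputable def cyl : Cyl B B := ofOplax S.homotopy.H

theorem toOplax_cyl : S.cyl.toOplax = S.homotopy.H := toOplax_ofOplax _

theorem agree_zero : Agree (𝟙 B) (ofStrict (S.r ≫ i)) (S.cyl.freeze (endpt 0)) :=
  toOplax_comp_face_iff.1 (by rw [toOplax_cyl]; exact S.homotopy.at_zero)

theorem agree_one : Agree (𝟙 B) (ofStrict (𝟙 B)) (S.cyl.freeze (endpt 1)) :=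
  toOplax_comp_face_iff.1 (by rw [toOplax_cyl]; exact S.homotopy.at_one)

theorem agree_relative : Agree i (ofStrict i) S.cyl :=
  toOplax_comp_prodMap_iff.1 (by rw [toOplax_cyl, toOplax_ofStrict]; exact S.relative)

/-- At an end the cylinder is a strict 2-functor `F` that restricts to `i` along `i`, and linearity
is functoriality of `F`. -/
theorem isLinear_of_agree {F : B ⟶ B} {j : interval.{w}.Obj} (hF : i ≫ F = i)
    (a : Agree (𝟙 B) (ofStrict F) (S.cyl.freeze j)) (g : B.One) (k : A.One)
    (h : B.src g = B.tgt (i.map k)) :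
    S.cyl.map (interval.one j) (B.cmp g (i.map k)) =
        B.cmp (S.cyl.map (interval.one j) g) (i.map k) ∧
      S.cyl.con (interval.one j) (interval.one j) g (i.map k) =
        B.two (S.cyl.map (interval.one j) (B.cmp g (i.map k))) := by
  have e : ∀ f, S.cyl.map (interval.one j) f = F.map f := fun f => a.map (interval.one j) f
  refine ⟨?_, ?_⟩
  · rw [e, e, F.map_cmp h]
    exact congrArg _ (congr_functor_map hF k)
  · rw [e]
    exact a.con (interval.one j) (interval.one j) g (i.map k)
      (by rw [interval.src_one, interval.tgt_one]) h

/-- Linearity is assumed only over `0 → 1`. Over the two identities of `Δ₁` it follows from the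
strictness of `ir` and `1_B`. -/
theorem isLinear : S.cyl.IsLinear i i where
  obj := S.agree_relative.obj
  map := S.agree_relative.map
  map₂ := S.agree_relative.map₂
  con := S.agree_relative.con
  map_cmp ε g k h := by
    obtain rfl | rfl | rfl := interval_one_cases ε
    · refine (S.isLinear_of_agree ?_ S.agree_zero g k h).1
      rw [← Category.assoc, S.retraction, Category.id_comp]
    · rw [← comp_eq h]
      refine (S.map_comp g k h).trans ?_
      rw [comp_eq]
      exact congrArg (B.cmp _) (S.agree_relative.map _ k)
    · exact (S.isLinear_of_agree (Category.comp_id i) S.agree_one g k h).1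
  con_one ε g k h := by
    obtain rfl | rfl | rfl := interval_one_cases ε
    · rw [interval.src_one]
      refine (S.isLinear_of_agree ?_ S.agree_zero g k h).2
      rw [← Category.assoc, S.retraction, Category.id_comp]
    · rw [← comp_eq h]
      exact (totalConstr_eq (interval.tgt_one _).symm h).trans (S.constr_eq g k h)
    · rw [interval.src_one]
      exact (S.isLinear_of_agree (Category.comp_id i) S.agree_one g k h).2

end StrongOplaxRetract

end TwoCat

/-! ### Induction on composable cells of the pushout, and uniqueness -/

namespace TwoCat

namespace SievePushout

variable {A B A' B' : TwoCat.{w}} {u : A ⟶ A'} {i : A ⟶ B} {i' : A' ⟶ B'} {v : B ⟶ B'}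
  {χ : B ⟶ interval.{w}} {χ' : B' ⟶ interval.{w}} (P : SievePushout u i i' v χ χ')
include P

theorem exists_map_of_tgt {f : B'.One} (h : χ'.obj (B'.tgt f) = endpt 0) : ∃ k, f = i'.map k := by
  obtain ⟨k, hk⟩ := P.sieve'.surj₁ f h
  exact ⟨k, hk.symm⟩

theorem exists_map₂_of_tgt {α : B'.Two} (h : χ'.obj (B'.tgt (B'.dom α)) = endpt 0) :
    ∃ κ, α = i'.map₂ κ := by
  obtain ⟨k, hk⟩ := P.sieve'.surj₂ α h
  exact ⟨k, hk.symm⟩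

theorem composable_of_ne {g f : B.One} (hg : χ.obj (B.src g) ≠ endpt 0)
    (h : B'.src (v.map g) = B'.tgt (v.map f)) : B.src g = B.tgt f :=
  P.inj₀ hg (by rw [← v.src_map, ← v.tgt_map, h])

theorem composable_of_map {k l : A'.One} (h : B'.src (i'.map k) = B'.tgt (i'.map l)) :
    A'.src k = A'.tgt l :=
  P.sieve'.inj₀ (by rw [← i'.src_map, ← i'.tgt_map, h])

theorem exists_map_of_src {g f : B'.One} (h : B'.src g = B'.tgt f)
    (hg : χ'.obj (B'.src g) = endpt 0) : ∃ k, f = i'.map k :=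
  P.exists_map_of_tgt (by rw [← h, hg])

/-- Induction on composable pairs of 1-cells of the pushout. -/
theorem pair_induction {Q : B'.One → B'.One → Prop}
    (hA : ∀ k l, A'.src k = A'.tgt l → Q (i'.map k) (i'.map l))
    (hB : ∀ g f, B.src g = B.tgt f → Q (v.map g) (v.map f))
    (hr : ∀ g f k, B'.src g = B'.tgt f → B'.src f = B'.tgt (i'.map k) → Q g f →
      Q g (B'.cmp f (i'.map k)))
    (hm : ∀ g k l, B'.src g = B'.tgt (i'.map k) → A'.src k = A'.tgt l →
      Q g (i'.map (A'.cmp k l)) → Q (B'.cmp g (i'.map k)) (i'.map l))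
    (g f : B'.One) (h : B'.src g = B'.tgt f) : Q g f := by
  -- Inserting an identity of `B`, in the form `i'(k) = v(1) i'(k)`, reduces this to a pair in `B`.
  have hBA : ∀ g k, B'.src (v.map g) = B'.tgt (i'.map k) → Q (v.map g) (i'.map k) := by
    intro g k h
    have := hr (v.map g) (v.map (B.one (B.src g))) k (by rw [v.tgt_map, v.src_map, B.tgt_one])
      (by rw [v.src_map, B.src_one, ← v.src_map, h]) (hB _ _ (B.tgt_one _).symm)
    rwa [v.map_one, one_cmp (by rw [← h, v.src_map])] at this
  obtain ⟨k, rfl⟩ | ⟨b, hb, rfl⟩ | ⟨b, k, hb, hb', hbk, rfl⟩ := P.one_cases g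
  · obtain ⟨l, rfl⟩ := P.exists_map_of_src h (by rw [i'.src_map, P.sieve'.obj_eq])
    exact hA k l (P.composable_of_map h)
  · obtain ⟨l, rfl⟩ | ⟨a, ha, rfl⟩ | ⟨a, l, ha, ha', hal, rfl⟩ := P.one_cases f
    · exact hBA b l h
    · exact hB b a (P.composable_of_ne hb h)
    · rw [tgt_cmp] at h
      exact hr _ _ l h hal (hB b a (P.composable_of_ne hb h))
  · rw [src_cmp hbk] at h
    obtain ⟨l, rfl⟩ := P.exists_map_of_src h (by rw [i'.src_map, P.sieve'.obj_eq])
    have hkl := P.composable_of_map h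
    -- Moving `k` to the second term leaves a pair covered by `hBA`.
    exact hm _ k l hbk hkl (hBA b _ (by rw [hbk, i'.tgt_map, i'.tgt_map, tgt_cmp]))

/-- Induction on composable triples of 1-cells of the pushout. -/
theorem triple_induction {Q : B'.One → B'.One → B'.One → Prop}
    (hA : ∀ k l m, A'.src k = A'.tgt l → A'.src l = A'.tgt m →
      Q (i'.map k) (i'.map l) (i'.map m))
    (hB : ∀ k g f, B.src k = B.tgt g → B.src g = B.tgt f → Q (v.map k) (v.map g) (v.map f))
    (hr : ∀ k g f a, B'.src k = B'.tgt g → B'.src g = B'.tgt f → B'.src f = B'.tgt (i'.map a) →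
      Q k g f → Q k g (B'.cmp f (i'.map a)))
    (hm : ∀ k g a b, B'.src k = B'.tgt g → B'.src g = B'.tgt (i'.map a) → A'.src a = A'.tgt b →
      Q k g (i'.map (A'.cmp a b)) → Q k (B'.cmp g (i'.map a)) (i'.map b))
    (hl : ∀ k a b c, B'.src k = B'.tgt (i'.map a) → A'.src a = A'.tgt b → A'.src b = A'.tgt c →
      Q k (i'.map (A'.cmp a b)) (i'.map c) → Q (B'.cmp k (i'.map a)) (i'.map b) (i'.map c))
    (k g f : B'.One) (h : B'.src k = B'.tgt g) (h' : B'.src g = B'.tgt f) : Q k g f := by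
  have hBBA : ∀ k g a, B.src k = B.tgt g → B'.src (v.map g) = B'.tgt (i'.map a) →
      Q (v.map k) (v.map g) (i'.map a) := by
    intro k g a h h'
    have := hr (v.map k) (v.map g) (v.map (B.one (B.src g))) a (by rw [v.tgt_map, v.src_map, h])
      (by rw [v.tgt_map, v.src_map, B.tgt_one]) (by rw [v.src_map, B.src_one, ← v.src_map, h'])
      (hB _ _ _ h (B.tgt_one _).symm)
    rwa [v.map_one, one_cmp (by rw [← h', v.src_map])] at this
  obtain ⟨a, rfl⟩ | ⟨k, hk, rfl⟩ | ⟨k, a, hk, hk', hka, rfl⟩ := P.one_cases k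
  · obtain ⟨b, rfl⟩ := P.exists_map_of_src h (by rw [i'.src_map, P.sieve'.obj_eq])
    obtain ⟨c, rfl⟩ := P.exists_map_of_src h' (by rw [i'.src_map, P.sieve'.obj_eq])
    exact hA a b c (P.composable_of_map h) (P.composable_of_map h')
  · obtain ⟨b, rfl⟩ | ⟨g, hg, rfl⟩ | ⟨g, b, hg, hg', hgb, rfl⟩ := P.one_cases g
    · refine absurd ?_ hk
      rw [← P.chi_obj, ← v.src_map, h, i'.tgt_map, P.sieve'.obj_eq]
    · have hkg := P.composable_of_ne hk h
      obtain ⟨c, rfl⟩ | ⟨f, hf, rfl⟩ | ⟨f, c, hf, hf', hfc, rfl⟩ := P.one_cases f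
      · exact hBBA k g c hkg h'
      · exact hB k g f hkg (P.composable_of_ne hg h')
      · rw [tgt_cmp] at h'
        exact hr _ _ _ c h h' hfc (hB k g f hkg (P.composable_of_ne hg h'))
    · rw [tgt_cmp] at h
      rw [src_cmp hgb] at h'
      have hkg := P.composable_of_ne hk h
      obtain ⟨c, rfl⟩ := P.exists_map_of_src h' (by rw [i'.src_map, P.sieve'.obj_eq])
      exact hm _ _ b c h hgb (P.composable_of_map h')
        (hBBA k g _ hkg (by rw [hgb, i'.tgt_map, i'.tgt_map, tgt_cmp]))
  · rw [src_cmp hka] at h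
    obtain ⟨b, rfl⟩ := P.exists_map_of_src h (by rw [i'.src_map, P.sieve'.obj_eq])
    obtain ⟨c, rfl⟩ := P.exists_map_of_src h' (by rw [i'.src_map, P.sieve'.obj_eq])
    have hab := P.composable_of_map h
    have hbc := P.composable_of_map h'
    have hab' : A'.src (A'.cmp a b) = A'.tgt c := by rw [src_cmp hab, hbc]
    refine hl _ a b c hka hab hbc ?_
    have e : v.obj (B.src k) = i'.obj (A'.tgt a) := by rw [← v.src_map, hka, i'.tgt_map]
    -- An identity of `B` is inserted as middle term, so that `hm` can extract `ab` from the third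
    -- term `(ab)c`.
    have := hm (v.map k) (v.map (B.one (B.src k))) (A'.cmp a b) c
      (by rw [v.tgt_map, v.src_map, B.tgt_one])
      (by rw [v.src_map, B.src_one, e, i'.tgt_map, tgt_cmp]) hab'
      (hBBA k _ _ (B.tgt_one _).symm
        (by rw [v.src_map, B.src_one, e, i'.tgt_map, tgt_cmp, tgt_cmp]))
    rwa [v.map_one, one_cmp (by rw [e, i'.tgt_map, tgt_cmp])] at this

/-- Induction on horizontally composable pairs of 2-cells of the pushout. -/
theorem pair_induction₂ {Q : B'.Two → B'.Two → Prop}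
    (hA : ∀ κ l, A'.src (A'.dom κ) = A'.tgt (A'.dom l) → Q (i'.map₂ κ) (i'.map₂ l))
    (hB : ∀ β α, B.src (B.dom β) = B.tgt (B.dom α) → Q (v.map₂ β) (v.map₂ α))
    (hr : ∀ β α κ, B'.src (B'.dom β) = B'.tgt (B'.dom α) →
      B'.src (B'.dom α) = B'.tgt (B'.dom (i'.map₂ κ)) → Q β α → Q β (B'.hc α (i'.map₂ κ)))
    (hm : ∀ β κ l, B'.src (B'.dom β) = B'.tgt (B'.dom (i'.map₂ κ)) →
      A'.src (A'.dom κ) = A'.tgt (A'.dom l) →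
      Q β (i'.map₂ (A'.hc κ l)) → Q (B'.hc β (i'.map₂ κ)) (i'.map₂ l))
    (hv : ∀ δ γ β α, B'.dom δ = B'.cod γ → B'.dom β = B'.cod α →
      B'.src (B'.dom γ) = B'.tgt (B'.dom α) → Q δ β → Q γ α → Q (B'.vc δ γ) (B'.vc β α))
    (β α : B'.Two) (h : B'.src (B'.dom β) = B'.tgt (B'.dom α)) : Q β α := by
  have hBA : ∀ β κ, B'.src (B'.dom (v.map₂ β)) = B'.tgt (B'.dom (i'.map₂ κ)) →
      Q (v.map₂ β) (i'.map₂ κ) := by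
    intro β κ h
    have e : B'.src (B'.dom (v.map₂ β)) = v.obj (B.src (B.dom β)) := by rw [v.dom_map₂, v.src_map]
    have := hr (v.map₂ β) (v.map₂ (B.two (B.one (B.src (B.dom β))))) κ
      (by rw [e, v.dom_map₂, v.tgt_map, B.dom_two, B.tgt_one])
      (by rw [v.dom_map₂, v.src_map, B.dom_two, B.src_one, ← e, h])
      (hB _ _ (by rw [B.dom_two, B.tgt_one]))
    rwa [v.map₂_two, v.map_one, one_hc (by rw [← h, e])] at this
  -- Generated cells are vertical composites. With an identity as one of the four cells, `hv`
  -- decomposes one variable at a time.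
  have hG : ∀ α, Generated i' v χ α → ∀ β, χ.obj (B.src (B.dom β)) ≠ endpt 0 →
      B'.src (B'.dom (v.map₂ β)) = B'.tgt (B'.dom α) → Q (v.map₂ β) α := by
    intro α hα
    have comp : ∀ β α, χ.obj (B.src (B.dom β)) ≠ endpt 0 →
        B'.src (B'.dom (v.map₂ β)) = B'.tgt (B'.dom (v.map₂ α)) →
        B.src (B.dom β) = B.tgt (B.dom α) := fun β α hβ h =>
      P.composable_of_ne hβ (by rw [← v.dom_map₂, h, v.dom_map₂])
    induction hα with
    | of α _ => exact fun β hβ h => hB β α (comp β α hβ h)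
    | of_hc α κ _ _ hc =>
      intro β hβ h
      rw [tgt_dom_hc] at h
      exact hr _ _ κ h hc (hB β α (comp β α hβ h))
    | vc γ α hγα _ _ ihγ ihα =>
      intro β hβ h
      have h₁ : B'.src (B'.dom (v.map₂ β)) = B'.tgt (B'.dom γ) := by rw [h, tgt_dom_vc]
      have h₂ : B'.src (B'.dom (v.map₂ (B.two (B.dom β)))) = B'.tgt (B'.dom α) := by
        rw [v.dom_map₂, B.dom_two, ← v.dom_map₂, h₁, hγα, B'.tgt_cod]
      have := hv (v.map₂ β) (v.map₂ (B.two (B.dom β))) γ α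
        (by rw [v.dom_map₂, v.cod_map₂, B.cod_two]) hγα h₂ (ihγ β hβ h₁)
        (ihα _ (by rwa [B.dom_two]) h₂)
      rwa [v.map₂_two, vc_two (v.dom_map₂ β).symm] at this
  have hGG : ∀ β, Generated i' v χ β → ∀ α, B'.src (B'.dom β) = B'.tgt (B'.dom α) → Q β α := by
    intro β hβ
    induction hβ with
    | of β hβ =>
      intro α h
      refine hG α (P.generated α ?_) β hβ h
      rwa [← h, v.dom_map₂, v.src_map, P.chi_obj]
    | of_hc β κ _ _ hc =>
      intro α h
      rw [src_dom_hc hc] at h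
      obtain ⟨l, rfl⟩ := P.exists_map₂_of_tgt (α := α)
        (by rw [← h, i'.dom_map₂, i'.src_map, P.sieve'.obj_eq])
      have hkl : A'.src (A'.dom κ) = A'.tgt (A'.dom l) :=
        P.composable_of_map (by rw [← i'.dom_map₂, h, i'.dom_map₂])
      refine hm _ κ l hc hkl (hBA β _ ?_)
      rw [hc, i'.dom_map₂, i'.dom_map₂, i'.tgt_map, i'.tgt_map, tgt_dom_hc]
    | vc γ β hγβ _ _ ihγ ihβ =>
      intro α h
      rw [src_dom_vc] at h
      have h' : B'.src (B'.dom β) = B'.tgt (B'.dom (B'.two (B'.dom α))) := by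
        rw [B'.dom_two, ← h, hγβ, B'.src_cod]
      have := hv γ β α (B'.two (B'.dom α)) hγβ (B'.cod_two _).symm h' (ihγ α h) (ihβ _ h')
      rwa [vc_two rfl] at this
  by_cases hβ : χ'.obj (B'.tgt (B'.dom β)) = endpt 0
  · obtain ⟨κ, rfl⟩ := P.exists_map₂_of_tgt hβ
    obtain ⟨l, rfl⟩ := P.exists_map₂_of_tgt (α := α)
      (by rw [← h, i'.dom_map₂, i'.src_map, P.sieve'.obj_eq])
    exact hA κ l (P.composable_of_map (by rw [← i'.dom_map₂, h, i'.dom_map₂]))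
  · exact hGG β (P.generated β hβ) α h

end SievePushout

namespace Cyl

variable {A B A' B' D : TwoCat.{w}} {u : A ⟶ A'} {i : A ⟶ B} {i' : A' ⟶ B'} {v : B ⟶ B'}
  {χ : B ⟶ interval.{w}} {χ' : B' ⟶ interval.{w}}

/-- A linear cylinder on the pushout is determined by its restriction to `B`. -/
theorem IsLinear.agree (P : SievePushout u i i' v χ χ') {G : A' ⟶ D} {K : Cyl B D}
    {c c' : Cyl B' D} (l : IsLinear i' G c) (l' : IsLinear i' G c') (a : Agree v K c)
    (a' : Agree v K c') : Agree (𝟙 B') c c' where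
  obj j x := by
    change c'.obj j x = c.obj j x
    obtain ⟨a, rfl⟩ | ⟨b, -, rfl⟩ := P.obj_cases x
    · rw [l.obj, l'.obj]
    · rw [a.obj, a'.obj]
  map ε f := by
    change c'.map ε f = c.map ε f
    obtain ⟨k, rfl⟩ | ⟨g, -, rfl⟩ | ⟨g, k, -, -, h, rfl⟩ := P.one_cases f
    · rw [l.map, l'.map]
    · rw [a.map, a'.map]
    · rw [l.map_cmp _ _ _ h, l'.map_cmp _ _ _ h, a.map, a'.map]
  map₂ ε α := by
    change c'.map₂ ε α = c.map₂ ε α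
    by_cases hα : χ'.obj (B'.tgt (B'.dom α)) = endpt 0
    · obtain ⟨κ, rfl⟩ := P.exists_map₂_of_tgt hα
      rw [l.map₂, l'.map₂]
    · induction P.generated α hα with
      | of α _ => rw [a.map₂, a'.map₂]
      | of_hc α κ _ _ h => rw [l.map₂_hc _ _ _ h, l'.map₂_hc _ _ _ h, a.map₂, a'.map₂]
      | vc β α h hβ hα' ihβ ihα =>
        rw [tgt_dom_vc] at hα
        rw [c.map₂_vc _ _ _ h, c'.map₂_vc _ _ _ h, ihβ hα,
          ihα (by rwa [← B'.tgt_cod, ← h])]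
  con ε η g f hεη := by
    change _ → c'.con ε η g f = c.con ε η g f
    revert g f
    -- The two reduction rules of this induction are `con_cmp` and `cmp_con`, which hold for both
    -- cylinders.
    refine P.pair_induction (fun k m h => ?_) (fun g f h => ?_) (fun g f k hgf hfk e => ?_)
      (fun g k m hgk hkm e => ?_)
    · rw [l.con _ _ _ _ hεη h, l'.con _ _ _ _ hεη h]
    · rw [a.con _ _ _ _ hεη h, a'.con _ _ _ _ hεη h]
    · rw [l.con_cmp _ _ _ _ _ hεη hgf hfk, l'.con_cmp _ _ _ _ _ hεη hgf hfk, e]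
    · rw [l.cmp_con _ _ _ _ _ hεη hgk hkm, l'.cmp_con _ _ _ _ _ hεη hgk hkm, e]

end Cyl

end TwoCat

/-! ### Module maps for all targets at once, and 2-cells as 1-cells -/

namespace TwoCat

/-- A map from the right `D`-module of cells of `X` to the right `D`-module of cells of `W`,
extending the 2-functor `F` on `D`. -/
structure ModMap {D X W : TwoCat.{w}} (j : D ⟶ X) (F : D ⟶ W) (o₀ o₁ : X.Obj → W.Obj) where
  f₁ : X.One → W.One
  f₂ : X.Two → W.Two
  src : ∀ f, W.src (f₁ f) = o₀ (X.src f)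
  tgt : ∀ f, W.tgt (f₁ f) = o₁ (X.tgt f)
  dom : ∀ α, W.dom (f₂ α) = f₁ (X.dom α)
  cod : ∀ α, W.cod (f₂ α) = f₁ (X.cod α)
  two : ∀ f, f₂ (X.two f) = W.two (f₁ f)
  vc : ∀ β α, X.dom β = X.cod α → f₂ (X.vc β α) = W.vc (f₂ β) (f₂ α)
  act₁ : ∀ f k, X.src f = X.tgt (j.map k) → f₁ (X.cmp f (j.map k)) = W.cmp (f₁ f) (F.map k)
  act₂ : ∀ α k, X.src (X.dom α) = X.tgt (X.dom (j.map₂ k)) →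
    f₂ (X.hc α (j.map₂ k)) = W.hc (f₂ α) (F.map₂ k)
  map : ∀ k, f₁ (j.map k) = F.map k
  map₂ : ∀ κ, f₂ (j.map₂ κ) = F.map₂ κ

namespace ModMap

variable {D X W : TwoCat.{w}} {j : D ⟶ X} {F : D ⟶ W} {o₀ o₁ : X.Obj → W.Obj}

/-- The restriction to the cells with target `c`. -/
def toHomMap (φ : ModMap j F o₀ o₁) (c : X.Obj) : HomMap j F o₀ c (o₁ c) where
  f₁ := φ.f₁
  f₂ := φ.f₂
  src f _ := φ.src f
  tgt f h := by rw [φ.tgt, h]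
  dom α _ := φ.dom α
  cod α _ := φ.cod α
  two f _ := φ.two f
  vc β α _ h := φ.vc β α h
  act₁ f k _ h := φ.act₁ f k h
  act₂ α k _ h := φ.act₂ α k h

variable {A B A' B' : TwoCat.{w}} {u : A ⟶ A'} {i : A ⟶ B} {i' : A' ⟶ B'} {v : B ⟶ B'}
  {χ : B ⟶ interval.{w}} {χ' : B' ⟶ interval.{w}}

open Classical in
/-- The map of modules on the cells of a sieve with target a given object of it. -/
noncomputable def homMapOfSieve (s : IsSieveOf i' χ') (G : A' ⟶ W) (o : B'.Obj → W.Obj)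
    (ho : ∀ a, G.obj a = o (i'.obj a)) (a : A'.Obj) : HomMap i' G o (i'.obj a) (G.obj a) :=
  -- Cells with target `i'(a)` come from `A'`, so the default values only concern cells on which no
  -- condition is imposed.
  let f₁ : B'.One → W.One := fun f => if h : ∃ k, i'.map k = f then G.map h.choose else
    W.one (G.obj a)
  let f₂ : B'.Two → W.Two := fun f => if h : ∃ k, i'.map₂ k = f then G.map₂ h.choose else
    W.two (W.one (G.obj a))
  have e₁ : ∀ k, f₁ (i'.map k) = G.map k := fun k => by
    have h : ∃ l, i'.map l = i'.map k := ⟨k, rfl⟩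
    simp only [f₁, dif_pos h]
    rw [s.inj₁ h.choose_spec]
  have e₂ : ∀ k, f₂ (i'.map₂ k) = G.map₂ k := fun k => by
    have h : ∃ l, i'.map₂ l = i'.map₂ k := ⟨k, rfl⟩
    simp only [f₂, dif_pos h]
    rw [s.inj₂ h.choose_spec]
  have c₁ : ∀ f, B'.tgt f = i'.obj a → ∃ k, i'.map k = f ∧ A'.tgt k = a := fun f hf => by
    obtain ⟨k, rfl⟩ := s.surj₁ f (by rw [hf, s.obj_eq])
    exact ⟨k, rfl, s.inj₀ (by rw [← hf, i'.tgt_map])⟩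
  have c₂ : ∀ f, B'.tgt (B'.dom f) = i'.obj a → ∃ k, i'.map₂ k = f := fun f hf =>
    s.surj₂ f (by rw [hf, s.obj_eq])
  { f₁ := f₁
    f₂ := f₂
    src := fun f h => by
      obtain ⟨k, rfl, rfl⟩ := c₁ f h
      rw [e₁, G.src_map, i'.src_map, ho]
    tgt := fun f h => by
      obtain ⟨k, rfl, rfl⟩ := c₁ f h
      rw [e₁, G.tgt_map]
    dom := fun f h => by
      obtain ⟨k, rfl⟩ := c₂ f h
      rw [e₂, G.dom_map₂, i'.dom_map₂, e₁]
    cod := fun f h => by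
      obtain ⟨k, rfl⟩ := c₂ f h
      rw [e₂, G.cod_map₂, i'.cod_map₂, e₁]
    two := fun f h => by
      obtain ⟨k, rfl, rfl⟩ := c₁ f h
      rw [← i'.map₂_two, e₂, e₁, G.map₂_two]
    vc := fun β α h hβα => by
      obtain ⟨k, rfl⟩ := c₂ β h
      obtain ⟨l, rfl⟩ := c₂ α (by rw [← h, hβα, B'.tgt_cod])
      have hkl : A'.dom k = A'.cod l := s.inj₁ (by rw [← i'.dom_map₂, hβα, i'.cod_map₂])
      rw [← i'.map₂_vc hkl, e₂, e₂, e₂, G.map₂_vc hkl]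
    act₁ := fun f l h hl => by
      obtain ⟨k, rfl, rfl⟩ := c₁ f h
      have hkl : A'.src k = A'.tgt l := s.inj₀ (by rw [← i'.src_map, hl, i'.tgt_map])
      rw [← i'.map_cmp hkl, e₁, e₁, G.map_cmp hkl]
    act₂ := fun f l h hl => by
      obtain ⟨k, rfl⟩ := c₂ f h
      have hkl : A'.src (A'.dom k) = A'.tgt (A'.dom l) := s.inj₀ (by
        rw [← i'.src_map, ← i'.tgt_map, ← i'.dom_map₂, hl, i'.dom_map₂])
      rw [← i'.map₂_hc hkl, e₂, e₂, G.map₂_hc hkl] }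

theorem homMapOfSieve_map (s : IsSieveOf i' χ') (G : A' ⟶ W) (o : B'.Obj → W.Obj)
    (ho : ∀ a, G.obj a = o (i'.obj a)) (a : A'.Obj) (k : A'.One) :
    (homMapOfSieve s G o ho a).f₁ (i'.map k) = G.map k := by
  have h : ∃ l, i'.map l = i'.map k := ⟨k, rfl⟩
  refine (dif_pos h).trans ?_
  rw [s.inj₁ h.choose_spec]

theorem homMapOfSieve_map₂ (s : IsSieveOf i' χ') (G : A' ⟶ W) (o : B'.Obj → W.Obj)
    (ho : ∀ a, G.obj a = o (i'.obj a)) (a : A'.Obj) (k : A'.Two) :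
    (homMapOfSieve s G o ho a).f₂ (i'.map₂ k) = G.map₂ k := by
  have h : ∃ l, i'.map₂ l = i'.map₂ k := ⟨k, rfl⟩
  refine (dif_pos h).trans ?_
  rw [s.inj₂ h.choose_spec]

variable {G : A' ⟶ W} {p₀ p₁ : B'.Obj → W.Obj}

/-- Extension of a map of right modules along a pushout of a sieve. -/
theorem exists_extend (P : SievePushout u i i' v χ χ') (h₀ : ∀ a, G.obj a = p₀ (i'.obj a))
    (h₁ : ∀ a, G.obj a = p₁ (i'.obj a))
    (φ : ModMap i (u ≫ G) (fun x => p₀ (v.obj x)) (fun x => p₁ (v.obj x))) :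
    ∃ ψ : ModMap i' G p₀ p₁, (∀ f, ψ.f₁ (v.map f) = φ.f₁ f) ∧
      ∀ α, ψ.f₂ (v.map₂ α) = φ.f₂ α := by
  -- Precomposition does not change the target, so each target `x` is treated separately: in `A'`
  -- the map is forced to be `G`, and outside it is an extension to an induced module.
  have key : ∀ x, ∃ ψ : HomMap i' G p₀ x (p₁ x),
      (∀ f, B'.tgt (v.map f) = x → ψ.f₁ (v.map f) = φ.f₁ f) ∧
      (∀ α, B'.tgt (B'.dom (v.map₂ α)) = x → ψ.f₂ (v.map₂ α) = φ.f₂ α) ∧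
      (∀ k, B'.tgt (i'.map k) = x → ψ.f₁ (i'.map k) = G.map k) ∧
      (∀ κ, B'.tgt (B'.dom (i'.map₂ κ)) = x → ψ.f₂ (i'.map₂ κ) = G.map₂ κ) := by
    intro x
    obtain ⟨a, rfl⟩ | ⟨c, hc, rfl⟩ := P.obj_cases x
    · rw [← h₁]
      refine ⟨homMapOfSieve P.sieve' G p₀ h₀ a, fun f hf => ?_, fun α hα => ?_,
        fun k _ => homMapOfSieve_map .., fun k _ => homMapOfSieve_map₂ ..⟩
      · obtain ⟨k, rfl⟩ := P.sieve.surj₁ f (by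
          rw [← P.chi_obj, ← v.tgt_map, hf, P.sieve'.obj_eq])
        rw [P.comm₁, homMapOfSieve_map, φ.map]
        rfl
      · obtain ⟨k, rfl⟩ := P.sieve.surj₂ α (by
          rw [← P.chi_obj, ← v.tgt_map, ← v.dom_map₂, hα, P.sieve'.obj_eq])
        rw [P.comm₂, homMapOfSieve_map₂, φ.map₂]
        rfl
    · obtain ⟨ψ, ψ₁, ψ₂⟩ := (φ.toHomMap c).exists_extend P hc h₀
      have hc' : χ'.obj (v.obj c) ≠ endpt 0 := by rwa [P.chi_obj]
      refine ⟨ψ, fun f hf => ψ₁ f ?_, fun α hα => ψ₂ α ?_, fun k hk => ?_, fun k hk => ?_⟩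
      · exact (P.inj₀ hc (by rw [← v.tgt_map, hf])).symm
      · exact (P.inj₀ hc (by rw [← v.tgt_map, ← v.dom_map₂, hα])).symm
      · exact absurd (by rw [← hk, P.sieve'.tgt_map]) hc'
      · exact absurd (by rw [← hk, P.sieve'.tgt_dom_map₂]) hc'
  choose ψ ψ₁ ψ₂ ψ₃ ψ₄ using key
  have e₁ : ∀ {f x}, B'.tgt f = x → (ψ (B'.tgt f)).f₁ f = (ψ x).f₁ f := by rintro f _ rfl; rfl
  have e₂ : ∀ {f x}, B'.tgt (B'.dom f) = x →
    (ψ (B'.tgt (B'.dom f))).f₂ f = (ψ x).f₂ f := by rintro f _ rfl; rfl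
  exact ⟨
    { f₁ := fun f => (ψ (B'.tgt f)).f₁ f
      f₂ := fun α => (ψ (B'.tgt (B'.dom α))).f₂ α
      src := fun f => (ψ _).src f rfl
      tgt := fun f => (ψ _).tgt f rfl
      dom := fun α => (ψ _).dom α rfl
      cod := fun α => ((ψ _).cod α rfl).trans (e₁ (B'.tgt_cod α)).symm
      two := fun f => (e₂ (by rw [B'.dom_two])).trans ((ψ _).two f rfl)
      vc := fun β α h => by
        rw [e₂ tgt_dom_vc, (ψ _).vc β α rfl h,
          e₂ (f := α) (x := B'.tgt (B'.dom β)) (by rw [h, B'.tgt_cod])]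
      act₁ := fun f k h => (e₁ tgt_cmp).trans ((ψ _).act₁ f k rfl h)
      act₂ := fun f k h => (e₂ tgt_dom_hc).trans ((ψ _).act₂ f k rfl h)
      map := fun k => ψ₃ _ k rfl
      map₂ := fun k => ψ₄ _ k rfl }, fun f => ψ₁ _ f rfl, fun α => ψ₂ _ α rfl⟩

end ModMap

/-- The 2-category with the same objects as `D`, whose 1-cells are the 2-cells of `D`, composed
horizontally, and with a unique 2-cell between any two parallel 1-cells. -/
noncomputable abbrev horizontal (D : TwoCat.{w}) : TwoCat.{w} where
  Obj := D.Obj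
  One := D.Two
  -- With exactly one 2-cell between parallel 1-cells, the conditions that module maps must satisfy
  -- on 2-cells hold automatically.
  Two := {p : D.Two × D.Two // D.src (D.dom p.1) = D.src (D.dom p.2) ∧
    D.tgt (D.dom p.1) = D.tgt (D.dom p.2)}
  src α := D.src (D.dom α)
  tgt α := D.tgt (D.dom α)
  dom p := p.1.1
  cod p := p.1.2
  src_cod p := p.2.1.symm
  tgt_cod p := p.2.2.symm
  one x := D.two (D.one x)
  two α := ⟨(α, α), rfl, rfl⟩
  comp β α _ := D.hc β α
  vcomp q p h := ⟨(p.1.1, q.1.2), by rw [p.2.1, ← h, q.2.1], by rw [p.2.2, ← h, q.2.2]⟩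
  hcomp q p h := ⟨(D.hc q.1.1 p.1.1, D.hc q.1.2 p.1.2),
    by rw [src_dom_hc h, src_dom_hc (by rw [← q.2.1, ← p.2.2, h]), p.2.1],
    by rw [tgt_dom_hc, tgt_dom_hc, q.2.2]⟩
  src_one x := by rw [D.dom_two, D.src_one]
  tgt_one x := by rw [D.dom_two, D.tgt_one]
  src_comp _ _ h := src_dom_hc h
  tgt_comp _ _ _ := tgt_dom_hc
  one_comp _ := one_hc rfl
  comp_one _ := hc_one rfl
  comp_assoc _ _ _ h₁ h₂ := hc_assoc h₁ h₂
  dom_two _ := rfl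
  cod_two _ := rfl
  dom_vcomp _ _ _ := rfl
  cod_vcomp _ _ _ := rfl
  two_vcomp _ := rfl
  vcomp_two _ := rfl
  vcomp_assoc _ _ _ _ _ := rfl
  dom_hcomp _ _ _ := rfl
  cod_hcomp _ _ _ := rfl
  one_hcomp p := Subtype.ext (Prod.ext (one_hc rfl) (one_hc p.2.2))
  hcomp_one p := Subtype.ext (Prod.ext (hc_one rfl) (hc_one p.2.1))
  hcomp_assoc r q p h₁ h₂ := Subtype.ext (Prod.ext (hc_assoc h₁ h₂)
    (hc_assoc (by rw [← r.2.1, ← q.2.2, h₁]) (by rw [← q.2.1, ← p.2.2, h₂])))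
  hcomp_two _ _ _ := rfl
  interchange _ _ _ _ _ _ _ := rfl

section Horizontal

variable {C D : TwoCat.{w}}

theorem horizontal_two_ext {p q : (horizontal D).Two}
    (h₁ : (horizontal D).dom p = (horizontal D).dom q)
    (h₂ : (horizontal D).cod p = (horizontal D).cod q) : p = q :=
  Subtype.ext (Prod.ext h₁ h₂)

theorem horizontal_cmp {β α : D.Two} (h : D.src (D.dom β) = D.tgt (D.dom α)) :
    (horizontal D).cmp β α = D.hc β α :=
  (comp_eq (C := horizontal D) h).symm

/-- The 2-functor from `C` to `horizontal D` sending a 1-cell to the identity 2-cell of its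
image. -/
noncomputable def toHorizontal (G : C ⟶ D) : C ⟶ horizontal D :=
  have map_comp : ∀ g f h, D.two (G.map (C.comp g f h)) =
      D.hc (D.two (G.map g)) (D.two (G.map f)) := fun g f h => by
    rw [hc_two (by rw [G.src_map, G.tgt_map, h]), comp_eq h, G.map_cmp h]
  { obj := G.obj
    map := fun k => D.two (G.map k)
    map₂ := fun κ => ⟨(D.two (G.map (C.dom κ)), D.two (G.map (C.cod κ))), by simp, by simp⟩
    src_map := fun f => by change D.src (D.dom _) = _; rw [D.dom_two, G.src_map]
    tgt_map := fun f => by change D.tgt (D.dom _) = _; rw [D.dom_two, G.tgt_map]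
    dom_map₂ := fun _ => rfl
    cod_map₂ := fun _ => rfl
    map_one := fun x => by rw [G.map_one]
    map_comp := map_comp
    map₂_two := fun f => Subtype.ext (Prod.ext
      (congrArg (fun x => D.two (G.map x)) (C.dom_two f))
      (congrArg (fun x => D.two (G.map x)) (C.cod_two f)))
    map₂_vcomp := fun β α h => Subtype.ext (Prod.ext
      (congrArg (fun x => D.two (G.map x)) (C.dom_vcomp β α h))
      (congrArg (fun x => D.two (G.map x)) (C.cod_vcomp β α h)))
    map₂_hcomp := fun β α h => Subtype.ext (Prod.ext
      ((congrArg (fun x => D.two (G.map x)) (C.dom_hcomp β α h)).trans (map_comp _ _ h))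
      ((congrArg (fun x => D.two (G.map x)) (C.cod_hcomp β α h)).trans (map_comp _ _ _))) }

open Classical in
/-- The 2-cell of `horizontal D` between two parallel 1-cells. -/
noncomputable def horizontalTwo (α β : D.Two) : (horizontal D).Two :=
  if h : D.src (D.dom α) = D.src (D.dom β) ∧ D.tgt (D.dom α) = D.tgt (D.dom β) then ⟨(α, β), h⟩
  else ⟨(α, α), rfl, rfl⟩

theorem dom_horizontalTwo (α β : D.Two) : (horizontal D).dom (horizontalTwo α β) = α := by
  unfold horizontalTwo; split_ifs <;> rfl

theorem cod_horizontalTwo {α β : D.Two} (h : D.src (D.dom α) = D.src (D.dom β))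
    (h' : D.tgt (D.dom α) = D.tgt (D.dom β)) :
    (horizontal D).cod (horizontalTwo α β) = β := by
  unfold horizontalTwo; rw [dif_pos ⟨h, h'⟩]

variable {A B : TwoCat.{w}} {j : A ⟶ B} {G : A ⟶ D} {F : A ⟶ horizontal D}
  (hF : ∀ k, F.map k = D.two (G.map k)) {o : B.Obj → D.Obj}
include hF

/-- A map of modules to `horizontal D` is determined by its values on 1-cells. -/
noncomputable def horizontalHomMap (t : B.One → D.Two) (c : B.Obj) (z : D.Obj)
    (src : ∀ f, B.tgt f = c → D.src (D.dom (t f)) = o (B.src f))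
    (tgt : ∀ f, B.tgt f = c → D.tgt (D.dom (t f)) = z)
    (ho : ∀ a, G.obj a = o (j.obj a))
    (act : ∀ f k, B.tgt f = c → B.src f = B.tgt (j.map k) →
      t (B.cmp f (j.map k)) = D.hc (t f) (D.two (G.map k))) :
    HomMap (W := horizontal D) j F o c z :=
  have cod : ∀ α, B.tgt (B.dom α) = c →
      (horizontal D).cod (horizontalTwo (t (B.dom α)) (t (B.cod α))) = t (B.cod α) := fun α h => by
    have h' : B.tgt (B.cod α) = c := by rw [B.tgt_cod, h]
    exact cod_horizontalTwo (by rw [src _ h, src _ h', B.src_cod]) (by rw [tgt _ h, tgt _ h'])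
  have cmp : ∀ f k, B.tgt f = c → B.src f = B.tgt (j.map k) →
      t (B.cmp f (j.map k)) = (horizontal D).cmp (t f) (F.map k) := fun f k h h' => by
    rw [hF, horizontal_cmp, act f k h h']
    rw [src f h, h', D.dom_two, G.tgt_map, ho, j.tgt_map]
  { f₁ := t
    f₂ := fun α => horizontalTwo (t (B.dom α)) (t (B.cod α))
    src := src
    tgt := tgt
    dom := fun α _ => dom_horizontalTwo _ _
    cod := cod
    two := fun f h => by
      refine horizontal_two_ext ?_ ?_
      · rw [dom_horizontalTwo, B.dom_two, (horizontal D).dom_two]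
      · rw [cod _ (by rw [B.dom_two, h]), B.cod_two, (horizontal D).cod_two]
    vc := fun β α h hβα => by
      have hα : B.tgt (B.dom α) = c := by rw [← h, hβα, B.tgt_cod]
      refine horizontal_two_ext ?_ ?_
      · rw [dom_horizontalTwo, dom_vc hβα, dom_vc (C := horizontal D), dom_horizontalTwo]
        rw [dom_horizontalTwo, cod _ hα, hβα]
      · rw [cod _ (by rw [tgt_dom_vc, h]), cod_vc, cod_vc (C := horizontal D), cod _ h]
    act₁ := cmp
    act₂ := fun α k h hk => by
      have hd : B.src (B.dom α) = B.tgt (j.map (A.dom k)) := by rw [hk, j.dom_map₂]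
      have hc : B.src (B.cod α) = B.tgt (j.map (A.cod k)) := by
        rw [B.src_cod, hk, ← j.cod_map₂, B.tgt_cod]
      have h' : B.tgt (B.cod α) = c := by rw [B.tgt_cod, h]
      have x : (horizontal D).src ((horizontal D).dom
          (horizontalTwo (t (B.dom α)) (t (B.cod α)))) =
          (horizontal D).tgt ((horizontal D).dom (F.map₂ k)) := by
        rw [dom_horizontalTwo, F.dom_map₂, hF]
        change D.src (D.dom _) = D.tgt (D.dom (D.two _))
        rw [D.dom_two, G.tgt_map, src _ h, hd, j.tgt_map, ho]
      refine horizontal_two_ext ?_ ?_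
      · rw [dom_hc x, dom_horizontalTwo, dom_horizontalTwo, dom_hc hk, j.dom_map₂, cmp _ _ h hd, F.dom_map₂]
      · rw [cod_hc x, cod _ (by rw [tgt_dom_hc, h]), cod _ h, cod_hc hk, j.cod_map₂, cmp _ _ h' hc, F.cod_map₂] }

/-- A map of modules to `horizontal D` is determined by its values on 1-cells. -/
noncomputable def horizontalModMap (o₀ o₁ : B.Obj → D.Obj) (t : B.One → D.Two)
    (src : ∀ f, D.src (D.dom (t f)) = o₀ (B.src f))
    (tgt : ∀ f, D.tgt (D.dom (t f)) = o₁ (B.tgt f))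
    (ho : ∀ a, G.obj a = o₀ (j.obj a))
    (act : ∀ f k, B.src f = B.tgt (j.map k) →
      t (B.cmp f (j.map k)) = D.hc (t f) (D.two (G.map k)))
    (map : ∀ k, t (j.map k) = D.two (G.map k)) :
    ModMap (W := horizontal D) j F o₀ o₁ :=
  let φ (c : B.Obj) := horizontalHomMap hF (o := o₀) t c (o₁ c) (fun f _ => src f)
    (fun f h => by rw [tgt, h]) ho (fun f k _ h => act f k h)
  { f₁ := t
    f₂ := fun α => horizontalTwo (t (B.dom α)) (t (B.cod α))
    src := src
    tgt := tgt
    dom := fun α => (φ _).dom α rfl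
    cod := fun α => (φ _).cod α rfl
    two := fun f => (φ _).two f rfl
    vc := fun β α h => (φ _).vc β α rfl h
    act₁ := fun f k h => (φ _).act₁ f k rfl h
    act₂ := fun f k h => (φ _).act₂ f k rfl h
    map := fun k => by rw [map, hF]
    map₂ := fun κ => by
      have e : t (B.dom (j.map₂ κ)) = D.two (G.map (A.dom κ)) := by rw [j.dom_map₂, map]
      have e' : t (B.cod (j.map₂ κ)) = D.two (G.map (A.cod κ)) := by rw [j.cod_map₂, map]
      refine horizontal_two_ext ?_ ?_
      · rw [dom_horizontalTwo, e, F.dom_map₂, hF]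
      · exact ((φ _).cod (j.map₂ κ) rfl).trans (e'.trans (by rw [F.cod_map₂, hF])) }

end Horizontal

end TwoCat

/-! ### Extension of the constraints -/

namespace TwoCat

namespace Cyl

variable {A B A' B' D : TwoCat.{w}} {u : A ⟶ A'} {i : A ⟶ B} {i' : A' ⟶ B'} {v : B ⟶ B'}
  {χ : B ⟶ interval.{w}} {χ' : B' ⟶ interval.{w}} {G : A' ⟶ D} {K : Cyl B D}
  {o : interval.{w}.Obj → B'.Obj → D.Obj}

/-- The map of modules given by the cells of a linear cylinder over a fixed 1-cell of `Δ₁`. -/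
noncomputable def IsLinear.modMap (l : IsLinear i (u ≫ G) K)
    (ho : ∀ j x, o j (v.obj x) = K.obj j x) (ε : interval.{w}.One) :
    ModMap i (u ≫ G) (fun x => o (interval.src ε) (v.obj x))
      (fun x => o (interval.tgt ε) (v.obj x)) where
  f₁ := K.map ε
  f₂ := K.map₂ ε
  src f := by rw [K.src_map, ho]
  tgt f := by rw [K.tgt_map, ho]
  dom := K.dom_map₂ ε
  cod := K.cod_map₂ ε
  two := K.map₂_two ε
  vc := K.map₂_vc ε
  act₁ := l.map_cmp ε
  act₂ := l.map₂_hc ε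
  map := l.map ε
  map₂ := l.map₂ ε

/-- The constraints with a fixed second component in `Δ₁ × B` extend to the pushout. -/
theorem IsLinear.exists_con_one (P : SievePushout u i i' v χ χ') (l : IsLinear i (u ≫ G) K)
    (ho : ∀ j x, o j (v.obj x) = K.obj j x) (ho' : ∀ j a, G.obj a = o j (i'.obj a))
    {ε η : interval.{w}.One} (h : interval.src ε = interval.tgt η) :
    ∃ E : B'.One → D.Two, (∀ g, D.src (D.dom (E g)) = o (interval.src η) (B'.src g)) ∧
      (∀ g, E (v.map g) = K.con ε η g (B.one (B.src g))) ∧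
      (∀ k, E (i'.map k) = D.two (G.map k)) ∧
      ∀ g k, B'.src g = B'.tgt (i'.map k) →
        E (B'.cmp g (i'.map k)) = D.hc (E g) (D.two (G.map k)) := by
  have dom : ∀ g, D.dom (K.con ε η g (B.one (B.src g))) = K.map (interval.cmp ε η) g := fun g => by
    rw [K.dom_con _ _ _ _ h (B.tgt_one _).symm, cmp_one rfl]
  -- Linearity in `g` of the constraint at `(ε, g)` and `(η, 1)` is `con_one_cmp`.
  let φ : ModMap (W := horizontal D) i (u ≫ toHorizontal G)
      (fun x => o (interval.src η) (v.obj x)) (fun x => o (interval.tgt ε) (v.obj x)) :=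
    horizontalModMap (F := u ≫ toHorizontal G) (fun _ => rfl) (G := u ≫ G) (fun x => o (interval.src η) (v.obj x))
      (fun x => o (interval.tgt ε) (v.obj x)) (fun g => K.con ε η g (B.one (B.src g)))
      (fun g => by rw [dom, K.src_map, src_cmp h, ho])
      (fun g => by rw [dom, K.tgt_map, tgt_cmp, ho])
      (fun a => by rw [ho, l.obj])
      (fun g k hgk => by rw [src_cmp hgk, l.con_one_cmp _ _ _ _ h hgk])
      (fun k => by
        rw [i.src_map, ← i.map_one, l.con _ _ _ _ h (A.tgt_one _).symm, cmp_one rfl])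
  obtain ⟨ψ, hψ, -⟩ := ModMap.exists_extend (G := toHorizontal G) P (ho' _) (ho' _) φ
  refine ⟨ψ.f₁, ψ.src, hψ, ψ.map, fun g k hgk => (ψ.act₁ g k hgk).trans (horizontal_cmp ?_)⟩
  refine (ψ.src g).trans ?_
  change _ = D.tgt (D.dom (D.two (G.map k)))
  rw [D.dom_two, G.tgt_map, ho' (interval.src η), ← i'.tgt_map, hgk]

/-- The constraints with a fixed first component in `Δ₁ × B` extend to the pushout. -/
theorem IsLinear.exists_con_right (P : SievePushout u i i' v χ χ') (l : IsLinear i (u ≫ G) K)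
    (ho : ∀ j x, o j (v.obj x) = K.obj j x) (ho' : ∀ j a, G.obj a = o j (i'.obj a))
    {ε η : interval.{w}.One} (h : interval.src ε = interval.tgt η) (g : B.One)
    (hg : χ.obj (B.src g) ≠ endpt 0) :
    ∃ T : B'.One → D.Two, (∀ f, B.src g = B.tgt f → T (v.map f) = K.con ε η g f) ∧
      ∀ f k, B'.src (v.map g) = B'.tgt f → B'.src f = B'.tgt (i'.map k) →
        T (B'.cmp f (i'.map k)) = D.hc (T f) (D.two (G.map k)) := by
  -- With `g` fixed, linearity in `f` of the constraint is `con_cmp`.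
  let φ : HomMap (W := horizontal D) i (u ≫ toHorizontal G)
      (fun x => o (interval.src η) (v.obj x)) (B.src g) (o (interval.tgt ε) (v.obj (B.tgt g))) :=
    horizontalHomMap (F := u ≫ toHorizontal G) (fun _ => rfl) (G := u ≫ G) (o := fun x => o (interval.src η) (v.obj x))
      (fun f => K.con ε η g f) _ (o (interval.tgt ε) (v.obj (B.tgt g)))
      (fun f hf => by rw [K.dom_con _ _ _ _ h hf.symm, K.src_map, src_cmp h, src_cmp hf.symm, ho])
      (fun f hf => by rw [K.dom_con _ _ _ _ h hf.symm, K.tgt_map, tgt_cmp, tgt_cmp, ho])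
      (fun a => by rw [ho, l.obj])
      (fun f k hf hfk => l.con_cmp _ _ _ _ _ h hf.symm hfk)
  obtain ⟨ψ, hψ, -⟩ := φ.exists_extend P hg (ho' _)
  refine ⟨ψ.f₁, fun f hf => hψ f hf.symm, fun f k hf hfk => ?_⟩
  have hf' : B'.tgt f = v.obj (B.src g) := by rw [← hf, v.src_map]
  refine (ψ.act₁ f k hf' hfk).trans (horizontal_cmp ?_)
  refine (ψ.src f hf').trans ?_
  change _ = D.tgt (D.dom (D.two (G.map k)))
  rw [D.dom_two, G.tgt_map, ho' (interval.src η), ← i'.tgt_map, hfk]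

open Classical in
/-- The constraints of a linear cylinder extend to the pushout. -/
theorem IsLinear.exists_con (P : SievePushout u i i' v χ χ') (l : IsLinear i (u ≫ G) K)
    (ho : ∀ j x, o j (v.obj x) = K.obj j x) (ho' : ∀ j a, G.obj a = o j (i'.obj a))
    {ε η : interval.{w}.One} (h : interval.src ε = interval.tgt η) :
    ∃ C : B'.One → B'.One → D.Two,
      (∀ k m, A'.src k = A'.tgt m → C (i'.map k) (i'.map m) = D.two (G.map (A'.cmp k m))) ∧
      (∀ g f, B.src g = B.tgt f → C (v.map g) (v.map f) = K.con ε η g f) ∧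
      (∀ g f k, B'.src g = B'.tgt f → B'.src f = B'.tgt (i'.map k) →
        C g (B'.cmp f (i'.map k)) = D.hc (C g f) (D.two (G.map k))) ∧
      ∀ g k m, B'.src g = B'.tgt (i'.map k) → A'.src k = A'.tgt m →
        C (B'.cmp g (i'.map k)) (i'.map m) = C g (i'.map (A'.cmp k m)) := by
  obtain ⟨E, E_src, E_v, E_i, E_act⟩ := l.exists_con_one P ho ho' h
  have hT : ∀ g, ∃ T : B'.One → D.Two, χ.obj (B.src g) ≠ endpt 0 →
      (∀ f, B.src g = B.tgt f → T (v.map f) = K.con ε η g f) ∧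
      ∀ f k, B'.src (v.map g) = B'.tgt f → B'.src f = B'.tgt (i'.map k) →
        T (B'.cmp f (i'.map k)) = D.hc (T f) (D.two (G.map k)) := fun g => by
    by_cases hg : χ.obj (B.src g) = endpt 0
    · exact ⟨E, fun h => absurd hg h⟩
    · obtain ⟨T, hT⟩ := l.exists_con_right P ho ho' h g hg
      exact ⟨T, fun _ => hT⟩
  choose T hT using hT
  -- A composable `g` with source outside `A'` comes from a unique 1-cell of `B`. If its source is
  -- in `A'`, then `f` lies in `A'`, `E f` is the identity of its image under `G`, and the formula
  -- is the one forced by `con_map`.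
  let C : B'.One → B'.One → D.Two := fun g f =>
    if h : ∃ b, χ.obj (B.src b) ≠ endpt 0 ∧ v.map b = g then T h.choose f else D.hc (E g) (E f)
  have C_v : ∀ b, χ.obj (B.src b) ≠ endpt 0 → C (v.map b) = T b := fun b hb => by
    have h : ∃ b', χ.obj (B.src b') ≠ endpt 0 ∧ v.map b' = v.map b := ⟨b, hb, rfl⟩
    funext f
    refine (dif_pos h).trans ?_
    rw [P.inj₁ h.choose_spec.1 h.choose_spec.2]
  have C_i : ∀ g f, χ'.obj (B'.src g) = endpt 0 → C g f = D.hc (E g) (E f) := fun g f hg => by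
    refine dif_neg ?_
    rintro ⟨b, hb, rfl⟩
    exact hb (by rw [← P.chi_obj, ← v.src_map, hg])
  have hi : ∀ g k, B'.src g = B'.tgt (i'.map k) → χ'.obj (B'.src g) = endpt 0 := fun g k hgk => by
    rw [hgk, P.sieve'.tgt_map]
  have E_src_i : ∀ g k, B'.src g = B'.tgt (i'.map k) → D.src (D.dom (E g)) = D.tgt (G.map k) :=
    fun g k hgk => by rw [E_src, hgk, i'.tgt_map, ← ho', G.tgt_map]
  have E_hc : ∀ g k m, B'.src g = B'.tgt (i'.map k) → A'.src k = A'.tgt m →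
      D.hc (D.hc (E g) (D.two (G.map k))) (D.two (G.map m)) =
        D.hc (E g) (D.two (G.map (A'.cmp k m))) := fun g k m hgk hkm => by
    have e : D.src (G.map k) = D.tgt (G.map m) := by rw [G.src_map, G.tgt_map, hkm]
    rw [hc_assoc (by rw [D.dom_two, E_src_i g k hgk]) (by rw [D.dom_two, D.dom_two, e]), hc_two e,
      G.map_cmp hkm]
  refine ⟨C, fun k m hkm => ?_, fun g f hgf => ?_, fun g f k hgf hfk => ?_,
    fun g k m hgk hkm => ?_⟩
  · rw [C_i _ _ (by rw [i'.src_map, P.sieve'.obj_eq]), E_i, E_i,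
      hc_two (by rw [G.src_map, G.tgt_map, hkm]), G.map_cmp hkm]
  · by_cases hg : χ.obj (B.src g) = endpt 0
    · obtain ⟨m, rfl⟩ := P.sieve.surj₁ f (by rw [← hgf, hg])
      rw [C_i _ _ (by rw [v.src_map, P.chi_obj, hg]), E_v, P.comm₁, E_i, l.con_map _ _ _ _ h hgf]
      rfl
    · rw [C_v g hg]
      exact (hT g hg).1 f hgf
  · by_cases hg : χ'.obj (B'.src g) = endpt 0
    · obtain ⟨m, rfl⟩ := P.exists_map_of_src hgf hg
      rw [C_i _ _ hg, C_i _ _ hg, E_act _ _ hfk, E_i, hc_assoc]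
      · rw [D.dom_two, E_src_i _ _ hgf]
      · rw [D.dom_two, D.dom_two, G.src_map, G.tgt_map, P.composable_of_map hfk]
    · obtain ⟨m, rfl⟩ | ⟨b, hb, rfl⟩ | ⟨b, m, -, -, hbm, rfl⟩ := P.one_cases g
      · exact absurd (by rw [i'.src_map, P.sieve'.obj_eq]) hg
      · rw [C_v b hb]
        exact (hT b hb).2 f k hgf hfk
      · exact absurd (by rw [src_cmp hbm, i'.src_map, P.sieve'.obj_eq]) hg
  · rw [C_i _ _ (by rw [src_cmp hgk, i'.src_map, P.sieve'.obj_eq]), C_i _ _ (hi g k hgk),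
      E_act _ _ hgk, E_i, E_i, E_hc g k m hgk hkm]

end Cyl

end TwoCat

/-! ### Extension of linear cylinders -/

namespace TwoCat

namespace Cyl

variable {A B A' B' D : TwoCat.{w}} {u : A ⟶ A'} {i : A ⟶ B} {i' : A' ⟶ B'} {v : B ⟶ B'}
  {χ : B ⟶ interval.{w}} {χ' : B' ⟶ interval.{w}} {G : A' ⟶ D} {K : Cyl B D}
  {o : interval.{w}.Obj → B'.Obj → D.Obj}

/-- A linear cylinder extends along the pushout of a sieve. -/
theorem IsLinear.exists_extend (P : SievePushout u i i' v χ χ') (l : IsLinear i (u ≫ G) K)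
    (ho : ∀ j x, o j (v.obj x) = K.obj j x) (ho' : ∀ j a, G.obj a = o j (i'.obj a)) :
    ∃ c : Cyl B' D, IsLinear i' G c ∧ Agree v K c := by
  -- Over each `ε` separately, the 1-cells and 2-cells of the cylinder form a module map. Only the
  -- constraints relate different `ε`.
  choose M M₁ M₂ using fun ε => ModMap.exists_extend P (ho' (interval.src ε))
    (ho' (interval.tgt ε)) (l.modMap ho ε)
  change ∀ ε f, (M ε).f₁ (v.map f) = K.map ε f at M₁
  change ∀ ε α, (M ε).f₂ (v.map₂ α) = K.map₂ ε α at M₂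
  have hC : ∀ ε η, ∃ C : B'.One → B'.One → D.Two, interval.src ε = interval.tgt η → _ :=
    fun ε η => by
      by_cases h : interval.src ε = interval.tgt η
      · obtain ⟨C, hC⟩ := l.exists_con P ho ho' h
        exact ⟨C, fun _ => hC⟩
      · exact ⟨fun f _ => D.two ((M ε).f₁ f), fun h' => absurd h' h⟩
  choose C hC using hC
  have C_i := fun ε η h => (hC ε η h).1
  have C_v := fun ε η h => (hC ε η h).2.1
  have C_cmp := fun ε η h => (hC ε η h).2.2.1
  have cmp_C := fun ε η h => (hC ε η h).2.2.2
  clear hC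
  have G_cmp : ∀ k m, A'.src k = A'.tgt m → D.src (G.map k) = D.tgt (G.map m) :=
    fun k m h => by rw [G.src_map, G.tgt_map, h]
  have M_i : ∀ ε f k, B'.src f = B'.tgt (i'.map k) → D.src ((M ε).f₁ f) = D.tgt (G.map k) :=
    fun ε f k h => by rw [(M ε).src, h, i'.tgt_map, G.tgt_map, ho']
  have M_src : ∀ ε η g f, interval.src ε = interval.tgt η → B'.src g = B'.tgt f →
      D.src ((M ε).f₁ g) = D.tgt ((M η).f₁ f) :=
    fun ε η g f h h' => by rw [(M ε).src, (M η).tgt, h, h']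
  have C_dc : ∀ ε η, interval.src ε = interval.tgt η → ∀ g f, B'.src g = B'.tgt f →
      D.dom (C ε η g f) = (M (interval.cmp ε η)).f₁ (B'.cmp g f) ∧
        D.cod (C ε η g f) = D.cmp ((M ε).f₁ g) ((M η).f₁ f) := by
    intro ε η h
    refine P.pair_induction (fun k m hkm => ?_) (fun g f hgf => ?_) (fun g f k hgf hfk e => ?_)
      (fun g k m hgk hkm e => ?_)
    · rw [C_i _ _ h _ _ hkm, D.dom_two, D.cod_two, ← i'.map_cmp hkm, (M _).map, (M _).map,
        (M _).map, G.map_cmp hkm]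
      exact ⟨rfl, rfl⟩
    · rw [C_v _ _ h _ _ hgf, K.dom_con _ _ _ _ h hgf, K.cod_con _ _ _ _ h hgf, ← v.map_cmp hgf,
        M₁, M₁, M₁]
      exact ⟨rfl, rfl⟩
    · have hgfk : B'.src (B'.cmp g f) = B'.tgt (i'.map k) := by rw [src_cmp hgf, hfk]
      have x : D.src (D.dom (C ε η g f)) = D.tgt (D.dom (D.two (G.map k))) := by
        rw [D.dom_two, e.1, M_i _ _ _ hgfk]
      rw [C_cmp _ _ h _ _ _ hgf hfk, dom_hc x, cod_hc x, e.1, e.2, D.dom_two, D.cod_two,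
        ← cmp_assoc hgf hfk, (M _).act₁ _ _ hgfk, (M _).act₁ _ _ hfk,
        cmp_assoc (M_src _ _ _ _ h hgf) (M_i _ _ _ hfk)]
      exact ⟨rfl, rfl⟩
    · have hi : B'.src (i'.map k) = B'.tgt (i'.map m) := by rw [i'.src_map, i'.tgt_map, hkm]
      rw [cmp_C _ _ h _ _ _ hgk hkm, e.1, e.2, i'.map_cmp hkm, cmp_assoc hgk hi,
        (M _).act₁ _ _ hgk, ← i'.map_cmp hkm, (M η).map, (M η).map,
        cmp_assoc (M_i _ _ _ hgk) (G_cmp _ _ hkm), G.map_cmp hkm]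
      exact ⟨rfl, rfl⟩
  have C_dom := fun ε η h g f h' => (C_dc ε η h g f h').1
  have C_cod := fun ε η h g f h' => (C_dc ε η h g f h').2
  have C_right : ∀ ε η, interval.src ε = interval.tgt η → ∀ g f k, B'.src g = B'.tgt f →
      B'.src f = B'.tgt (i'.map k) → D.src (D.dom (C ε η g f)) = D.tgt (G.map k) := by
    intro ε η h g f k hgf hfk
    rw [C_dom _ _ h _ _ hgf, M_i _ _ _ (by rw [src_cmp hgf, hfk])]
  have C_map : ∀ ε η, interval.src ε = interval.tgt η → ∀ g k, B'.src g = B'.tgt (i'.map k) →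
      C ε η g (i'.map k) = D.hc (C ε η g (B'.one (B'.src g))) (D.two (G.map k)) :=
    fun ε η h g k hgk => by
      rw [← C_cmp _ _ h _ _ _ (B'.tgt_one _).symm (by rw [B'.src_one, hgk]), one_cmp hgk]
  have C_left : ∀ η f, C (interval.one (interval.tgt η)) η (B'.one (B'.tgt f)) f =
      D.two ((M η).f₁ f) := by
    intro η f
    have h : interval.src (interval.one (interval.tgt η)) = interval.tgt η := interval.src_one _
    have hv : ∀ f, C (interval.one (interval.tgt η)) η (B'.one (B'.tgt (v.map f))) (v.map f) =
        D.two ((M η).f₁ (v.map f)) := fun f => by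
      rw [v.tgt_map, ← v.map_one, C_v _ _ h _ _ (B.src_one _), K.con_one_left, M₁]
    obtain ⟨k, rfl⟩ | ⟨g, -, rfl⟩ | ⟨g, k, -, -, hgk, rfl⟩ := P.one_cases f
    · rw [i'.tgt_map, ← i'.map_one, C_i _ _ h _ _ (A'.src_one _), one_cmp rfl, (M _).map]
    · exact hv g
    · rw [tgt_cmp, C_cmp _ _ h _ _ _ (B'.src_one _) hgk, hv, (M _).act₁ _ _ hgk,
        hc_two (M_i _ _ _ hgk)]
  have C_one : ∀ ε g, C ε (interval.one (interval.src ε)) g (B'.one (B'.src g)) =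
      D.two ((M ε).f₁ g) := by
    intro ε g
    have h : interval.src ε = interval.tgt (interval.one (interval.src ε)) :=
      (interval.tgt_one _).symm
    have hv : ∀ g, C ε (interval.one (interval.src ε)) (v.map g) (B'.one (B'.src (v.map g))) =
        D.two ((M ε).f₁ (v.map g)) := fun g => by
      rw [v.src_map, ← v.map_one, C_v _ _ h _ _ (B.tgt_one _).symm, K.con_one_right, M₁]
    obtain ⟨k, rfl⟩ | ⟨g, -, rfl⟩ | ⟨g, k, -, -, hgk, rfl⟩ := P.one_cases g
    · rw [i'.src_map, ← i'.map_one, C_i _ _ h _ _ (A'.tgt_one _).symm, cmp_one rfl, (M _).map]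
    · exact hv g
    · rw [src_cmp hgk, i'.src_map, ← i'.map_one, cmp_C _ _ h _ _ _ hgk (A'.tgt_one _).symm,
        cmp_one rfl, C_map _ _ h _ _ hgk, hv, (M _).act₁ _ _ hgk, hc_two (M_i _ _ _ hgk)]
  -- For triples in `B` this is the cocycle condition of `K`, and for triples in `A'` all
  -- constraints are identities. The other cases reduce to these by `C_cmp` and `cmp_C`.
  have cocycle : ∀ δ ε η, interval.src δ = interval.tgt ε → interval.src ε = interval.tgt η →
      ∀ k g f, B'.src k = B'.tgt g → B'.src g = B'.tgt f →
      D.vc (D.hc (D.two ((M δ).f₁ k)) (C ε η g f)) (C δ (interval.cmp ε η) k (B'.cmp g f)) =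
        D.vc (D.hc (C δ ε k g) (D.two ((M η).f₁ f)))
          (C (interval.cmp δ ε) η (B'.cmp k g) f) := by
    intro δ ε η h₁ h₂
    have h₃ : interval.src δ = interval.tgt (interval.cmp ε η) := by rw [tgt_cmp, h₁]
    have h₄ : interval.src (interval.cmp δ ε) = interval.tgt η := by rw [src_cmp h₁, h₂]
    refine P.triple_induction (fun a b c hab hbc => ?_) (fun k g f hkg hgf => ?_)
      (fun k g f a hkg hgf hfa e => ?_) (fun k g a b hkg hga hab e => ?_)
      (fun k a b c hka hab hbc e => ?_)
    · have habc : A'.src (A'.cmp a b) = A'.tgt c := by rw [src_cmp hab, hbc]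
      have habc' : A'.src a = A'.tgt (A'.cmp b c) := by rw [tgt_cmp, hab]
      rw [← i'.map_cmp hab, ← i'.map_cmp hbc, C_i _ _ h₂ _ _ hbc, C_i _ _ h₃ _ _ habc',
        C_i _ _ h₁ _ _ hab, C_i _ _ h₄ _ _ habc, (M _).map, (M _).map, hc_two (G_cmp _ _ habc'),
        hc_two (G_cmp _ _ habc), ← G.map_cmp habc', ← G.map_cmp habc, cmp_assoc hab hbc]
    · rw [← v.map_cmp hkg, ← v.map_cmp hgf, C_v _ _ h₂ _ _ hgf,
        C_v _ _ h₃ _ _ (by rw [tgt_cmp, hkg]), C_v _ _ h₁ _ _ hkg,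
        C_v _ _ h₄ _ _ (by rw [src_cmp hkg, hgf]), M₁, M₁, K.cocycle _ _ _ _ _ _ h₁ h₂ hkg hgf]
    · have hkgf : B'.src k = B'.tgt (B'.cmp g f) := by rw [tgt_cmp, hkg]
      have hkgf' : B'.src (B'.cmp k g) = B'.tgt f := by rw [src_cmp hkg, hgf]
      have hgfa : B'.src (B'.cmp g f) = B'.tgt (i'.map a) := by rw [src_cmp hgf, hfa]
      have x : D.src (D.dom (D.two ((M δ).f₁ k))) = D.tgt (D.dom (C ε η g f)) := by
        rw [D.dom_two, C_dom _ _ h₂ _ _ hgf, M_src _ _ _ _ h₃ hkgf]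
      have x' : D.src (D.dom (C δ ε k g)) = D.tgt (D.dom (D.two ((M η).f₁ f))) := by
        rw [D.dom_two, C_dom _ _ h₁ _ _ hkg, M_src _ _ _ _ h₄ hkgf']
      have y := C_right _ _ h₂ _ _ _ hgf hfa
      have y' := C_right _ _ h₃ _ _ _ hkgf hgfa
      have z := M_i η _ _ hfa
      have z' := C_right _ _ h₄ _ _ _ hkgf' hfa
      rw [C_cmp _ _ h₂ _ _ _ hgf hfa, ← cmp_assoc hgf hfa, C_cmp _ _ h₃ _ _ _ hkgf hgfa,
        C_cmp _ _ h₄ _ _ _ hkgf' hfa, (M _).act₁ _ _ hfa, ← hc_two z,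
        ← hc_assoc x (by rw [D.dom_two, y]),
        ← hc_assoc x' (by rw [D.dom_two, D.dom_two, z]), ← vc_hc_two _ y', e, vc_hc_two _ z']
      · rw [dom_hc x', D.dom_two, C_dom _ _ h₁ _ _ hkg, C_cod _ _ h₄ _ _ hkgf']
      · rw [dom_hc x, D.dom_two, C_dom _ _ h₂ _ _ hgf, C_cod _ _ h₃ _ _ hkgf]
    · have hi : B'.src (i'.map a) = B'.tgt (i'.map b) := by rw [i'.src_map, i'.tgt_map, hab]
      have hkga : B'.src (B'.cmp k g) = B'.tgt (i'.map a) := by rw [src_cmp hkg, hga]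
      have y := C_right _ _ h₁ _ _ _ hkg hga
      rw [cmp_C _ _ h₂ _ _ _ hga hab, cmp_assoc hga hi, ← i'.map_cmp hab, e,
        C_cmp _ _ h₁ _ _ _ hkg hga, ← cmp_assoc hkg hga, cmp_C _ _ h₄ _ _ _ hkga hab, (M η).map,
        (M η).map, G.map_cmp hab, ← hc_two (G_cmp _ _ hab),
        hc_assoc (by rw [D.dom_two, y]) (by rw [D.dom_two, D.dom_two, G_cmp _ _ hab])]
    · have habc : A'.src (A'.cmp a b) = A'.tgt c := by rw [src_cmp hab, hbc]
      have habc' : A'.src a = A'.tgt (A'.cmp b c) := by rw [tgt_cmp, hab]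
      have hi : B'.src (i'.map a) = B'.tgt (i'.map b) := by rw [i'.src_map, i'.tgt_map, hab]
      have z := M_i δ _ _ hka
      -- The hypothesis concerns `(k, ab, c)`; reading `cmp_C` backwards moves `a` into the first
      -- term.
      rw [C_i _ _ h₂ _ _ habc, ← i'.map_cmp habc, cmp_assoc hab hbc,
        ← cmp_C _ _ h₃ _ _ _ hka habc', ← cmp_C _ _ h₁ _ _ _ hka hab, i'.map_cmp hab,
        ← cmp_assoc hka hi] at e
      rw [← i'.map_cmp hbc, C_i _ _ h₂ _ _ hbc, (M _).act₁ _ _ hka, ← hc_two z,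
        hc_assoc (by rw [D.dom_two, D.dom_two, z])
          (by rw [D.dom_two, D.dom_two, G_cmp _ _ habc']),
        hc_two (G_cmp _ _ habc'), ← G.map_cmp habc', e]
  have nat : ∀ ε η, interval.src ε = interval.tgt η → ∀ β α,
      B'.src (B'.dom β) = B'.tgt (B'.dom α) →
      D.vc (C ε η (B'.cod β) (B'.cod α)) ((M (interval.cmp ε η)).f₂ (B'.hc β α)) =
        D.vc (D.hc ((M ε).f₂ β) ((M η).f₂ α)) (C ε η (B'.dom β) (B'.dom α)) := by
    intro ε η h
    have cod_comp : ∀ {β α}, B'.src (B'.dom β) = B'.tgt (B'.dom α) →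
        B'.src (B'.cod β) = B'.tgt (B'.cod α) := fun h => by rw [B'.src_cod, B'.tgt_cod, h]
    have M₂_comp : ∀ β α, B'.src (B'.dom β) = B'.tgt (B'.dom α) →
        D.src (D.dom ((M ε).f₂ β)) = D.tgt (D.dom ((M η).f₂ α)) := fun β α hβα => by
      rw [(M _).dom, (M _).dom, M_src _ _ _ _ h hβα]
    have M₂_i : ∀ ε α κ, B'.src (B'.dom α) = B'.tgt (B'.dom (i'.map₂ κ)) →
        D.src (D.dom ((M ε).f₂ α)) = D.tgt (D.dom (G.map₂ κ)) := fun ε α κ hα => by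
      rw [(M _).dom, M_i ε _ (A'.dom κ) (by rw [hα, i'.dom_map₂]), G.dom_map₂]
    refine P.pair_induction₂ (fun κ m hκm => ?_) (fun β α hβα => ?_)
      (fun β α κ hβα hακ e => ?_) (fun β κ m hβκ hκm e => ?_)
      (fun δ γ β α hδγ hβα hγα e e' => ?_)
    · have hκm' : A'.src (A'.cod κ) = A'.tgt (A'.cod m) := by rw [A'.src_cod, A'.tgt_cod, hκm]
      rw [i'.cod_map₂, i'.cod_map₂, i'.dom_map₂, i'.dom_map₂, C_i _ _ h _ _ hκm',
        C_i _ _ h _ _ hκm, ← i'.map₂_hc hκm, (M _).map₂, (M _).map₂, (M _).map₂, ← G.map₂_hc hκm,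
        two_vc, vc_two]
      · rw [G.dom_map₂, dom_hc hκm]
      · rw [G.cod_map₂, cod_hc hκm]
    · have hβα' : B.src (B.cod β) = B.tgt (B.cod α) := by rw [B.src_cod, B.tgt_cod, hβα]
      rw [v.cod_map₂, v.cod_map₂, v.dom_map₂, v.dom_map₂, C_v _ _ h _ _ hβα',
        C_v _ _ h _ _ hβα, ← v.map₂_hc hβα, M₂, M₂, M₂, K.naturality _ _ _ _ h hβα]
    · have hd : B'.src (B'.dom α) = B'.tgt (i'.map (A'.dom κ)) := by rw [hακ, i'.dom_map₂]
      have hc : B'.src (B'.cod α) = B'.tgt (i'.map (A'.cod κ)) := by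
        rw [cod_comp hακ, i'.cod_map₂]
      have hβα' := cod_comp hβα
      have hβακ : B'.src (B'.dom (B'.hc β α)) = B'.tgt (B'.dom (i'.map₂ κ)) := by
        rw [src_dom_hc hβα, hακ]
      have x := M₂_comp β α hβα
      have y := M₂_i η α κ hακ
      have y' := M₂_i (interval.cmp ε η) _ κ hβακ
      have z := C_right _ _ h _ _ _ hβα' hc
      have z' := C_right _ _ h _ _ _ hβα hd
      rw [cod_hc hακ, dom_hc hακ, i'.dom_map₂, i'.cod_map₂, C_cmp _ _ h _ _ _ hβα' hc,
        C_cmp _ _ h _ _ _ hβα hd, ← hc_assoc hβα hακ, (M _).act₂ _ _ hβακ, (M _).act₂ _ _ hακ,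
        ← hc_assoc x y, ← vc_hc_vc, ← vc_hc_vc, e, two_vc (G.cod_map₂ κ).symm,
        vc_two (G.dom_map₂ κ).symm]
      · rw [dom_hc x, (M _).dom, (M _).dom, C_cod _ _ h _ _ hβα]
      · rw [D.cod_two, G.dom_map₂]
      · rw [D.dom_two, z']
      · rw [(M _).cod, C_dom _ _ h _ _ hβα', cod_hc hβα]
      · rw [D.dom_two, G.cod_map₂]
      · exact y'
    · have hd : B'.src (B'.dom β) = B'.tgt (i'.map (A'.dom κ)) := by rw [hβκ, i'.dom_map₂]
      have hc : B'.src (B'.cod β) = B'.tgt (i'.map (A'.cod κ)) := by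
        rw [cod_comp hβκ, i'.cod_map₂]
      have hκm' : A'.src (A'.cod κ) = A'.tgt (A'.cod m) := by rw [A'.src_cod, A'.tgt_cod, hκm]
      have hi : B'.src (B'.dom (i'.map₂ κ)) = B'.tgt (B'.dom (i'.map₂ m)) := by
        rw [i'.dom_map₂, i'.dom_map₂, i'.src_map, i'.tgt_map, hκm]
      have hG : D.src (D.dom (G.map₂ κ)) = D.tgt (D.dom (G.map₂ m)) := by
        rw [G.dom_map₂, G.dom_map₂, G_cmp _ _ hκm]
      have y := M₂_i ε β κ hβκ
      rw [i'.cod_map₂, i'.dom_map₂, cod_hc hκm, dom_hc hκm, ← cmp_C _ _ h _ _ _ hc hκm',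
        ← cmp_C _ _ h _ _ _ hd hκm, (M η).map₂, G.map₂_hc hκm, i'.map₂_hc hκm] at e
      rw [cod_hc hβκ, dom_hc hβκ, i'.cod_map₂, i'.cod_map₂, i'.dom_map₂, i'.dom_map₂,
        hc_assoc hβκ hi, e, (M _).act₂ _ _ hβκ, (M η).map₂,
        hc_assoc y hG]
    · have hδβ : B'.src (B'.dom δ) = B'.tgt (B'.dom β) := by
        rw [hδγ, hβα, B'.src_cod, B'.tgt_cod, hγα]
      have hδβ' := cod_comp hδβ
      have hγα' := cod_comp hγα
      have x := M₂_comp δ β hδβ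
      have x' := M₂_comp γ α hγα
      have a₁ : D.dom (C ε η (B'.cod δ) (B'.cod β)) =
          D.cod ((M (interval.cmp ε η)).f₂ (B'.hc δ β)) := by
        rw [C_dom _ _ h _ _ hδβ', (M _).cod, cod_hc hδβ]
      have a₂ : B'.dom (B'.hc δ β) = B'.cod (B'.hc γ α) := by
        rw [dom_hc hδβ, cod_hc hγα, hδγ, hβα]
      have a₃ : D.dom ((M (interval.cmp ε η)).f₂ (B'.hc δ β)) =
          D.cod ((M (interval.cmp ε η)).f₂ (B'.hc γ α)) := by rw [(M _).dom, (M _).cod, a₂]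
      have a₄ : D.dom (D.hc ((M ε).f₂ δ) ((M η).f₂ β)) =
          D.cod (C ε η (B'.dom δ) (B'.dom β)) := by
        rw [dom_hc x, (M _).dom, (M _).dom, C_cod _ _ h _ _ hδβ]
      have a₅ : D.dom (D.hc ((M ε).f₂ γ) ((M η).f₂ α)) =
          D.cod (C ε η (B'.dom γ) (B'.dom α)) := by
        rw [dom_hc x', (M _).dom, (M _).dom, C_cod _ _ h _ _ hγα]
      have a₆ : D.dom (C ε η (B'.dom δ) (B'.dom β)) =
          D.cod ((M (interval.cmp ε η)).f₂ (B'.hc γ α)) := by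
        rw [C_dom _ _ h _ _ hδβ, (M _).cod, ← a₂, dom_hc hδβ]
      have a₇ : D.dom ((M ε).f₂ δ) = D.cod ((M ε).f₂ γ) := by rw [(M _).dom, (M _).cod, hδγ]
      have a₈ : D.dom ((M η).f₂ β) = D.cod ((M η).f₂ α) := by rw [(M _).dom, (M _).cod, hβα]
      have a₉ : D.dom (D.hc ((M ε).f₂ δ) ((M η).f₂ β)) =
          D.cod (D.hc ((M ε).f₂ γ) ((M η).f₂ α)) := by rw [dom_hc x, cod_hc x', a₇, a₈]
      -- The naturality squares of `(δ, β)` and of `(γ, α)` are pasted vertically by interchange.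
      rw [cod_vc, cod_vc, dom_vc hδγ, dom_vc hβα, vc_hc_vc hδγ hβα hγα, (M _).vc _ _ a₂,
        (M _).vc _ _ hδγ, (M _).vc _ _ hβα, ← vc_assoc a₁ a₃, e, vc_assoc a₄ a₆, hδγ, hβα, e',
        ← vc_assoc a₉ a₅, vc_hc_vc a₇ a₈ x']
  refine ⟨
    { obj := o
      map := fun ε => (M ε).f₁
      map₂ := fun ε => (M ε).f₂
      con := C
      src_map := fun ε => (M ε).src
      tgt_map := fun ε => (M ε).tgt
      dom_map₂ := fun ε => (M ε).dom
      cod_map₂ := fun ε => (M ε).cod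
      dom_con := fun ε η g f h h' => C_dom ε η h g f h'
      cod_con := fun ε η g f h h' => C_cod ε η h g f h'
      map_one := fun j x => ?_
      con_one_left := C_left
      con_one_right := C_one
      cocycle := fun δ ε η k g f h₁ h₂ h₃ h₄ => cocycle δ ε η h₁ h₂ k g f h₃ h₄
      map₂_vc := fun ε => (M ε).vc
      map₂_two := fun ε => (M ε).two
      naturality := fun ε η β α h h' => nat ε η h β α h' },
    { obj := fun j a => (ho' j a).symm
      map := fun ε => (M ε).map
      map₂ := fun ε => (M ε).map₂
      con := fun ε η g f h h' => C_i ε η h g f h'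
      map_cmp := fun ε => (M ε).act₁
      con_one := fun ε g k h => ?_ },
    { obj := ho
      map := M₁
      map₂ := M₂
      con := fun ε η g f h h' => C_v ε η h g f h' }⟩
  · obtain ⟨a, rfl⟩ | ⟨b, -, rfl⟩ := P.obj_cases x
    · rw [← i'.map_one, (M _).map, G.map_one, ho']
    · rw [← v.map_one, M₁, K.map_one, ho]
  · change C ε _ g (i'.map k) = D.two ((M ε).f₁ (B'.cmp g (i'.map k)))
    rw [C_map _ _ (interval.tgt_one _).symm _ _ h, C_one, (M _).act₁ _ _ h,
      hc_two (M_i _ _ _ h)]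

end Cyl

end TwoCat

/-! ### Strong oplax deformation retracts under pushout -/

namespace TwoCat

namespace Cyl

variable {A A' B B' D E : TwoCat.{w}} {u : A ⟶ A'} {i : A ⟶ B} {i' : A' ⟶ B'} {v : B ⟶ B'}
  {χ : B ⟶ interval.{w}} {χ' : B' ⟶ interval.{w}}

theorem Agree.toOplax_eq {c c' : Cyl B D} (a : Agree (𝟙 B) c c') : c'.toOplax = c.toOplax :=
  oplaxFunctor_ext (fun _ => a.obj _ _) (fun _ => a.map _ _) (fun _ => a.map₂ _ _)
    (fun _ _ h => a.con _ _ _ _ (Prod.ext_iff.1 h).1 (Prod.ext_iff.1 h).2)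

theorem Agree.postcomp_freeze {c : Cyl B D} {F : B ⟶ D} {j : interval.{w}.Obj} (G : D ⟶ E)
    (a : Agree (𝟙 B) (ofStrict F) (c.freeze j)) :
    Agree (𝟙 B) (ofStrict (F ≫ G)) ((c.postcomp G).freeze j) where
  obj ε x := congrArg G.obj (a.obj ε x)
  map ε f := congrArg G.map (a.map ε f)
  map₂ ε α := congrArg G.map₂ (a.map₂ ε α)
  con ε η g f h h' := (congrArg G.map₂ (a.con ε η g f h h')).trans (G.map₂_two _)

/-- The restriction of a linear cylinder to an end is linear, and so is the cylinder on a strict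
2-functor. By `IsLinear.agree` it suffices to compare them on `B`, where the end of `K` is known. -/
theorem IsLinear.agree_freeze (P : SievePushout u i i' v χ χ') {G : A' ⟶ D} {K : Cyl B D}
    {c : Cyl B' D} (l : IsLinear i' G c) (a : Agree v K c) {F : B ⟶ D} {F' : B' ⟶ D}
    {j : interval.{w}.Obj} (h : Agree (𝟙 B) (ofStrict F) (K.freeze j)) (hv : v ≫ F' = F)
    (hi : i' ≫ F' = G) : Agree (𝟙 B') (ofStrict F') (c.freeze j) := by
  subst hv
  refine IsLinear.agree P (isLinear_ofStrict hi) (l.freeze j) (K := K.freeze j) ?_ ?_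
  · exact
    { obj := fun ε x => (h.obj ε x).symm
      map := fun ε f => (h.map ε f).symm
      map₂ := fun ε α => (h.map₂ ε α).symm
      con := fun ε η g f hεη hgf => (congrArg D.two (congrArg F'.map (v.map_cmp hgf).symm)).trans
        (h.con ε η g f hεη hgf).symm }
  · exact
    { obj := fun _ => a.obj j
      map := fun _ => a.map _
      map₂ := fun _ => a.map₂ _
      con := fun _ _ g f _ => a.con _ _ g f (by rw [interval.src_one, interval.tgt_one]) }

end Cyl

namespace StrongOplaxRetract

open Cyl

variable {A B A' B' : TwoCat.{w}} {i : A ⟶ B}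

theorem ext_of_eq {S T : StrongOplaxRetract i} (hr : S.r = T.r)
    (hH : S.homotopy.H = T.homotopy.H) : S = T := by
  obtain ⟨r, _, ⟨H, _, _⟩, _, _, _⟩ := S
  obtain ⟨r', _, ⟨H', _, _⟩, _, _, _⟩ := T
  cases hr
  cases hH
  rfl

/-- A strong oplax deformation retract structure, from a linear cylinder. -/
noncomputable def ofCyl (r : B ⟶ A) (hr : i ≫ r = 𝟙 A) (c : Cyl B B) (l : IsLinear i i c)
    (h₀ : Agree (𝟙 B) (ofStrict (r ≫ i)) (c.freeze (endpt 0)))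
    (h₁ : Agree (𝟙 B) (ofStrict (𝟙 B)) (c.freeze (endpt 1))) : StrongOplaxRetract i where
  r := r
  retraction := hr
  homotopy :=
    { H := c.toOplax
      at_zero := toOplax_comp_face_iff.2 h₀
      at_one := toOplax_comp_face_iff.2 h₁ }
  relative := (toOplax_comp_prodMap_iff.2
    { obj := l.obj
      map := l.map
      map₂ := l.map₂
      con := l.con }).trans (toOplax_ofStrict i)
  map_comp g f h := by
    refine (congrArg (c.map arrow) (comp_eq h)).trans ((l.map_cmp arrow g f h).trans ?_)
    rw [comp_eq]
    exact congrArg (B.cmp (c.map arrow g)) (l.map _ f).symm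
  constr_eq g f h := (l.con_one arrow g f h).trans
    (congrArg (fun x => B.two (c.map arrow x)) (comp_eq h).symm)

variable {u : A ⟶ A'} {i' : A' ⟶ B'} {v : B ⟶ B'}

-- The retraction glues `1` and `ur`, which agree over `A` because `ri = 1`. The homotopy is the
-- extension of the linear cylinder `vH`, and its two ends are identified by `agree_freeze`.
open Classical in
theorem exists_of_isPushout (sq : IsPushout u i i' v) (hi : IsSieve i)
    (S : StrongOplaxRetract i) :
    ∃ T : StrongOplaxRetract i', v ≫ T.r = S.r ≫ u ∧
      T.homotopy.H.comp (oplax (prodMap interval v)) = (oplax v).comp S.homotopy.H := by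
  obtain ⟨χ, χ', P⟩ := exists_sievePushout sq hi
  have hw : u ≫ 𝟙 A' = i ≫ S.r ≫ u := by
    rw [← Category.assoc, S.retraction, Category.comp_id, Category.id_comp]
  let r : B' ⟶ A' := sq.desc (𝟙 A') (S.r ≫ u) hw
  have hr : i' ≫ r = 𝟙 A' := sq.inl_desc _ _ _
  have hv : v ≫ r = S.r ≫ u := sq.inr_desc _ _ _
  have hv' : v ≫ r ≫ i' = (S.r ≫ i) ≫ v := by
    rw [← Category.assoc, hv, Category.assoc, sq.w, Category.assoc]
  have l : IsLinear i (u ≫ i') (S.cyl.postcomp v) := by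
    rw [sq.w]
    exact S.isLinear.postcomp v
  -- The cylinder must be `i'r'` at the end `0` and the identity at the end `1`, which fixes it on
  -- objects.
  let o : interval.{w}.Obj → B'.Obj → B'.Obj := fun j x =>
    if j = endpt 0 then i'.obj (r.obj x) else x
  have o₀ : ∀ x, o (endpt 0) x = i'.obj (r.obj x) := fun x => if_pos rfl
  have o₁ : ∀ x, o (endpt 1) x = x := fun x => if_neg endpt_ne.symm
  obtain ⟨c, l', a⟩ := l.exists_extend (o := o) P (fun j x => by
    obtain rfl | rfl := endpt_cases j
    · exact (o₀ _).trans ((congr_functor_obj hv' x).trans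
        (congrArg v.obj (S.agree_zero.obj (endpt 0) x)).symm)
    · exact (o₁ _).trans (congrArg v.obj (S.agree_one.obj (endpt 1) x)).symm) (fun j a => by
    obtain rfl | rfl := endpt_cases j
    · exact ((o₀ _).trans (congrArg i'.obj (congr_functor_obj hr a))).symm
    · exact (o₁ _).symm)
  refine ⟨ofCyl r hr c l' ?_ ?_, hv, ?_⟩
  · exact l'.agree_freeze P a (S.agree_zero.postcomp_freeze v) hv'
      (by rw [← Category.assoc, hr, Category.id_comp])
  · exact l'.agree_freeze P a (S.agree_one.postcomp_freeze v)
      (by rw [Category.comp_id, Category.id_comp]) (Category.comp_id _)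
  · exact (toOplax_comp_prodMap_iff.2 a).trans (by rw [toOplax_postcomp, toOplax_cyl])

/-- The restrictions of `r'` to `A'` and `B` are prescribed, and both homotopies are linear
cylinders restricting to `vH` on `B`. -/
theorem eq_of_isPushout (sq : IsPushout u i i' v) (hi : IsSieve i)
    (S : StrongOplaxRetract i) {T T' : StrongOplaxRetract i'} (hr : v ≫ T.r = S.r ≫ u)
    (hH : T.homotopy.H.comp (oplax (prodMap interval v)) = (oplax v).comp S.homotopy.H)
    (hr' : v ≫ T'.r = S.r ≫ u)
    (hH' : T'.homotopy.H.comp (oplax (prodMap interval v)) = (oplax v).comp S.homotopy.H) :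
    T = T' := by
  obtain ⟨χ, χ', P⟩ := exists_sievePushout sq hi
  have key : ∀ T : StrongOplaxRetract i',
      T.homotopy.H.comp (oplax (prodMap interval v)) = (oplax v).comp S.homotopy.H →
      Agree v (S.cyl.postcomp v) T.cyl := fun T h =>
    toOplax_comp_prodMap_iff.1 (by rw [toOplax_postcomp, toOplax_cyl, toOplax_cyl, h])
  refine ext_of_eq (sq.hom_ext ?_ ?_) ?_
  · rw [T.retraction, T'.retraction]
  · rw [hr, hr']
  · rw [← toOplax_cyl, ← toOplax_cyl]
    exact (T'.isLinear.agree P T.isLinear (key T' hH') (key T hH)).toOplax_eq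

end StrongOplaxRetract

end TwoCat

theorem proposition6p20 {A B A' B' : TwoCat.{w}} (i : A ⟶ B) (u : A ⟶ A') (i' : A' ⟶ B')
    (v : B ⟶ B') (sq : IsPushout u i i' v) (hi : TwoCat.IsSieve i) :
    (TwoCat.IsStrongOplaxRetractSieve i → TwoCat.IsStrongOplaxRetractSieve i') ∧
    TwoCat.IsSieve i' ∧
    ∀ S : TwoCat.StrongOplaxRetract i, ∃! S' : TwoCat.StrongOplaxRetract i',
      v ≫ S'.r = S.r ≫ u ∧
      S'.homotopy.H.comp (TwoCat.oplax (TwoCat.prodMap TwoCat.interval v)) =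
        (TwoCat.oplax v).comp S.homotopy.H := by
  have hi' : TwoCat.IsSieve i' := by
    obtain ⟨χ, χ', P⟩ := TwoCat.exists_sievePushout sq hi
    exact P.sieve'.isSieve
  refine ⟨fun h => ⟨hi', ?_⟩, hi', fun S => ?_⟩
  · obtain ⟨S⟩ := h.2
    obtain ⟨T, -⟩ := S.exists_of_isPushout sq hi
    exact ⟨T⟩
  · obtain ⟨T, hT⟩ := S.exists_of_isPushout sq hi
    exact ⟨T, hT, fun T' hT' => S.eq_of_isPushout sq hi hT'.1 hT'.2 hT.1 hT.2⟩
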